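/- **Setting.** Let $\tau_j=-\tfrac{\mathbf i}{2}\sigma_j$ ($\sigma_j$ the Pauli matrices), identify $v\in\mathbb R^3$ with $v^j\tau_j\in su(2)$, and put $\mathrm{Tr}(XY)=-2\,\mathrm{tr}(XY)$. Let $\gamma$ be a cubic graph on $\mathbb T^3$: the periodic cubic lattice with vertex set $\prod_{i=1}^3\mathbb Z/L_i$, $L_i\ge 2$, and edges $e$ running from $s(e)$ to $t(e)$ in the positive coordinate directions. Assume that a choice of minimal loops is given: a set of elementary squares such that each edge lies in exactly one of them, and a numbering $e_1(v),\dots,e_6(v)$ of the six edge ends at each vertex $v$ such that $e_1(v),e_2(v)$ lie in the same square, as do $e_3(v),e_4(v)$ and $e_5(v),e_6(v)$. The twisted-geometry space $P_\gamma^+$ consists of the families $(V_e,\tilde V_e,\eta_e,\xi_e)_e$ with $V_e,\tilde V_e\in S^2$, $\eta_e\ge 0$, $\xi_e\in S^1=\mathbb R/2\pi\mathbb Z$. Fix sections $n_e,\tilde n_e,n_v:S^2\to SU(2)$ (for edges $e$ and vertices $v$) with $V=n_e(V)\tau_3n_e(V)^{-1}$, $V=-\tilde n_e(V)\tau_3\tilde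 n_e(V)^{-1}$, $V=n_v(V)\tau_3n_v(V)^{-1}$; no section is continuous on all of $S^2$, and statements about derivatives are made at points near which the sections involved are smooth. For constants $a,\kappa>0$ the symplectic potential is $$\Theta=\frac{a^2}{\kappa}\sum_e\left(\eta_e\mathrm{Tr}(V_edn_en_e^{-1})+\eta_ed\xi_e+\eta_e\mathrm{Tr}(\tilde V_ed\tilde n_e\tilde n_e^{-1})\right).$$ **Variables.** For an end of an edge $e$ at $v$ let $\mathcal V_{e(v)}=V_e$ if $s(e)=v$ and $\mathcal V_{e(v)}=\tilde V_e$ if $t(e)=v$. Let $G_v=-\sum_{s(e)=v}\eta_eV_e-\sum_{t(e)=v}\eta_e\tilde V_e$. Put $\vec\eta_{v,1}=\eta_{e_1(v)}\mathcal V_{e_1(v)}+\eta_{e_2(v)}\mathcal V_{e_2(v)}$, $\vec\eta_{v,2}=\eta_{e_3(v)}\mathcal V_{e_3(v)}+\eta_{e_4(v)}\mathcal V_{e_4(v)}$, $\vec\eta_{v,3}=\eta_{e_5(v)}\mathcal V_{e_5(v)}+\eta_{e_6(v)}\mathcal V_{e_6(v)}$, $\vec\eta_{v,4}=\vec\eta_{v,1}+\vec\eta_{v,2}$,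 $\eta_{v,I}=|\vec\eta_{v,I}|$, $\breve\eta_v=|G_v|$, and $\mathcal V_v=-G_v/\breve\eta_v$ (the unit vector along $\sum_I\eta_{e_I(v)}\mathcal V_{e_I(v)}$). For nonzero $u,w\perp k\neq 0$ let $\angle_k(u,w)\in\mathbb R/2\pi\mathbb Z$ be the oriented angle from $u$ to $w$ of right-handed rotation about $k$. Put $$\varrho_{v,1}=\angle_{\vec\eta_{v,1}}(\vec\eta_{v,1}\times\vec\eta_{v,2},\,\mathcal V_{e_1(v)}\times\mathcal V_{e_2(v)}),\qquad \varrho_{v,2}=\angle_{\vec\eta_{v,2}}(\vec\eta_{v,1}\times\vec\eta_{v,2},\,\mathcal V_{e_3(v)}\times\mathcal V_{e_4(v)}),$$ $$\varrho_{v,3}=\angle_{\vec\eta_{v,3}}(\vec\eta_{v,3}\times\vec\eta_{v,4},\,\mathcal V_{e_5(v)}\times\mathcal V_{e_6(v)}),\qquad \varrho_{v,4}=\angle_{\vec\eta_{v,4}}(\vec\eta_{v,3}\times\vec\eta_{v,4},\,\vec\eta_{v,1}\times\vec\eta_{v,2}),$$ $$\breve\varrho_v=\angle_{\mathcal V_v}\big((n_v\tau_2n_v^{-1})\times\mathcal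 V_v,\ \vec\eta_{v,3}\times\mathcal V_v\big),\qquad n_v=n_v(\mathcal V_v).$$ For an edge $e$ let $e_s,e_t$ be the neighbours of $e$ in its minimal loop at $s(e)$ and $t(e)$. Let $\zeta_e$ be the angle such that the rotation given by $h^\Gamma_e=n_e(V_e)e^{\zeta_e\tau_3}\tilde n_e(\tilde V_e)^{-1}$ takes the direction of $\tilde V_e\times\mathcal V_{e_t(t(e))}$ to that of $\mathcal V_{e_s(s(e))}\times V_e$, and put $\varrho_e=\xi_e-\zeta_e$. **Theorem.** (1) Let $\dot P_\gamma^+\subset P_\gamma^+$ be the set where, for all $e$ and $v$, $\eta_e>0$, $\breve\eta_v>0$, and the strict triangle inequalities hold for the triples $(\eta_{v,1},\eta_{e_1(v)},\eta_{e_2(v)})$, $(\eta_{v,2},\eta_{e_3(v)},\eta_{e_4(v)})$, $(\eta_{v,3},\eta_{e_5(v)},\eta_{e_6(v)})$, $(\eta_{v,4},\eta_{v,1},\eta_{v,2})$, $(\eta_{v,4},\eta_{v,3},\breve\eta_v)$. The variables $(\eta_e,\varrho_e)$, $(\eta_{v,I},\varrho_{v,I})_{I=1,\dots,4}$, $(\breve\eta_v,\breve\varrho_v)$,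 $\mathcal V_v$ map $\dot P_\gamma^+$ bijectively onto the set of all real numbers $\eta_e$, $\eta_{v,I}$, $\breve\eta_v$ subject to these inequalities, angles $\varrho_e$, $\varrho_{v,I}$, $\breve\varrho_v$ and unit vectors $\mathcal V_v$. Near every point at which the sections are smooth, this re-parametrization is smooth in both directions, and there $$\Theta_{\dot P_\gamma^+}=\frac{a^2}{\kappa}\left(\sum_e\eta_ed\varrho_e+\sum_v\Big(\breve\eta_v\mathrm{Tr}(\mathcal V_vdn_vn_v^{-1})+\sum_{I=1}^4\eta_{v,I}d\varrho_{v,I}+\breve\eta_vd\breve\varrho_v\Big)\right).$$ (2) Let $\dot H_\gamma^+$ be the set of points of $P_\gamma^+$ with $G_v=0$, $\eta_e>0$ for all $e$ and $v$, and strict triangle inequalities for $(\eta_{v,1},\eta_{e_1(v)},\eta_{e_2(v)})$, $(\eta_{v,2},\eta_{e_3(v)},\eta_{e_4(v)})$, $(\eta_{v,3},\eta_{e_5(v)},\eta_{e_6(v)})$, $(\eta_{v,3},\eta_{v,1},\eta_{v,2})$, modulo the gauge transformations $V_e\mapsto g_{s(e)}V_eg_{s(e)}^{-1}$, $\tilde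 V_e\mapsto g_{t(e)}\tilde V_eg_{t(e)}^{-1}$, $\eta_e\mapsto\eta_e$, $\xi_e\mapsto\xi_e+\alpha-\beta$ with $g_v\in SU(2)$, where $g_{s(e)}n_e(V_e)=n_e(g_{s(e)}V_eg_{s(e)}^{-1})e^{\alpha\tau_3}$ and $g_{t(e)}\tilde n_e(\tilde V_e)=\tilde n_e(g_{t(e)}\tilde V_eg_{t(e)}^{-1})e^{\beta\tau_3}$. With $\varrho_{v,3}$ now replaced by $\angle_{\vec\eta_{v,3}}(\vec\eta_{v,1}\times\vec\eta_{v,2},\mathcal V_{e_5(v)}\times\mathcal V_{e_6(v)})$, the variables $(\eta_e,\varrho_e)$, $(\eta_{v,I},\varrho_{v,I})_{I=1,2,3}$ are gauge invariant and map $\dot H_\gamma^+$ bijectively onto the set of all values subject to these inequalities. Near points at which the sections $n_e,\tilde n_e$ are smooth they are smooth on the constraint surface, every smooth curve of their values lifts locally, through any prescribed preimage, to a smooth curve in the constraint surface, and the restriction of $\Theta$ to the constraint surface is the pullback of $$\Theta_{\dot H_\gamma^+}=\frac{a^2}{\kappa}\left(\sum_e\eta_ed\varrho_e+\sum_v\sum_{I=1}^3\eta_{v,I}d\varrho_{v,I}\right).$$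 -/

import Mathlib

open scoped Matrix ContDiff Topology

noncomputable section

namespace TwistedGeometry

/-! ### `SU(2)`, `su(2)` and vectors in three dimensions -/

/-- The space of internal vectors `(v^i)`, `i = 1, 2, 3`. -/
abbrev R3 : Type := Fin 3 → ℝ

abbrev SU2 : Type := Matrix.specialUnitaryGroup (Fin 2) ℂ

/-- `τ_i = -(i/2) σ_i`, with `σ_i` the Pauli matrices (indices start at `0`). -/
def tau : Fin 3 → Matrix (Fin 2) (Fin 2) ℂ :=
  ![(-(Complex.I / 2)) • !![0, 1; 1, 0],
    (-(Complex.I / 2)) • !![0, -Complex.I; Complex.I, 0],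
    (-(Complex.I / 2)) • !![1, 0; 0, -1]]

/-- The element `v^i τ_i` of `su(2)`. -/
def su2 (v : R3) : Matrix (Fin 2) (Fin 2) ℂ := ∑ i, (v i : ℂ) • tau i

/-- `Tr(XY) = -2 tr(XY)`, which is real for `X, Y ∈ su(2)`; it makes `τ_1, τ_2, τ_3` orthonormal. -/
def Tr (X Y : Matrix (Fin 2) (Fin 2) ℂ) : ℝ := (-2 * (X * Y).trace).re

/-- The one-parameter subgroup `e^{θ τ_3}`. -/
def expTau3 (θ : ℝ) : Matrix (Fin 2) (Fin 2) ℂ := NormedSpace.exp ((θ : ℂ) • tau 2)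

/-- The adjoint action: the vector `w` with `w^i τ_i = g (v^i τ_i) g⁻¹`. -/
def rot (g : SU2) (v : R3) : R3 := fun i => Tr (tau i) (g.1 * su2 v * (g⁻¹).1)

/-- The Euclidean length `√(δ_{ij} v^i v^j)`. -/
def len (v : R3) : ℝ := Real.sqrt (v ⬝ᵥ v)

/-- The oriented angle about the axis `k` from `u` to `w`, for nonzero `u`, `w` orthogonal to
`k ≠ 0`: the angle `θ` (modulo `2π`) such that the right-handed rotation by `θ` about `k` takes the
direction of `u` to that of `w`. For `u = a × b` and `w = c × d` it is the oriented dihedral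
angle from the plane identified by the vectors `(a, b)` to the plane identified by `(c, d)`. -/
def angleAbout (k u w : R3) : Real.Angle :=
  ((Complex.arg ⟨len k * (u ⬝ᵥ w), k ⬝ᵥ (u ⨯₃ w)⟩ : ℝ) : Real.Angle)

/-! ### Angle-valued functions along curves -/

/-- An `S¹`-valued curve is smooth at time `t`. -/
def SmoothAngleAt (θ : ℝ → Real.Angle) (t : ℝ) : Prop :=
  ContDiffAt ℝ ∞ (fun s => (θ s).cos) t ∧ ContDiffAt ℝ ∞ (fun s => (θ s).sin) t

/-- The angle form `dθ = cos θ d(sin θ) - sin θ d(cos θ)` on the velocity of an `S¹`-valued curve. -/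
def angleDeriv (θ : ℝ → Real.Angle) (t : ℝ) : ℝ :=
  (θ t).cos * deriv (fun s => (θ s).sin) t - (θ t).sin * deriv (fun s => (θ s).cos) t

/-! ### The cubic graph on the three-torus -/

variable (L : Fin 3 → ℕ)

/-- Vertices of the periodic cubic lattice with `L 0 × L 1 × L 2` vertices. -/
abbrev Vertex : Type := ∀ i : Fin 3, ZMod (L i)

/-- The edge `(v, i)` starts at `v` and runs in the positive `i`-th coordinate direction. -/
abbrev Edge : Type := Vertex L × Fin 3

/-- The two ends of the edges at a vertex: `(i, true)` stands for `e(v, +i)`, the edge that starts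
at `v` in the direction `i`; `(i, false)` for `e(v, -i)`, the edge in direction `i` that ends at `v`. -/
abbrev HalfEdge : Type := Fin 3 × Bool

/-- An elementary square, given by its lowest corner and its normal direction. -/
abbrev Square : Type := Vertex L × Fin 3

variable {L}

/-- The unit step in direction `i`. -/
def step (i : Fin 3) : Vertex L := Pi.single i 1

def source (e : Edge L) : Vertex L := e.1

def target (e : Edge L) : Vertex L := e.1 + step e.2

/-- The edge of the graph of which `h` is a half at the vertex `v`. -/
def edgeAt (v : Vertex L) (h : HalfEdge) : Edge L := if h.2 then (v, h.1) else (v - step h.1, h.1)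

/-- The four edges of the minimal loop around a square. -/
def Square.edges (p : Square L) : Finset (Edge L) :=
  {(p.1, p.2 + 1), (p.1 + step (p.2 + 2), p.2 + 1), (p.1, p.2 + 2), (p.1 + step (p.2 + 1), p.2 + 2)}

variable (L) in
/-- A choice of minimal loops for the whole graph: the graph is composed of minimal square loops,
each edge `e` belonging to one and only one of them, `loop e`. The six edges `e_1(v), …, e_6(v)`
linked to a vertex `v` are numbered so that `e_1(v), e_2(v)` lie in the same loop, and so do
`e_3(v), e_4(v)` and `e_5(v), e_6(v)` (numbers start at `0` below). -/
structure LoopChoice where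
  loop : Edge L → Square L
  mem_loop : ∀ e, e ∈ (loop e).edges
  loop_unique : ∀ e f, f ∈ (loop e).edges → loop f = loop e
  label : Vertex L → Fin 6 ≃ HalfEdge
  loop_01 : ∀ v, loop (edgeAt v (label v 0)) = loop (edgeAt v (label v 1))
  loop_23 : ∀ v, loop (edgeAt v (label v 2)) = loop (edgeAt v (label v 3))
  loop_45 : ∀ v, loop (edgeAt v (label v 4)) = loop (edgeAt v (label v 5))

/-- The other half-edge at `v` that lies in the same minimal loop. -/
def LoopChoice.partner (D : LoopChoice L) (v : Vertex L) (h : HalfEdge) : HalfEdge :=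
  D.label v (![1, 0, 3, 2, 5, 4] ((D.label v).symm h))

/-! ### The twisted geometry space -/

variable (L) in
/-- The branch `P_γ^+` (all `η_e ≥ 0`) of the product over the edges of `S² × S² × T*S¹`. -/
@[ext] structure Point where
  V : Edge L → R3
  Vt : Edge L → R3
  η : Edge L → ℝ
  ξ : Edge L → Real.Angle
  V_unit : ∀ e, V e ⬝ᵥ V e = 1
  Vt_unit : ∀ e, Vt e ⬝ᵥ Vt e = 1
  η_nonneg : ∀ e, 0 ≤ η e

/-- A curve in `P_γ^+` is smooth at time `t`. -/
def Point.SmoothAt (c : ℝ → Point L) (t : ℝ) : Prop :=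
  (∀ e, ContDiffAt ℝ ∞ (fun s => (c s).V e) t) ∧
  (∀ e, ContDiffAt ℝ ∞ (fun s => (c s).Vt e) t) ∧
  (∀ e, ContDiffAt ℝ ∞ (fun s => (c s).η e) t) ∧
  (∀ e, SmoothAngleAt (fun s => (c s).ξ e) t)

variable (L) in
/-- The sections `n_e`, `ñ_e`, `n_v` of `SU(2) → S²`, with `V = n τ_3 n⁻¹` for `n_e` and `n_v` and
`V = -ñ τ_3 ñ⁻¹` for `ñ_e`. No section is continuous on all of `S²`, so that no regularity is
imposed here (see `SectionSmoothAt`); values off the unit sphere play no role. -/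
structure Sections where
  n : Edge L → R3 → SU2
  nt : Edge L → R3 → SU2
  nv : Vertex L → R3 → SU2
  n_spec : ∀ e V, V ⬝ᵥ V = 1 → su2 V = (n e V).1 * tau 2 * ((n e V)⁻¹).1
  nt_spec : ∀ e V, V ⬝ᵥ V = 1 → su2 V = -((nt e V).1 * tau 2 * ((nt e V)⁻¹).1)
  nv_spec : ∀ v V, V ⬝ᵥ V = 1 → su2 V = (nv v V).1 * tau 2 * ((nv v V)⁻¹).1

/-- The map `n` is smooth, as a map on the unit sphere, on a neighbourhood of `V`. -/
def SectionSmoothAt (n : R3 → SU2) (V : R3) : Prop :=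
  ∃ (U : Set R3) (f : R3 → Matrix (Fin 2) (Fin 2) ℂ), IsOpen U ∧ V ∈ U ∧
    (∀ i j, ContDiffOn ℝ ∞ (fun W => f W i j) U) ∧ ∀ W ∈ U, W ⬝ᵥ W = 1 → f W = (n W).1

/-- `Tr(V dn n⁻¹)` on the velocity at time `t` of a curve `V` in the sphere, where `n = n(V)`. -/
def sphereForm (n : R3 → SU2) (V : ℝ → R3) (t : ℝ) : ℝ :=
  Tr (su2 (V t)) ((Matrix.of fun i j => deriv (fun s => (n (V s)).1 i j) t) * ((n (V t))⁻¹).1)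

section

variable [∀ i, NeZero (L i)]

/-- The symplectic potential `Θ_{P_γ}` on the velocity at time `t` of a curve `c`. -/
def potential (a κ : ℝ) (S : Sections L) (c : ℝ → Point L) (t : ℝ) : ℝ :=
  a ^ 2 / κ * ∑ e,
    ((c t).η e * sphereForm (S.n e) (fun s => (c s).V e) t
      + (c t).η e * angleDeriv (fun s => (c s).ξ e) t
      + (c t).η e * sphereForm (S.nt e) (fun s => (c s).Vt e) t)

end

/-- The unit vector `𝒱_{e(v)}`: `V_e` if `e` starts at `v`, `Ṽ_e` if `e` ends at `v`. -/
def Point.normal (x : Point L) (v : Vertex L) (h : HalfEdge) : R3 :=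
  if h.2 then x.V (edgeAt v h) else x.Vt (edgeAt v h)

/-- The Gauss constraint `G_v = -∑_{s(e)=v} η_e V_e - ∑_{t(e)=v} η_e Ṽ_e`. -/
def Point.gauss (x : Point L) (v : Vertex L) : R3 :=
  -∑ h : HalfEdge, x.η (edgeAt v h) • x.normal v h

/-! ### The new variables -/

variable (D : LoopChoice L)

/-- The angle `ζ_e` of the holonomy `h^Γ_e = n_e e^{ζ_e τ_3} ñ_e⁻¹ = e^{ζ_e V_e} n_e ñ_e⁻¹` of the
spin connection, determined by the alignment along the minimal loop of `e`: the rotation defined by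
`h^Γ_e` takes the direction of `Ṽ_e × 𝒱_{e_t}` to that of `𝒱_{e_s} × V_e`, where `e_s` and `e_t`
are the edges of the loop next to `e` at the source and at the target of `e`. -/
def zeta (S : Sections L) (x : Point L) (e : Edge L) : Real.Angle :=
  angleAbout (x.V e)
    (rot (S.n e (x.V e) * (S.nt e (x.Vt e))⁻¹)
      (x.Vt e ⨯₃ x.normal (target e) (D.partner (target e) (e.2, false))))
    (x.normal (source e) (D.partner (source e) (e.2, true)) ⨯₃ x.V e)

/-- The angle `ϱ_e = ξ_e - ζ_e`. -/
def rho (S : Sections L) (x : Point L) (e : Edge L) : Real.Angle := x.ξ e - zeta D S x e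

/-- The number `η_{e_I(v)}` (with `I` starting at `0`). -/
def etaL (x : Point L) (v : Vertex L) (I : Fin 6) : ℝ := x.η (edgeAt v (D.label v I))

/-- The unit vector `𝒱_{e_I(v)}` (with `I` starting at `0`). -/
def normalL (x : Point L) (v : Vertex L) (I : Fin 6) : R3 := x.normal v (D.label v I)

/-- The vectors `η_{v,1} = η_{e_1} 𝒱_{e_1} + η_{e_2} 𝒱_{e_2}`, likewise `η_{v,2}` and `η_{v,3}`, and
`η_{v,4} = η_{v,1} + η_{v,2}`; here and below the index starts at `0`. -/
def etaVec (x : Point L) (v : Vertex L) : Fin 4 → R3 :=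
  let w : Fin 6 → R3 := fun I => etaL D x v I • normalL D x v I
  ![w 0 + w 1, w 2 + w 3, w 4 + w 5, (w 0 + w 1) + (w 2 + w 3)]

/-- The modulus `η̆_v` of the Gauss constraint. -/
def etaBreve (x : Point L) (v : Vertex L) : ℝ := len (x.gauss v)

/-- The direction `𝒱_v` of the side that closes the polygon of the vectors `η_{e_I} 𝒱_{e_I}`,
drawn from its initial point to its final point: `η̆_v 𝒱_v = ∑_I η_{e_I} 𝒱_{e_I} = -G_v`. -/
def normalV (x : Point L) (v : Vertex L) : R3 := -((etaBreve x v)⁻¹ • x.gauss v)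

/-- The angles `ϱ_{v,I}`, each measured about the common line `η_{v,I}` of the two planes. -/
def rhoV (x : Point L) (v : Vertex L) : Fin 4 → Real.Angle :=
  let N : Fin 6 → R3 := normalL D x v
  let E : Fin 4 → R3 := etaVec D x v
  ![angleAbout (E 0) (E 0 ⨯₃ E 1) (N 0 ⨯₃ N 1),
    angleAbout (E 1) (E 0 ⨯₃ E 1) (N 2 ⨯₃ N 3),
    angleAbout (E 2) (E 2 ⨯₃ E 3) (N 4 ⨯₃ N 5),
    angleAbout (E 3) (E 2 ⨯₃ E 3) (E 0 ⨯₃ E 1)]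

/-- The angle `ϱ̆_v` about `𝒱_v` from the plane of `(n τ_2 n⁻¹, 𝒱_v)`, `n = n_v(𝒱_v)`, to the plane of
`(η_{v,3}, 𝒱_v)`. -/
def rhoBreve (S : Sections L) (x : Point L) (v : Vertex L) : Real.Angle :=
  angleAbout (normalV x v)
    (rot (S.nv v (normalV x v)) ![0, 1, 0] ⨯₃ normalV x v)
    (etaVec D x v 2 ⨯₃ normalV x v)

/-- The strict triangle inequality `|b - c| < a < b + c`. -/
def Triangle (a b c : ℝ) : Prop := |b - c| < a ∧ a < b + c

variable (L) in
/-- Values of the variables `(η_e, ϱ_e)`, `(η_{v,I}, ϱ_{v,I})` for `I = 1, …, 4`, `(η̆_v, ϱ̆_v)`, `𝒱_v`. -/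
@[ext] structure Variables where
  η : Edge L → ℝ
  ρ : Edge L → Real.Angle
  ηv : Vertex L → Fin 4 → ℝ
  ρv : Vertex L → Fin 4 → Real.Angle
  ηb : Vertex L → ℝ
  ρb : Vertex L → Real.Angle
  W : Vertex L → R3

def Variables.SmoothAt (q : ℝ → Variables L) (t : ℝ) : Prop :=
  (∀ e, ContDiffAt ℝ ∞ (fun s => (q s).η e) t) ∧
  (∀ e, SmoothAngleAt (fun s => (q s).ρ e) t) ∧
  (∀ v I, ContDiffAt ℝ ∞ (fun s => (q s).ηv v I) t) ∧
  (∀ v I, SmoothAngleAt (fun s => (q s).ρv v I) t) ∧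
  (∀ v, ContDiffAt ℝ ∞ (fun s => (q s).ηb v) t) ∧
  (∀ v, SmoothAngleAt (fun s => (q s).ρb v) t) ∧
  (∀ v, ContDiffAt ℝ ∞ (fun s => (q s).W v) t)

/-- The inequalities that define the interior of `P_γ^+`, together with `𝒱_v ∈ S²`. -/
def variablesRange : Set (Variables L) :=
  {q | (∀ e, 0 < q.η e) ∧ ∀ v,
    Triangle (q.ηv v 0) (q.η (edgeAt v (D.label v 0))) (q.η (edgeAt v (D.label v 1))) ∧
    Triangle (q.ηv v 1) (q.η (edgeAt v (D.label v 2))) (q.η (edgeAt v (D.label v 3))) ∧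
    Triangle (q.ηv v 2) (q.η (edgeAt v (D.label v 4))) (q.η (edgeAt v (D.label v 5))) ∧
    Triangle (q.ηv v 3) (q.ηv v 0) (q.ηv v 1) ∧
    Triangle (q.ηv v 3) (q.ηv v 2) (q.ηb v) ∧
    0 < q.ηb v ∧ q.W v ⬝ᵥ q.W v = 1}

/-- The new variables as functions on `P_γ^+`. -/
def newVariables (S : Sections L) (x : Point L) : Variables L where
  η := x.η
  ρ := rho D S x
  ηv := fun v I => len (etaVec D x v I)
  ρv := rhoV D x
  ηb := etaBreve x
  ρb := rhoBreve D S x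
  W := normalV x

/-- The interior of `P_γ^+`. -/
def interiorP : Set (Point L) :=
  {x | (∀ e, 0 < x.η e) ∧ ∀ v,
    Triangle (len (etaVec D x v 0)) (etaL D x v 0) (etaL D x v 1) ∧
    Triangle (len (etaVec D x v 1)) (etaL D x v 2) (etaL D x v 3) ∧
    Triangle (len (etaVec D x v 2)) (etaL D x v 4) (etaL D x v 5) ∧
    Triangle (len (etaVec D x v 3)) (len (etaVec D x v 0)) (len (etaVec D x v 1)) ∧
    Triangle (len (etaVec D x v 3)) (len (etaVec D x v 2)) (etaBreve x v) ∧
    0 < etaBreve x v}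

/-- The sections of the edges are smooth near the values that they take at `x`. -/
def EdgeRegular (S : Sections L) (x : Point L) : Prop :=
  ∀ e, SectionSmoothAt (S.n e) (x.V e) ∧ SectionSmoothAt (S.nt e) (x.Vt e)

/-- The sections of the vertices are smooth near the values that they take at `x`. -/
def VertexRegular (S : Sections L) (x : Point L) : Prop :=
  ∀ v, SectionSmoothAt (S.nv v) (normalV x v)

section

variable [∀ i, NeZero (L i)]

/-- `(a²/κ) (∑_e η_e dϱ_e + ∑_v (η̆_v Tr(𝒱_v dn_v n_v⁻¹) + ∑_{I=1}^4 η_{v,I} dϱ_{v,I} + η̆_v dϱ̆_v))`. -/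
def newPotential (a κ : ℝ) (S : Sections L) (q : ℝ → Variables L) (t : ℝ) : ℝ :=
  a ^ 2 / κ * (∑ e, (q t).η e * angleDeriv (fun s => (q s).ρ e) t
    + ∑ v, ((q t).ηb v * sphereForm (S.nv v) (fun s => (q s).W v) t
      + ∑ I, (q t).ηv v I * angleDeriv (fun s => (q s).ρv v I) t
      + (q t).ηb v * angleDeriv (fun s => (q s).ρb v) t))

end

/-! ### Gauge transformations and the reduced space -/

/-- `y` is the image of `x` under the gauge transformation `g`: `V_e ↦ g_{s(e)} V_e g_{s(e)}⁻¹`,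
`Ṽ_e ↦ g_{t(e)} Ṽ_e g_{t(e)}⁻¹`, `η_e ↦ η_e` and `ξ_e ↦ ξ_e + α - β`, where `α`, `β` are determined by
`g_{s(e)} n_e(V_e) = n_e(V'_e) e^{α τ_3}` and `g_{t(e)} ñ_e(Ṽ_e) = ñ_e(Ṽ'_e) e^{β τ_3}`. -/
def IsGaugeTransform (S : Sections L) (g : Vertex L → SU2) (x y : Point L) : Prop :=
  ∀ e, su2 (y.V e) = (g (source e)).1 * su2 (x.V e) * ((g (source e))⁻¹).1 ∧
    su2 (y.Vt e) = (g (target e)).1 * su2 (x.Vt e) * ((g (target e))⁻¹).1 ∧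
    y.η e = x.η e ∧
    ∃ α β : ℝ,
      (g (source e)).1 * (S.n e (x.V e)).1 = (S.n e (y.V e)).1 * expTau3 α ∧
      (g (target e)).1 * (S.nt e (x.Vt e)).1 = (S.nt e (y.Vt e)).1 * expTau3 β ∧
      y.ξ e = x.ξ e + ((α - β : ℝ) : Real.Angle)

/-- The part of the constraint surface `G_v = 0` that lies over the interior of `H_γ^+`. -/
def constraintInterior : Set (Point L) :=
  {x | (∀ e, 0 < x.η e) ∧ ∀ v, x.gauss v = 0 ∧
    Triangle (len (etaVec D x v 0)) (etaL D x v 0) (etaL D x v 1) ∧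
    Triangle (len (etaVec D x v 1)) (etaL D x v 2) (etaL D x v 3) ∧
    Triangle (len (etaVec D x v 2)) (etaL D x v 4) (etaL D x v 5) ∧
    Triangle (len (etaVec D x v 2)) (len (etaVec D x v 0)) (len (etaVec D x v 1))}

/-- The interior of the reduced space `H_γ^+ = P_γ^+ // SU(2)^{|V(γ)|}`: the constraint surface
modulo gauge transformations. -/
def ReducedSpace (S : Sections L) : Type :=
  Quot fun x y : constraintInterior D => ∃ g : Vertex L → SU2, IsGaugeTransform S g x.1 y.1

variable (L) in
/-- Values of the variables `(η_e, ϱ_e)` and `(η_{v,I}, ϱ_{v,I})` for `I = 1, 2, 3`. -/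
@[ext] structure ReducedVariables where
  η : Edge L → ℝ
  ρ : Edge L → Real.Angle
  ηv : Vertex L → Fin 3 → ℝ
  ρv : Vertex L → Fin 3 → Real.Angle

def ReducedVariables.SmoothAt (q : ℝ → ReducedVariables L) (t : ℝ) : Prop :=
  (∀ e, ContDiffAt ℝ ∞ (fun s => (q s).η e) t) ∧
  (∀ e, SmoothAngleAt (fun s => (q s).ρ e) t) ∧
  (∀ v I, ContDiffAt ℝ ∞ (fun s => (q s).ηv v I) t) ∧
  (∀ v I, SmoothAngleAt (fun s => (q s).ρv v I) t)

/-- The inequalities that define the interior of `H_γ^+`. -/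
def reducedRange : Set (ReducedVariables L) :=
  {q | (∀ e, 0 < q.η e) ∧ ∀ v,
    Triangle (q.ηv v 0) (q.η (edgeAt v (D.label v 0))) (q.η (edgeAt v (D.label v 1))) ∧
    Triangle (q.ηv v 1) (q.η (edgeAt v (D.label v 2))) (q.η (edgeAt v (D.label v 3))) ∧
    Triangle (q.ηv v 2) (q.η (edgeAt v (D.label v 4))) (q.η (edgeAt v (D.label v 5))) ∧
    Triangle (q.ηv v 2) (q.ηv v 0) (q.ηv v 1)}

/-- The reduced variables as functions on the constraint surface. Here `ϱ_{v,3}` is the angle about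
`η_{v,3}` from the plane of `(η_{v,1}, η_{v,2})` to the plane of `(𝒱_{e_5}, 𝒱_{e_6})`. -/
def reducedVariables (S : Sections L) (x : Point L) : ReducedVariables L where
  η := x.η
  ρ := rho D S x
  ηv := fun v => ![len (etaVec D x v 0), len (etaVec D x v 1), len (etaVec D x v 2)]
  ρv := fun v => ![rhoV D x v 0, rhoV D x v 1,
    angleAbout (etaVec D x v 2) (etaVec D x v 0 ⨯₃ etaVec D x v 1)
      (normalL D x v 4 ⨯₃ normalL D x v 5)]

section

variable [∀ i, NeZero (L i)]

/-- `(a²/κ) (∑_e η_e dϱ_e + ∑_v ∑_{I=1}^3 η_{v,I} dϱ_{v,I})`. -/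
def reducedPotential (a κ : ℝ) (q : ℝ → ReducedVariables L) (t : ℝ) : ℝ :=
  a ^ 2 / κ * (∑ e, (q t).η e * angleDeriv (fun s => (q s).ρ e) t
    + ∑ v, ∑ I, (q t).ηv v I * angleDeriv (fun s => (q s).ρv v I) t)

end

end TwistedGeometry

end

open TwistedGeometry

open scoped Matrix ContDiff Topology

noncomputable section

namespace TwistedGeometry

/-! ### Vector algebra -/

/-! Everything rests on one quantity: `spin k u`, the length of `k` times the angular velocity about
`k` of a direction `u` orthogonal to `k`. It is linear in the axis `k` and insensitive to the length
and sign of `u`. An oriented angle about a moving axis satisfies `|k| d∠_k(u, w) = spin k w - spin k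
u`; the motion of the axis itself does not contribute (`angleDeriv_angleAbout`, via
`wronskian_identity`).

For the potential, `spin_rot` identifies `Tr(V dn n⁻¹)` with the turning rate of a direction carried
along by the frame `n`. At an edge the two sphere terms together with `dζ_e` become the turning
rates, about `V_e` and `Ṽ_e`, of the planes spanned with the neighbours in the minimal loop
(`sphereForm_add_angleDeriv_holonomy`, `edge_form`). Weighted by `η_e` and regrouped at the
vertices, the two members of a pair share their plane, so by linearity their axes add up to a
diagonal `η_{v,I}` (`vertex_form`, `potential_eq`). Each of these rates is a term `η_{v,I} dϱ_{v,I}`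
plus the rate of a reference plane. The reference rates telescope, because rates of one plane about
several axes add up to its rate about the sum of the axes: at an open polygon the rate about `η̆_v
𝒱_v` is left (`open_spin_sum`), which gives `η̆_v dϱ̆_v` and `η̆_v Tr(𝒱_v dn_v n_v⁻¹)`
(`spin_refDir`); at a closed polygon the axes sum to zero and nothing is left (`closed_spin_sum`).

For bijectivity, the six vectors at a vertex form a polygon cut into triangles. Side lengths fix
each triangle within its plane (`hinge`), and the angles fix the planes one after another, starting
from a reference direction (`IsOpenPolygon.eq_openPolygon`, `openPolygon_spec`). The normals
determine `ζ_e`, and then `ξ_e = ϱ_e + ζ_e`. The formulas are smooth because strict triangle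
inequalities keep the square roots away from zero.

On the constraint surface there is no outer reference direction: a closed polygon is given by its
shape and an orthonormal frame, and `SU(2)` acts transitively on such frames. Since `ζ_e` shifts by
the same `α - β` as `ξ_e` (`holonomyAngle_gauge`), the shape and the `ϱ_e` are invariant and
separate the orbits (`exists_gaugeTransform`). Curves are lifted by holding the frames fixed
(`exists_smooth_lift`). -/

theorem dot_self_nonneg (v : R3) : 0 ≤ v ⬝ᵥ v := by
  simp only [dotProduct, Fin.sum_univ_three]
  nlinarith [mul_self_nonneg (v 0), mul_self_nonneg (v 1), mul_self_nonneg (v 2)]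

theorem dot_self_pos {v : R3} (h : v ≠ 0) : 0 < v ⬝ᵥ v :=
  lt_of_le_of_ne (dot_self_nonneg v) fun h' => h (dotProduct_self_eq_zero.mp h'.symm)

theorem len_sq (v : R3) : len v ^ 2 = v ⬝ᵥ v := Real.sq_sqrt (dot_self_nonneg v)

theorem len_nonneg (v : R3) : 0 ≤ len v := Real.sqrt_nonneg _

theorem len_pos {v : R3} (h : v ≠ 0) : 0 < len v := Real.sqrt_pos.mpr (dot_self_pos h)

theorem ne_zero_of_len_pos {v : R3} (h : 0 < len v) : v ≠ 0 := by
  rintro rfl; simp [len] at h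

theorem len_eq_of_sq {v : R3} {r : ℝ} (hr : 0 ≤ r) (h : v ⬝ᵥ v = r ^ 2) : len v = r := by
  rw [len, h, Real.sqrt_sq hr]

theorem len_eq_one {v : R3} (h : v ⬝ᵥ v = 1) : len v = 1 := by simp [len, h]

theorem len_smul {r : ℝ} (hr : 0 ≤ r) (v : R3) : len (r • v) = r * len v := by
  apply len_eq_of_sq (mul_nonneg hr (len_nonneg v))
  rw [mul_pow, len_sq]; simp [smul_dotProduct, dotProduct_smul]; ring

theorem len_neg (v : R3) : len (-v) = len v := by simp [len]

theorem ne_zero_of_unit {v : R3} (h : v ⬝ᵥ v = 1) : v ≠ 0 := by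
  rintro rfl; simp at h

theorem cross_dot_self (u w : R3) :
    (u ⨯₃ w) ⬝ᵥ (u ⨯₃ w) = (u ⬝ᵥ u) * (w ⬝ᵥ w) - (u ⬝ᵥ w) ^ 2 := by
  simp only [cross_apply, dotProduct, Fin.sum_univ_three, Matrix.cons_val]; ring

theorem dot_cross_left (u w : R3) : u ⬝ᵥ (u ⨯₃ w) = 0 := by
  simp only [cross_apply, dotProduct, Fin.sum_univ_three, Matrix.cons_val]; ring

theorem dot_cross_right (u w : R3) : w ⬝ᵥ (u ⨯₃ w) = 0 := by
  simp only [cross_apply, dotProduct, Fin.sum_univ_three, Matrix.cons_val]; ring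

/-- The unit vector in the direction of `v`. -/
def dir (v : R3) : R3 := (len v)⁻¹ • v

theorem dir_unit {v : R3} (h : v ≠ 0) : dir v ⬝ᵥ dir v = 1 := by
  have := len_pos h
  simp only [dir, smul_dotProduct, dotProduct_smul, smul_eq_mul, ← len_sq]
  field_simp

theorem len_smul_dir {v : R3} (h : v ≠ 0) : len v • dir v = v := by
  rw [dir, smul_smul, mul_inv_cancel₀ (len_pos h).ne', one_smul]

theorem dot_dir_eq_zero {k u : R3} (h : k ⬝ᵥ u = 0) : k ⬝ᵥ dir u = 0 := by
  simp [dir, dotProduct_smul, h]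

theorem dir_of_unit {v : R3} (h : v ⬝ᵥ v = 1) : dir v = v := by
  simp [dir, len_eq_one h]

theorem dir_smul {r : ℝ} (hr : 0 < r) (v : R3) : dir (r • v) = dir v := by
  rw [dir, len_smul hr.le, dir, smul_smul]
  congr 1
  rcases (len_nonneg v).eq_or_lt with h | h
  · simp [← h]
  · field_simp

/-! ### Oriented angles about an axis and rotations of the orthogonal plane. -/

/-- Since `u × w` is parallel to `k`, this is Lagrange's identity times `|k|²`. It computes the
modulus of the complex number whose argument is `angleAbout k u w`. -/
theorem abs_angle_sq {k u w : R3} (hu : k ⬝ᵥ u = 0) (hw : k ⬝ᵥ w = 0) :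
    (len k * (u ⬝ᵥ w)) ^ 2 + (k ⬝ᵥ (u ⨯₃ w)) ^ 2 = (len k * len u * len w) ^ 2 := by
  simp only [mul_pow, len_sq]
  simp only [cross_apply, dotProduct, Fin.sum_univ_three, Matrix.cons_val] at *
  linear_combination
    (-(u 0 * u 0 + u 1 * u 1 + u 2 * u 2) * (k 0 * w 0 + k 1 * w 1 + k 2 * w 2)
      + (u 0 * w 0 + u 1 * w 1 + u 2 * w 2) * (k 0 * u 0 + k 1 * u 1 + k 2 * u 2)) * hw
    + (-(w 0 * w 0 + w 1 * w 1 + w 2 * w 2) * (k 0 * u 0 + k 1 * u 1 + k 2 * u 2)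
      + (u 0 * w 0 + u 1 * w 1 + u 2 * w 2) * (k 0 * w 0 + k 1 * w 1 + k 2 * w 2)) * hu

/-- `u` and `w` are directions in the plane orthogonal to the axis `k`. -/
structure Transverse (k u w : R3) : Prop where
  k0 : k ≠ 0
  u0 : u ≠ 0
  w0 : w ≠ 0
  hu : k ⬝ᵥ u = 0
  hw : k ⬝ᵥ w = 0

theorem Transverse.norm_eq {k u w : R3} (h : Transverse k u w) :
    ‖(⟨len k * (u ⬝ᵥ w), k ⬝ᵥ (u ⨯₃ w)⟩ : ℂ)‖ = len k * len u * len w := by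
  rw [Complex.norm_eq_sqrt_sq_add_sq, abs_angle_sq h.hu h.hw, Real.sqrt_sq]
  have := len_nonneg k; have := len_nonneg u; have := len_nonneg w
  positivity

theorem Transverse.arg_ne {k u w : R3} (h : Transverse k u w) :
    (⟨len k * (u ⬝ᵥ w), k ⬝ᵥ (u ⨯₃ w)⟩ : ℂ) ≠ 0 := by
  rw [← norm_pos_iff, h.norm_eq]
  have := len_pos h.k0; have := len_pos h.u0; have := len_pos h.w0
  positivity

theorem Transverse.cos_angle {k u w : R3} (h : Transverse k u w) :
    (angleAbout k u w).cos = (u ⬝ᵥ w) / (len u * len w) := by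
  rw [angleAbout, Real.Angle.cos_coe, Complex.cos_arg h.arg_ne, h.norm_eq]
  have := len_pos h.k0; have := len_pos h.u0; have := len_pos h.w0
  field_simp

theorem Transverse.sin_angle {k u w : R3} (h : Transverse k u w) :
    (angleAbout k u w).sin = (k ⬝ᵥ (u ⨯₃ w)) / (len k * len u * len w) := by
  rw [angleAbout, Real.Angle.sin_coe, Complex.sin_arg, h.norm_eq]

theorem angle_ext {α β : Real.Angle} (hc : α.cos = β.cos) (hs : α.sin = β.sin) : α = β := by
  induction α using Real.Angle.induction_on
  induction β using Real.Angle.induction_on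
  exact Real.Angle.cos_sin_inj hc hs

/-- The rotation of a vector `a` orthogonal to `k` by the angle `θ` about `k`. -/
def turn (k : R3) (θ : Real.Angle) (a : R3) : R3 := θ.cos • a + θ.sin • (dir k ⨯₃ a)

/-- Expansion along the orthogonal directions `u` and `k × u`. No condition on `w` is needed: a
component of `w` along `k` contributes to neither side. -/
theorem cross_decomp {k u w : R3} (hu : k ⬝ᵥ u = 0) :
    (u ⬝ᵥ u) • (k ⨯₃ w) = (u ⬝ᵥ w) • (k ⨯₃ u) - (k ⬝ᵥ (u ⨯₃ w)) • u := by
  simp only [cross_apply, dotProduct, Fin.sum_univ_three, Matrix.cons_val] at *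
  ext i
  fin_cases i <;> simp
  · linear_combination (u 1 * w 2 - u 2 * w 1) * hu
  · linear_combination (u 2 * w 0 - u 0 * w 2) * hu
  · linear_combination (u 0 * w 1 - u 1 * w 0) * hu

theorem plane_decomp {k u w : R3} (hu : k ⬝ᵥ u = 0) (hw : k ⬝ᵥ w = 0) :
    (k ⬝ᵥ k * u ⬝ᵥ u) • w = (k ⬝ᵥ k * u ⬝ᵥ w) • u + (k ⬝ᵥ (u ⨯₃ w)) • (k ⨯₃ u) := by
  -- An identity for arbitrary vectors; the last three terms contain `k ⬝ᵥ u` or `k ⬝ᵥ w` and vanish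
  -- here.
  have e : (k ⬝ᵥ k * u ⬝ᵥ u) • w = (k ⬝ᵥ k * u ⬝ᵥ w) • u
    + (k ⬝ᵥ (u ⨯₃ w)) • (k ⨯₃ u) + ((u ⬝ᵥ u) * (k ⬝ᵥ w) - (k ⬝ᵥ u) * (u ⬝ᵥ w)) • k
     + ((k ⬝ᵥ u) * (k ⬝ᵥ u)) • w - ((k ⬝ᵥ w) * (k ⬝ᵥ u)) • u := by
    simp only [cross_apply, dotProduct, Fin.sum_univ_three, Matrix.cons_val]
    ext i
    simp only [Pi.add_apply, Pi.sub_apply, Pi.smul_apply, smul_eq_mul]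
    fin_cases i <;> simp <;> ring
  simpa [hu, hw] using e

/-- With the converse `Transverse.angle_eq`, this replaces the definition by a complex argument with
the description by a rotation, which is what the reconstruction of polygons uses. -/
theorem Transverse.dir_eq_turn {k u w : R3} (h : Transverse k u w) :
    dir w = turn k (angleAbout k u w) (dir u) := by
  have hk := len_pos h.k0; have hlu := len_pos h.u0; have hlw := len_pos h.w0
  rw [turn, h.cos_angle, h.sin_angle]
  have e := plane_decomp h.hu h.hw
  simp only [← len_sq] at e
  have e2 : w = (len k ^ 2 * len u ^ 2)⁻¹ •
      ((len k ^ 2 * u ⬝ᵥ w) • u + (k ⬝ᵥ (u ⨯₃ w)) • (k ⨯₃ u)) := by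
    rw [← e, smul_smul, inv_mul_cancel₀ (by positivity), one_smul]
  calc dir w = (len w)⁻¹ • w := rfl
    _ = (len w)⁻¹ • ((len k ^ 2 * len u ^ 2)⁻¹ •
      ((len k ^ 2 * u ⬝ᵥ w) • u + (k ⬝ᵥ (u ⨯₃ w)) • (k ⨯₃ u))) := congrArg _ e2
    _ = _ := by
      simp only [dir, map_smul, LinearMap.smul_apply, smul_smul, smul_add]
      congr 2 <;> field_simp

theorem turn_dot (k u : R3) (θ : Real.Angle) :
    u ⬝ᵥ turn k θ u = θ.cos * (u ⬝ᵥ u) := by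
  simp only [turn, dotProduct_add, dotProduct_smul, dot_cross_right]; simp

theorem dot_turn {k u : R3} (hu : k ⬝ᵥ u = 0) (θ : Real.Angle) : k ⬝ᵥ turn k θ u = 0 := by
  simp [turn, dir, hu]

theorem turn_dot_self {k u : R3} (hk : k ≠ 0) (hu : k ⬝ᵥ u = 0) (θ : Real.Angle) :
    turn k θ u ⬝ᵥ turn k θ u = u ⬝ᵥ u := by
  have h1 : dir k ⬝ᵥ u = 0 := by simp [dir, hu]
  have h2 := dir_unit hk
  have h3 := cross_dot_self (dir k) u
  rw [h1, h2] at h3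
  have h4 : (dir k ⨯₃ u) ⬝ᵥ u = 0 := by rw [dotProduct_comm]; exact dot_cross_right _ _
  simp only [turn, dotProduct_add, add_dotProduct, dotProduct_smul, smul_dotProduct, h3,
    dot_cross_right, h4, smul_eq_mul]
  linear_combination (u ⬝ᵥ u) * θ.cos_sq_add_sin_sq

theorem dir_cross_turn {k u : R3} (hk : k ≠ 0) (hu : k ⬝ᵥ u = 0) (θ : Real.Angle) :
    k ⬝ᵥ (u ⨯₃ turn k θ u) = θ.sin * (len k * (u ⬝ᵥ u)) := by
  have hp := len_pos hk
  have e : k ⬝ᵥ (u ⨯₃ (k ⨯₃ u)) = (k ⬝ᵥ k) * (u ⬝ᵥ u) - (k ⬝ᵥ u) ^ 2 := by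
    simp only [cross_apply, dotProduct, Fin.sum_univ_three, Matrix.cons_val]; ring
  simp only [turn, dir, map_add, map_smul, LinearMap.smul_apply, cross_self, smul_zero, zero_add,
    dotProduct_smul, e, hu, ← len_sq, smul_eq_mul]
  field_simp; ring

theorem Transverse.angle_eq {k u w : R3} (h : Transverse k u w) {θ : Real.Angle}
    (hθ : dir w = turn k θ (dir u)) : angleAbout k u w = θ := by
  have hk := len_pos h.k0; have hlu := len_pos h.u0; have hlw := len_pos h.w0
  have hd : k ⬝ᵥ dir u = 0 := dot_dir_eq_zero h.hu
  have hw : w = len w • turn k θ (dir u) := by rw [← hθ, len_smul_dir h.w0]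
  have hu : u = len u • dir u := (len_smul_dir h.u0).symm
  have e1 : u ⬝ᵥ w = len u * len w * θ.cos := by
    conv_lhs => rw [hu, hw]
    simp only [smul_dotProduct, dotProduct_smul, turn_dot, dir_unit h.u0, smul_eq_mul]
    ring
  have e2 : k ⬝ᵥ (u ⨯₃ w) = len k * len u * len w * θ.sin := by
    conv_lhs => rw [hu, hw]
    simp only [map_smul, LinearMap.smul_apply, dotProduct_smul,
      dir_cross_turn h.k0 hd, dir_unit h.u0, smul_eq_mul]
    ring
  apply angle_ext
  · rw [h.cos_angle, e1]; field_simp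
  · rw [h.sin_angle, e2]; field_simp

/-! ### Triangles with a prescribed base -/

/-- The side of length `p` of the triangle with base `k`, whose other side has length `r` and whose
plane has the oriented unit normal `a`. -/
def hinge (k a : R3) (p r : ℝ) : R3 :=
  ((p ^ 2 + len k ^ 2 - r ^ 2) / (2 * len k ^ 2)) • k +
    (Real.sqrt (p ^ 2 - ((p ^ 2 + len k ^ 2 - r ^ 2) / (2 * len k)) ^ 2) / len k) • (k ⨯₃ a)

theorem Triangle.pos {a b c : ℝ} (h : Triangle a b c) : 0 < a ∧ 0 < b ∧ 0 < c := by
  obtain ⟨h1, h2⟩ := h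
  have := abs_lt.mp h1
  exact ⟨(abs_nonneg _).trans_lt h1, by linarith, by linarith⟩

/-- The radicand is the squared height over the base `c`. Heron's factorization writes it as a
product of factors that the strict inequalities make positive. -/
theorem Triangle.radicand_pos {c p r : ℝ} (h : Triangle c p r) :
    0 < p ^ 2 - ((p ^ 2 + c ^ 2 - r ^ 2) / (2 * c)) ^ 2 := by
  obtain ⟨hc, hp, hr⟩ := h.pos
  have h1 := abs_lt.mp h.1
  have h2 := h.2
  have e : p ^ 2 - ((p ^ 2 + c ^ 2 - r ^ 2) / (2 * c)) ^ 2 =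
      ((p + r - c) * (p + r + c) * (c - (p - r)) * (c + (p - r))) / (4 * c ^ 2) := by
    field_simp; ring
  rw [e]
  have := mul_pos (mul_pos (mul_pos (by linarith : 0 < p + r - c) (by linarith : 0 < p + r + c))
    (by linarith : 0 < c - (p - r))) (by linarith : 0 < c + (p - r))
  positivity

theorem hinge_cross {k a : R3} (hk : k ≠ 0) (hka : k ⬝ᵥ a = 0) (p r : ℝ) :
    hinge k a p r ⨯₃ (k - hinge k a p r) =
      (Real.sqrt (p ^ 2 - ((p ^ 2 + len k ^ 2 - r ^ 2) / (2 * len k)) ^ 2) * len k) • a := by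
  have hp := len_pos hk
  have e : (k ⨯₃ a) ⨯₃ k = (len k ^ 2) • a - (k ⬝ᵥ a) • k := by
    rw [len_sq]
    simp only [cross_apply, dotProduct, Fin.sum_univ_three, Matrix.cons_val]
    ext i
    fin_cases i <;> simp <;> ring
  rw [map_sub, cross_self, sub_zero, hinge]
  simp only [map_add, map_smul, LinearMap.smul_apply, LinearMap.add_apply, cross_self, smul_zero,
    zero_add, e, hka, zero_smul, sub_zero, smul_smul]
  congr 1; field_simp

theorem hinge_spec {k a : R3} {p r : ℝ} (hka : k ⬝ᵥ a = 0) (ha : a ⬝ᵥ a = 1)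
    (h : Triangle (len k) p r) :
    len (hinge k a p r) = p ∧ len (k - hinge k a p r) = r ∧
      dir (hinge k a p r ⨯₃ (k - hinge k a p r)) = a := by
  obtain ⟨hc, hp, hr⟩ := h.pos
  have hk := ne_zero_of_len_pos hc
  have hrad := h.radicand_pos
  have e1 : (k ⨯₃ a) ⬝ᵥ (k ⨯₃ a) = len k ^ 2 := by rw [cross_dot_self, ha, hka, len_sq]; ring
  have e2 : k ⬝ᵥ (k ⨯₃ a) = 0 := dot_cross_left _ _
  have e3 : (k ⨯₃ a) ⬝ᵥ k = 0 := by rw [dotProduct_comm, e2]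
  have hs := Real.sq_sqrt hrad.le
  refine ⟨len_eq_of_sq hp.le ?_, len_eq_of_sq hr.le ?_, ?_⟩
  · simp only [hinge, dotProduct_add, add_dotProduct, dotProduct_smul, smul_dotProduct, e1, e2, e3,
      smul_eq_mul, ← len_sq k]
    set s := Real.sqrt (p ^ 2 - ((p ^ 2 + len k ^ 2 - r ^ 2) / (2 * len k)) ^ 2)
    field_simp
    field_simp at hs
    linear_combination len k * hs
  · simp only [hinge, dotProduct_add, add_dotProduct, dotProduct_smul, smul_dotProduct, e1, e2, e3,
      dotProduct_sub, sub_dotProduct, smul_eq_mul, ← len_sq k]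
    set s := Real.sqrt (p ^ 2 - ((p ^ 2 + len k ^ 2 - r ^ 2) / (2 * len k)) ^ 2)
    field_simp
    field_simp at hs
    linear_combination len k * hs
  · rw [hinge_cross hk hka, dir_smul (mul_pos (Real.sqrt_pos.mpr hrad) hc), dir_of_unit ha]

/-- For parallel `P` and `Q` Lagrange's identity makes the squared height zero, against
`Triangle.radicand_pos`. -/
theorem cross_ne_zero_of_triangle {P Q : R3} (h : Triangle (len (P + Q)) (len P) (len Q)) :
    P ⨯₃ Q ≠ 0 := by
  obtain ⟨hc, hp, hr⟩ := h.pos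
  intro h0
  have e := cross_dot_self P Q
  rw [h0, zero_dotProduct] at e
  have e2 : (P + Q) ⬝ᵥ (P + Q) = P ⬝ᵥ P + Q ⬝ᵥ Q + 2 * (P ⬝ᵥ Q) := by
    simp only [dotProduct_add, add_dotProduct, dotProduct_comm Q P]; ring
  have := h.radicand_pos
  rw [sub_pos, div_pow, div_lt_iff₀ (by positivity)] at this
  simp only [mul_pow, len_sq, e2] at this
  nlinarith

/-- The foot of the height is given by the law of cosines, the height by the area, and the side of
the base by the oriented normal. With `hinge_spec` this is existence and uniqueness of a triangle
over a given base in a given oriented plane. -/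
theorem eq_hinge {P Q : R3} (h : Triangle (len (P + Q)) (len P) (len Q)) :
    P = hinge (P + Q) (dir (P ⨯₃ Q)) (len P) (len Q) := by
  obtain ⟨hc, hp, hr⟩ := h.pos
  have hn := cross_ne_zero_of_triangle h
  have hN := len_pos hn
  have hrad := h.radicand_pos
  have hk2 := len_sq (P + Q)
  have e2 : (P + Q) ⬝ᵥ (P + Q) = P ⬝ᵥ P + Q ⬝ᵥ Q + 2 * (P ⬝ᵥ Q) := by
    simp only [dotProduct_add, add_dotProduct, dotProduct_comm Q P]; ring
  -- The height over the base is twice the area divided by the base.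
  have hs : Real.sqrt (len P ^ 2 - ((len P ^ 2 + len (P + Q) ^ 2 - len Q ^ 2) /
      (2 * len (P + Q))) ^ 2) = len (P ⨯₃ Q) / len (P + Q) := by
    rw [← Real.sqrt_sq (by positivity : 0 ≤ len (P ⨯₃ Q) / len (P + Q))]
    congr 1
    rw [div_pow, div_pow, len_sq (P ⨯₃ Q), cross_dot_self, mul_pow]
    have := dot_self_pos (ne_zero_of_len_pos hc)
    rw [e2] at this
    simp only [len_sq, e2]
    field_simp
    ring
  rw [hinge, hs]
  have e3 : (P + Q) ⨯₃ (P ⨯₃ Q) = ((P + Q) ⬝ᵥ Q) • P - ((P + Q) ⬝ᵥ P) • Q := by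
    simp only [cross_apply, dotProduct, Fin.sum_univ_three, Matrix.cons_val]
    ext i
    fin_cases i <;> simp <;> ring
  have e4 : (P + Q) ⬝ᵥ P = (len P ^ 2 + len (P + Q) ^ 2 - len Q ^ 2) / 2 := by
    simp only [len_sq, e2, add_dotProduct, dotProduct_comm Q P]; ring
  have e5 : (P + Q) ⬝ᵥ Q = len (P + Q) ^ 2 - (len P ^ 2 + len (P + Q) ^ 2 - len Q ^ 2) / 2 := by
    simp only [len_sq, e2, add_dotProduct]; ring
  simp only [dir, map_smul, e3, e4, e5]
  ext i
  simp only [Pi.add_apply, Pi.sub_apply, Pi.smul_apply, smul_eq_mul]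
  field_simp
  ring

/-! ### The adjoint representation of `SU(2)` -/

theorem SU2.val_inv (g : SU2) : (g⁻¹).1 = star g.1 := rfl

theorem SU2.mul_inv (g : SU2) : g.1 * (g⁻¹).1 = 1 := by
  rw [← Submonoid.coe_mul, mul_inv_cancel]; rfl

theorem SU2.inv_mul (g : SU2) : (g⁻¹).1 * g.1 = 1 := by
  rw [← Submonoid.coe_mul, inv_mul_cancel]; rfl

theorem su2_eq (v : R3) : su2 v =
    !![-(Complex.I / 2) * v 2, -(Complex.I / 2) * v 0 - v 1 / 2;
      -(Complex.I / 2) * v 0 + v 1 / 2, (Complex.I / 2) * v 2] := by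
  ext i j
  fin_cases i <;> fin_cases j <;> simp [su2, tau, Fin.sum_univ_three] <;> ring_nf <;>
    simp [Complex.I_sq] <;> ring

theorem Tr_tau_su2 (v : R3) (i : Fin 3) : Tr (tau i) (su2 v) = v i := by
  rw [su2_eq]
  fin_cases i <;> simp [Tr, tau, Matrix.trace, Fin.sum_univ_two] <;> ring

theorem su2_injective : Function.Injective su2 := fun v w h => by
  ext i; rw [← Tr_tau_su2 v, h, Tr_tau_su2]

theorem su2_add (v w : R3) : su2 (v + w) = su2 v + su2 w := by
  simp [su2, add_smul, Finset.sum_add_distrib]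

theorem su2_smul (r : ℝ) (v : R3) : su2 (r • v) = (r : ℂ) • su2 v := by
  simp only [su2, Finset.smul_sum, smul_smul, Pi.smul_apply, smul_eq_mul, Complex.ofReal_mul]

theorem su2_neg (v : R3) : su2 (-v) = -su2 v := by simp [su2]

theorem star_su2 (v : R3) : star (su2 v) = -su2 v := by
  rw [su2_eq]
  ext i j
  fin_cases i <;> fin_cases j <;> simp [Matrix.star_apply] <;> ring

theorem trace_su2 (v : R3) : (su2 v).trace = 0 := by
  rw [su2_eq]; simp [Matrix.trace, Fin.sum_univ_two]

theorem su2_Tr_tau {X : Matrix (Fin 2) (Fin 2) ℂ} (h : star X = -X) (ht : X.trace = 0) :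
    su2 (fun i => Tr (tau i) X) = X := by
  have e00 := congrFun (congrFun h 0) 0
  have e01 := congrFun (congrFun h 0) 1
  have e10 := congrFun (congrFun h 1) 0
  have e11 := congrFun (congrFun h 1) 1
  simp only [Matrix.star_apply, Matrix.neg_apply, Complex.ext_iff, RCLike.star_def,
    Complex.conj_re, Complex.conj_im, Complex.neg_re, Complex.neg_im] at e00 e01 e10 e11
  simp only [Matrix.trace, Fin.sum_univ_two, Matrix.diag_apply, Complex.ext_iff, Complex.add_re,
    Complex.add_im, Complex.zero_re, Complex.zero_im] at ht
  rw [su2_eq]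
  simp only [Tr, Matrix.trace_fin_two, Matrix.mul_apply, Fin.sum_univ_two, tau]
  ext i j
  fin_cases i <;> fin_cases j <;> simp [Complex.ext_iff] <;> constructor <;> linarith

/-- Conjugation preserves antihermitian traceless matrices, so no information is lost in taking
components. Facts about `rot` can then be read off from matrix identities by injectivity of `su2`.
-/
theorem su2_rot (g : SU2) (v : R3) : su2 (rot g v) = g.1 * su2 v * (g⁻¹).1 := by
  apply su2_Tr_tau
  · simp only [star_mul, SU2.val_inv, star_star, star_su2]; noncomm_ring
  · rw [Matrix.trace_mul_comm, ← mul_assoc, SU2.inv_mul, one_mul, trace_su2]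

theorem rot_eq_iff {g : SU2} {v w : R3} : w = rot g v ↔ su2 w = g.1 * su2 v * (g⁻¹).1 := by
  rw [← su2_rot]; exact su2_injective.eq_iff.symm

theorem rot_mul (g h : SU2) (v : R3) : rot (g * h) v = rot g (rot h v) := by
  rw [rot_eq_iff, su2_rot, su2_rot, mul_inv_rev]
  simp only [Submonoid.coe_mul, mul_assoc]

theorem rot_one (v : R3) : rot 1 v = v := by
  symm; rw [rot_eq_iff]; simp

theorem rot_inv_rot (g : SU2) (v : R3) : rot g⁻¹ (rot g v) = v := by
  rw [← rot_mul, inv_mul_cancel, rot_one]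

theorem rot_rot_inv (g : SU2) (v : R3) : rot g (rot g⁻¹ v) = v := by
  rw [← rot_mul, mul_inv_cancel, rot_one]

theorem rot_add (g : SU2) (v w : R3) : rot g (v + w) = rot g v + rot g w := by
  symm; rw [rot_eq_iff, su2_add, su2_add, su2_rot, su2_rot]; noncomm_ring

theorem rot_smul (g : SU2) (r : ℝ) (v : R3) : rot g (r • v) = r • rot g v := by
  symm; rw [rot_eq_iff, su2_smul, su2_smul, su2_rot]; simp

theorem rot_neg (g : SU2) (v : R3) : rot g (-v) = -rot g v := by
  simpa using rot_smul g (-1) v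

theorem rot_zero (g : SU2) : rot g 0 = 0 := by simpa using rot_smul g 0 0

theorem Tr_su2 (v w : R3) : Tr (su2 v) (su2 w) = v ⬝ᵥ w := by
  simp only [su2_eq]
  simp [Tr, Matrix.trace, Fin.sum_univ_two, dotProduct, Fin.sum_univ_three]
  ring

/-- The commutation relations of the `τ_i`. They make `rot` preserve cross products, hence
orientation and oriented angles. -/
theorem su2_cross (v w : R3) : su2 (v ⨯₃ w) = su2 v * su2 w - su2 w * su2 v := by
  simp only [su2_eq]
  ext i j
  fin_cases i <;> fin_cases j <;>
    simp [Matrix.mul_apply, Fin.sum_univ_two, cross_apply, Complex.ext_iff] <;>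
    constructor <;> ring

theorem rot_dot (g : SU2) (v w : R3) : rot g v ⬝ᵥ rot g w = v ⬝ᵥ w := by
  rw [← Tr_su2, ← Tr_su2, su2_rot, su2_rot, Tr, Tr]
  congr 2
  calc (g.1 * su2 v * (g⁻¹).1 * (g.1 * su2 w * (g⁻¹).1)).trace
      = (g.1 * (su2 v * ((g⁻¹).1 * g.1) * su2 w * (g⁻¹).1)).trace := by simp only [mul_assoc]
    _ = (su2 v * su2 w).trace := by
      rw [SU2.inv_mul, mul_one, Matrix.trace_mul_comm, mul_assoc, SU2.inv_mul, mul_one]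

theorem rot_cross (g : SU2) (v w : R3) : rot g (v ⨯₃ w) = rot g v ⨯₃ rot g w := by
  symm
  rw [rot_eq_iff, su2_cross, su2_cross, su2_rot, su2_rot]
  calc _ = g.1 * su2 v * ((g⁻¹).1 * g.1) * su2 w * (g⁻¹).1
        - g.1 * su2 w * ((g⁻¹).1 * g.1) * su2 v * (g⁻¹).1 := by simp only [mul_assoc]
    _ = _ := by rw [SU2.inv_mul]; noncomm_ring

theorem rot_injective (g : SU2) : Function.Injective (rot g) :=
  Function.LeftInverse.injective (rot_inv_rot g)

theorem rot_len (g : SU2) (v : R3) : len (rot g v) = len v := by rw [len, rot_dot, len]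

theorem rot_dir (g : SU2) (v : R3) : rot g (dir v) = dir (rot g v) := by
  rw [dir, rot_smul, dir, rot_len]

theorem rot_angleAbout (g : SU2) (k u w : R3) :
    angleAbout (rot g k) (rot g u) (rot g w) = angleAbout k u w := by
  rw [angleAbout, rot_len, rot_dot, ← rot_cross, rot_dot, angleAbout]

theorem rot_turn (g : SU2) (k : R3) (θ : Real.Angle) (a : R3) :
    rot g (turn k θ a) = turn (rot g k) θ (rot g a) := by
  simp only [turn, rot_add, rot_smul, rot_cross, rot_dir]

theorem rot_hinge (g : SU2) (k a : R3) (p r : ℝ) :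
    rot g (hinge k a p r) = hinge (rot g k) (rot g a) p r := by
  simp only [hinge, rot_add, rot_smul, rot_cross, rot_len]

/-! ### The stabilizer of the third axis -/

/-- The third basis vector, which corresponds to `τ_3`. -/
def axis : R3 := ![0, 0, 1]

theorem su2_axis : su2 axis = tau 2 := by
  rw [su2_eq]; ext i j; fin_cases i <;> fin_cases j <;> simp [axis, tau]

theorem expTau3_eq (θ : ℝ) : expTau3 θ =
    !![Complex.exp (-(Complex.I / 2) * θ), 0; 0, Complex.exp ((Complex.I / 2) * θ)] := by
  have : (θ : ℂ) • tau 2 =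
      Matrix.diagonal ![-(Complex.I / 2) * θ, (Complex.I / 2) * θ] := by
    ext i j; fin_cases i <;> fin_cases j <;> simp [tau, Matrix.diagonal] <;> ring
  rw [expTau3, this, Matrix.exp_diagonal]
  ext i j
  fin_cases i <;> fin_cases j <;> simp [Matrix.diagonal, ← Complex.exp_eq_exp_ℂ]

theorem exp_half_I (θ : ℝ) : Complex.exp ((Complex.I / 2) * θ) =
    ⟨Real.cos (θ / 2), Real.sin (θ / 2)⟩ := by
  have : (Complex.I / 2) * θ = ((θ / 2 : ℝ) : ℂ) * Complex.I := by push_cast; ring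
  rw [this, Complex.exp_mul_I, ← Complex.ofReal_cos, ← Complex.ofReal_sin]
  generalize Real.cos (θ / 2) = c
  generalize Real.sin (θ / 2) = s
  apply Complex.ext <;> simp

theorem exp_neg_half_I (θ : ℝ) : Complex.exp (-(Complex.I / 2) * θ) =
    ⟨Real.cos (θ / 2), -Real.sin (θ / 2)⟩ := by
  have : -(Complex.I / 2) * θ = (Complex.I / 2) * ((-θ : ℝ) : ℂ) := by push_cast; ring
  rw [this, exp_half_I, neg_div, Real.cos_neg, Real.sin_neg]

theorem expTau3_mem (θ : ℝ) : expTau3 θ ∈ Matrix.specialUnitaryGroup (Fin 2) ℂ := by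
  rw [Matrix.mem_specialUnitaryGroup_iff, Matrix.mem_unitaryGroup_iff, expTau3_eq,
    exp_half_I, exp_neg_half_I]
  have h := Real.cos_sq_add_sin_sq (θ / 2)
  generalize Real.cos (θ / 2) = c at *
  generalize Real.sin (θ / 2) = s at *
  constructor
  · ext i j
    fin_cases i <;> fin_cases j <;>
      simp [Matrix.mul_apply, Fin.sum_univ_two, Matrix.star_apply, Complex.ext_iff] <;>
      constructor <;> linarith
  · simp [Matrix.det_fin_two, Complex.ext_iff]
    constructor <;> linarith

/-- `e^{θ τ_3}` as an element of `SU(2)`. -/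
def axial (θ : ℝ) : SU2 := ⟨expTau3 θ, expTau3_mem θ⟩

theorem axial_neg (θ : ℝ) : (axial θ)⁻¹ = axial (-θ) := by
  rw [inv_eq_iff_mul_eq_one]
  apply Subtype.ext
  change expTau3 θ * expTau3 (-θ) = 1
  rw [expTau3_eq, expTau3_eq]
  ext i j
  fin_cases i <;> fin_cases j <;> simp [Matrix.mul_apply, Fin.sum_univ_two, ← Complex.exp_add]

theorem rot_axial (θ : ℝ) (v : R3) : rot (axial θ) v =
    ![Real.cos θ * v 0 - Real.sin θ * v 1, Real.sin θ * v 0 + Real.cos θ * v 1, v 2] := by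
  -- The entries of `e^{θ τ_3}` contain half angles; conjugation produces the double-angle formulas.
  have hc : Real.cos θ =
      Real.cos (θ / 2) * Real.cos (θ / 2) - Real.sin (θ / 2) * Real.sin (θ / 2) := by
    rw [← sq, ← sq, ← Real.cos_two_mul', mul_div_cancel₀ θ two_ne_zero]
  have hs : Real.sin θ = 2 * Real.sin (θ / 2) * Real.cos (θ / 2) := by
    rw [← Real.sin_two_mul, mul_div_cancel₀ θ two_ne_zero]
  have h1 := Real.sin_sq_add_cos_sq (θ / 2)
  symm
  rw [rot_eq_iff, SU2.val_inv, su2_eq, su2_eq, hc, hs]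
  simp only [axial, expTau3_eq, exp_half_I, exp_neg_half_I]
  generalize Real.cos (θ / 2) = c at *
  generalize Real.sin (θ / 2) = s at *
  ext i j
  fin_cases i <;> fin_cases j <;>
    simp [Matrix.mul_apply, Fin.sum_univ_two, Matrix.star_apply, Complex.ext_iff] <;>
    constructor <;> first
      | ring1
      | linear_combination (v 2 / 2) * h1
      | linear_combination -(v 2 / 2) * h1

theorem rot_axial_eq_turn (θ : ℝ) {v : R3} (hv : axis ⬝ᵥ v = 0) :
    rot (axial θ) v = turn axis θ v := by
  have h2 : v 2 = 0 := by simpa [axis, dotProduct, Fin.sum_univ_three] using hv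
  have : dir axis = axis := dir_of_unit (by simp [axis, dotProduct, Fin.sum_univ_three])
  rw [rot_axial, turn, this]
  ext i
  simp only [Pi.add_apply, Pi.smul_apply, smul_eq_mul]
  fin_cases i <;> simp [axis, cross_apply, h2] <;> ring

theorem axis_unit : axis ⬝ᵥ axis = 1 := by simp [axis, dotProduct, Fin.sum_univ_three]

theorem rot_axial_axis (θ : ℝ) : rot (axial θ) axis = axis := by
  rw [rot_axial]; simp [axis]

/-- Fixing the axis means commuting with `τ_3`, which forces `g` to be diagonal. Unitarity and
determinant one then leave a single phase. -/
theorem exists_axial {g : SU2} (h : rot g axis = axis) : ∃ θ, g = axial θ := by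
  have e : g.1 * tau 2 = tau 2 * g.1 := by
    have := congrArg su2 h
    rw [su2_rot, su2_axis] at this
    calc g.1 * tau 2 = g.1 * tau 2 * (g⁻¹).1 * g.1 := by rw [mul_assoc, SU2.inv_mul, mul_one]
      _ = _ := by rw [this]
  have e01 := congrFun (congrFun e 0) 1
  have e10 := congrFun (congrFun e 1) 0
  simp [tau, Matrix.mul_apply, Fin.sum_univ_two] at e01 e10
  have z01 : g.1 0 1 = 0 := by
    have : Complex.I * g.1 0 1 = 0 := by linear_combination e01
    simpa using this
  have z10 : g.1 1 0 = 0 := by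
    have : Complex.I * g.1 1 0 = 0 := by linear_combination -e10
    simpa using this
  have hu := g.2
  rw [Matrix.mem_specialUnitaryGroup_iff, Matrix.mem_unitaryGroup_iff] at hu
  obtain ⟨hu, hd⟩ := hu
  rw [Matrix.det_fin_two, z01, zero_mul, sub_zero] at hd
  have h11 := congrFun (congrFun hu 1) 1
  simp [Matrix.mul_apply, Fin.sum_univ_two, Matrix.star_apply, z10] at h11
  have hn : ‖g.1 1 1‖ = 1 := by
    rw [Complex.mul_conj, Complex.normSq_eq_norm_sq] at h11
    have : ‖g.1 1 1‖ ^ 2 = 1 := by exact_mod_cast h11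
    nlinarith [norm_nonneg (g.1 1 1)]
  have h1 : Complex.exp ((Complex.I / 2) * (2 * Complex.arg (g.1 1 1) : ℝ)) = g.1 1 1 := by
    have := Complex.norm_mul_exp_arg_mul_I (g.1 1 1)
    rw [hn, Complex.ofReal_one, one_mul] at this
    refine Eq.trans ?_ this
    congr 1; push_cast; ring
  -- The lower right entry of `e^{θ τ_3}` is `e^{iθ/2}`, hence the factor two.
  refine ⟨2 * Complex.arg (g.1 1 1), Subtype.ext ?_⟩
  simp only [axial]
  rw [expTau3_eq, h1, neg_mul, Complex.exp_neg, h1]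
  have h0 : g.1 0 0 = (g.1 1 1)⁻¹ := eq_inv_of_mul_eq_one_left hd
  ext i j
  fin_cases i <;> fin_cases j <;> simp [z01, z10, h0]

theorem Sections.rot_n {L : Fin 3 → ℕ} (S : Sections L) (e : Edge L) {V : R3} (h : V ⬝ᵥ V = 1) :
    rot (S.n e V) axis = V := by
  symm; rw [rot_eq_iff, su2_axis]; exact S.n_spec e V h

theorem Sections.rot_nt {L : Fin 3 → ℕ} (S : Sections L) (e : Edge L) {V : R3} (h : V ⬝ᵥ V = 1) :
    rot (S.nt e V) axis = -V := by
  symm; rw [rot_eq_iff, su2_axis, su2_neg, S.nt_spec e V h, neg_neg]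

theorem Sections.rot_nv {L : Fin 3 → ℕ} (S : Sections L) (v : Vertex L) {V : R3}
    (h : V ⬝ᵥ V = 1) : rot (S.nv v V) axis = V := by
  symm; rw [rot_eq_iff, su2_axis]; exact S.nv_spec v V h

/-- `SU(2)` acts transitively on oriented orthonormal frames, as soon as a section over the sphere
exists. -/
theorem exists_rot_frame {n : R3 → SU2} (hn : ∀ V, V ⬝ᵥ V = 1 → rot (n V) axis = V) {k a : R3}
    (hk : k ⬝ᵥ k = 1) (ha : a ⬝ᵥ a = 1) (hka : k ⬝ᵥ a = 0) :
    ∃ g : SU2, rot g axis = k ∧ rot g ![1, 0, 0] = a := by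
  set b := rot (n k)⁻¹ a with hb
  have hab : axis ⬝ᵥ b = 0 := by
    rw [← rot_dot (n k), hn k hk, hb, rot_rot_inv, hka]
  have hbb : b ⬝ᵥ b = 1 := by rw [hb, rot_dot, ha]
  have h2 : b 2 = 0 := by simpa [axis, dotProduct, Fin.sum_univ_three] using hab
  have h01 : b 0 ^ 2 + b 1 ^ 2 = 1 := by
    simp [dotProduct, Fin.sum_univ_three, h2] at hbb; linarith
  have hn1 : ‖(⟨b 0, b 1⟩ : ℂ)‖ = 1 := by
    rw [Complex.norm_eq_sqrt_sq_add_sq, h01, Real.sqrt_one]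
  have hne : (⟨b 0, b 1⟩ : ℂ) ≠ 0 := by rw [← norm_pos_iff, hn1]; exact one_pos
  -- The section moves the axis to `k`; beforehand a rotation about the axis, by the polar angle of
  -- the pulled-back vector `b`, takes the first basis vector to `b`.
  refine ⟨n k * axial (Complex.arg ⟨b 0, b 1⟩), ?_, ?_⟩
  · rw [rot_mul, rot_axial_axis, hn k hk]
  · rw [rot_mul, rot_axial, Complex.cos_arg hne, Complex.sin_arg, hn1]
    rw [← rot_rot_inv (n k) a, ← hb]
    congr 1
    ext i; fin_cases i <;> simp [h2]

/-! ### Derivatives of vector-valued curves -/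

theorem hasDerivAt_dot {u w : ℝ → R3} {u' w' : R3} {t : ℝ} (hu : HasDerivAt u u' t)
    (hw : HasDerivAt w w' t) :
    HasDerivAt (fun s => u s ⬝ᵥ w s) (u' ⬝ᵥ w t + u t ⬝ᵥ w') t := by
  rw [hasDerivAt_pi] at hu hw
  simp only [dotProduct, Fin.sum_univ_three]
  refine ((((hu 0).mul (hw 0)).add ((hu 1).mul (hw 1))).add
    ((hu 2).mul (hw 2))).congr_deriv ?_
  ring

theorem hasDerivAt_cross {u w : ℝ → R3} {u' w' : R3} {t : ℝ} (hu : HasDerivAt u u' t)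
    (hw : HasDerivAt w w' t) :
    HasDerivAt (fun s => u s ⨯₃ w s) (u' ⨯₃ w t + u t ⨯₃ w') t := by
  rw [hasDerivAt_pi] at hu hw ⊢
  intro i
  simp only [cross_apply]
  fin_cases i
  · exact (((hu 1).mul (hw 2)).sub ((hu 2).mul (hw 1))).congr_deriv (by simp; ring)
  · exact (((hu 2).mul (hw 0)).sub ((hu 0).mul (hw 2))).congr_deriv (by simp; ring)
  · exact (((hu 0).mul (hw 1)).sub ((hu 1).mul (hw 0))).congr_deriv (by simp; ring)

theorem hasDerivAt_len {k : ℝ → R3} {k' : R3} {t : ℝ} (hk : HasDerivAt k k' t) (h0 : k t ≠ 0) :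
    HasDerivAt (fun s => len (k s)) (k t ⬝ᵥ k' / len (k t)) t := by
  have := (hasDerivAt_dot hk hk).sqrt (dot_self_pos h0).ne'
  refine this.congr_deriv ?_
  rw [dotProduct_comm k']
  have := len_pos h0
  change _ / (2 * len (k t)) = _
  field_simp; ring

/-! ### Smoothness of the vector constructions and of angles along curves. -/

section Smoothness

variable {t : ℝ}

theorem contDiffAt_dot {u w : ℝ → R3} (hu : ContDiffAt ℝ ∞ u t) (hw : ContDiffAt ℝ ∞ w t) :
    ContDiffAt ℝ ∞ (fun s => u s ⬝ᵥ w s) t := by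
  rw [contDiffAt_pi] at hu hw
  simp only [dotProduct]
  exact ContDiffAt.sum fun i _ => (hu i).mul (hw i)

theorem contDiffAt_cross {u w : ℝ → R3} (hu : ContDiffAt ℝ ∞ u t) (hw : ContDiffAt ℝ ∞ w t) :
    ContDiffAt ℝ ∞ (fun s => u s ⨯₃ w s) t := by
  rw [contDiffAt_pi] at hu hw ⊢
  intro i
  simp only [cross_apply]
  fin_cases i
  · exact ((hu 1).mul (hw 2)).sub ((hu 2).mul (hw 1))
  · exact ((hu 2).mul (hw 0)).sub ((hu 0).mul (hw 2))
  · exact ((hu 0).mul (hw 1)).sub ((hu 1).mul (hw 0))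

theorem contDiffAt_len {u : ℝ → R3} (hu : ContDiffAt ℝ ∞ u t) (h0 : u t ≠ 0) :
    ContDiffAt ℝ ∞ (fun s => len (u s)) t :=
  (contDiffAt_dot hu hu).sqrt (dot_self_pos h0).ne'

theorem contDiffAt_dir {u : ℝ → R3} (hu : ContDiffAt ℝ ∞ u t) (h0 : u t ≠ 0) :
    ContDiffAt ℝ ∞ (fun s => dir (u s)) t :=
  ((contDiffAt_len hu h0).inv (len_pos h0).ne').smul hu

theorem contDiffAt_turn {k a : ℝ → R3} {θ : ℝ → Real.Angle} (hk : ContDiffAt ℝ ∞ k t)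
    (h0 : k t ≠ 0) (hθ : SmoothAngleAt θ t) (ha : ContDiffAt ℝ ∞ a t) :
    ContDiffAt ℝ ∞ (fun s => turn (k s) (θ s) (a s)) t :=
  (hθ.1.smul ha).add (hθ.2.smul (contDiffAt_cross (contDiffAt_dir hk h0) ha))

/-- The strict triangle inequality at `t` keeps the radicand away from zero, the only place where
smoothness could fail apart from the division by the base length. -/
theorem contDiffAt_hinge {k a : ℝ → R3} {p r : ℝ → ℝ} (hk : ContDiffAt ℝ ∞ k t)
    (ha : ContDiffAt ℝ ∞ a t) (hp : ContDiffAt ℝ ∞ p t) (hr : ContDiffAt ℝ ∞ r t)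
    (h : Triangle (len (k t)) (p t) (r t)) :
    ContDiffAt ℝ ∞ (fun s => hinge (k s) (a s) (p s) (r s)) t := by
  have hc := h.pos.1
  have hl := contDiffAt_len hk (ne_zero_of_len_pos hc)
  have hnum := ((hp.pow 2).add (hl.pow 2)).sub (hr.pow 2)
  refine ContDiffAt.add (ContDiffAt.smul (hnum.div (contDiffAt_const.mul (hl.pow 2)) ?_) hk)
    (ContDiffAt.smul (ContDiffAt.div (ContDiffAt.sqrt ((hp.pow 2).sub
      ((hnum.div (contDiffAt_const.mul hl) ?_).pow 2)) h.radicand_pos.ne') hl hc.ne')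
      (contDiffAt_cross hk ha))
  · positivity
  · positivity

theorem SmoothAngleAt.congr {α β : ℝ → Real.Angle} (h : SmoothAngleAt α t) (e : β =ᶠ[𝓝 t] α) :
    SmoothAngleAt β t :=
  ⟨h.1.congr_of_eventuallyEq (e.fun_comp Real.Angle.cos),
    h.2.congr_of_eventuallyEq (e.fun_comp Real.Angle.sin)⟩

theorem SmoothAngleAt.add {α β : ℝ → Real.Angle} (hα : SmoothAngleAt α t)
    (hβ : SmoothAngleAt β t) : SmoothAngleAt (fun s => α s + β s) t := by
  simp only [SmoothAngleAt, Real.Angle.cos_add, Real.Angle.sin_add]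
  exact ⟨(hα.1.mul hβ.1).sub (hα.2.mul hβ.2), (hα.2.mul hβ.1).add (hα.1.mul hβ.2)⟩

theorem SmoothAngleAt.neg {α : ℝ → Real.Angle} (hα : SmoothAngleAt α t) :
    SmoothAngleAt (fun s => -α s) t := by
  simp only [SmoothAngleAt, Real.Angle.cos_neg, Real.Angle.sin_neg]
  exact ⟨hα.1, hα.2.neg⟩

theorem SmoothAngleAt.sub {α β : ℝ → Real.Angle} (hα : SmoothAngleAt α t)
    (hβ : SmoothAngleAt β t) : SmoothAngleAt (fun s => α s - β s) t := by
  simp only [sub_eq_add_neg]; exact hα.add hβ.neg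

theorem ContDiffAt.hasDerivAt_infty {E : Type*} [NormedAddCommGroup E] [NormedSpace ℝ E]
    {f : ℝ → E} (hf : ContDiffAt ℝ ∞ f t) : HasDerivAt f (deriv f t) t :=
  (hf.differentiableAt (by simp)).hasDerivAt

theorem angleDeriv_add {α β : ℝ → Real.Angle} (hα : SmoothAngleAt α t)
    (hβ : SmoothAngleAt β t) :
    angleDeriv (fun s => α s + β s) t = angleDeriv α t + angleDeriv β t := by
  have c1 := ContDiffAt.hasDerivAt_infty hα.1
  have s1 := ContDiffAt.hasDerivAt_infty hα.2
  have c2 := ContDiffAt.hasDerivAt_infty hβ.1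
  have s2 := ContDiffAt.hasDerivAt_infty hβ.2
  have hc := ((c1.mul c2).sub (s1.mul s2)).deriv
  have hs := ((s1.mul c2).add (c1.mul s2)).deriv
  have h1 := (α t).cos_sq_add_sin_sq
  have h2 := (β t).cos_sq_add_sin_sq
  simp only [angleDeriv, Real.Angle.cos_add, Real.Angle.sin_add]
  simp only [Pi.mul_def, Pi.sub_def, Pi.add_def] at hc hs
  rw [hc, hs]
  linear_combination
    ((α t).cos * deriv (fun s => (α s).sin) t - (α t).sin * deriv (fun s => (α s).cos) t) * h2 +
    ((β t).cos * deriv (fun s => (β s).sin) t - (β t).sin * deriv (fun s => (β s).cos) t) * h1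

theorem smoothAngleAt_angleAbout {k u w : ℝ → R3} (hk : ContDiffAt ℝ ∞ k t)
    (hu : ContDiffAt ℝ ∞ u t) (hw : ContDiffAt ℝ ∞ w t)
    (h : ∀ᶠ s in 𝓝 t, Transverse (k s) (u s) (w s)) :
    SmoothAngleAt (fun s => angleAbout (k s) (u s) (w s)) t := by
  have h0 := h.self_of_nhds
  have lk := contDiffAt_len hk h0.k0
  have lu := contDiffAt_len hu h0.u0
  have lw := contDiffAt_len hw h0.w0
  have pk := (len_pos h0.k0).ne'
  have pu := (len_pos h0.u0).ne'
  have pw := (len_pos h0.w0).ne'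
  constructor
  · refine ContDiffAt.congr_of_eventuallyEq ?_ (h.mono fun s hs => hs.cos_angle)
    exact (contDiffAt_dot hu hw).div (lu.mul lw) (mul_ne_zero pu pw)
  · refine ContDiffAt.congr_of_eventuallyEq ?_ (h.mono fun s hs => hs.sin_angle)
    exact (contDiffAt_dot hk (contDiffAt_cross hu hw)).div ((lk.mul lu).mul lw)
      (mul_ne_zero (mul_ne_zero pk pu) pw)

end Smoothness

/-! ### The rate at which a direction turns about an axis -/

/-- For `u` orthogonal to `k`, this is `|k|` times the angular velocity of the direction of `u`
about `k` at time `t`. It is linear in `k`. -/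
def spin (k : R3) (u : ℝ → R3) (t : ℝ) : ℝ := deriv u t ⬝ᵥ (k ⨯₃ u t) / (u t ⬝ᵥ u t)

theorem spin_add (k l : R3) (u : ℝ → R3) (t : ℝ) : spin (k + l) u t = spin k u t + spin l u t := by
  simp only [spin, map_add, LinearMap.add_apply, dotProduct_add, add_div]

theorem spin_smul_axis (r : ℝ) (k : R3) (u : ℝ → R3) (t : ℝ) :
    spin (r • k) u t = r * spin k u t := by
  simp only [spin, map_smul, LinearMap.smul_apply, dotProduct_smul, smul_eq_mul, mul_div_assoc]

theorem spin_zero (u : ℝ → R3) (t : ℝ) : spin 0 u t = 0 := by simp [spin]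

theorem spin_congr {k : R3} {u w : ℝ → R3} {t : ℝ} (h : u =ᶠ[𝓝 t] w) :
    spin k u t = spin k w t := by
  rw [spin, spin, h.deriv_eq, h.self_of_nhds]

/-- Differentiating the factor adds a multiple of `u`, which is orthogonal to `k × u`. -/
theorem spin_smul {k : R3} {u : ℝ → R3} {f : ℝ → ℝ} {t : ℝ} (hf : DifferentiableAt ℝ f t)
    (hu : DifferentiableAt ℝ u t) (h0 : f t ≠ 0) :
    spin k (fun s => f s • u s) t = spin k u t := by
  rw [spin, spin, (hf.hasDerivAt.fun_smul hu.hasDerivAt).deriv]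
  simp only [map_smul, dotProduct_smul, smul_dotProduct, add_dotProduct, dot_cross_right,
    smul_eq_mul]
  rw [mul_zero, add_zero]
  -- If `u` vanishes at `t`, both quotients are zero by the convention for division by zero.
  by_cases hz : u t ⬝ᵥ u t = 0
  · simp [hz]
  · field_simp

theorem spin_neg (k : R3) (u : ℝ → R3) (t : ℝ) : spin k (fun s => -u s) t = spin k u t := by
  simp only [spin, deriv.fun_neg, map_neg, neg_dotProduct, dotProduct_neg, neg_neg]

/-- The derivative of the common denominator cancels in `X dY - Y dX`, so lengths enter angle forms
only as an overall factor. -/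
theorem wronskian_div {X Y r : ℝ → ℝ} {X' Y' r' t : ℝ} (hX : HasDerivAt X X' t)
    (hY : HasDerivAt Y Y' t) (hr : HasDerivAt r r' t) (h0 : r t ≠ 0) :
    X t / r t * deriv (fun s => Y s / r s) t - Y t / r t * deriv (fun s => X s / r s) t =
      (X t * Y' - Y t * X') / r t ^ 2 := by
  rw [(hX.fun_div hr h0).deriv, (hY.fun_div hr h0).deriv]
  field_simp
  ring

/-- Why a moving axis does no harm: `u × w` is parallel to `k`, so `k' ⬝ᵥ (u × w)` is determined by
`k ⬝ᵥ k'` and cancels the term coming from the derivative of `|k|`. The rest is `cross_decomp`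
applied to `u` and to `w`. -/
theorem wronskian_identity {k u w k' u' w' : R3} (hu : k ⬝ᵥ u = 0) (hw : k ⬝ᵥ w = 0) :
    (k ⬝ᵥ k) * ((u ⬝ᵥ w) * (k' ⬝ᵥ (u ⨯₃ w) + k ⬝ᵥ (u' ⨯₃ w + u ⨯₃ w'))
      - (k ⬝ᵥ (u ⨯₃ w)) * (u' ⬝ᵥ w + u ⬝ᵥ w')) - (k ⬝ᵥ k') * (u ⬝ᵥ w) * (k ⬝ᵥ (u ⨯₃ w)) =
    (k ⬝ᵥ k) * ((u ⬝ᵥ u) * (w' ⬝ᵥ (k ⨯₃ w)) - (w ⬝ᵥ w) * (u' ⬝ᵥ (k ⨯₃ u))) := by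
  have d1 := congrArg (fun v => w' ⬝ᵥ v) (cross_decomp (w := w) hu)
  have d2 := congrArg (fun v => u' ⬝ᵥ v) (cross_decomp (w := u) hw)
  simp only [dotProduct_smul, dotProduct_sub, smul_eq_mul] at d1 d2
  have d3 : (k ⬝ᵥ k) * (k' ⬝ᵥ (u ⨯₃ w)) = (k ⬝ᵥ k') * (k ⬝ᵥ (u ⨯₃ w)) := by
    have : (k ⬝ᵥ k) * (k' ⬝ᵥ (u ⨯₃ w)) = (k ⬝ᵥ k') * (k ⬝ᵥ (u ⨯₃ w))
        - (k ⬝ᵥ u) * (k' ⬝ᵥ (w ⨯₃ k)) - (k ⬝ᵥ w) * (k' ⬝ᵥ (k ⨯₃ u)) := by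
      simp only [cross_apply, dotProduct, Fin.sum_univ_three, Matrix.cons_val]; ring
    simpa [hu, hw] using this
  have e1 : k ⬝ᵥ (u ⨯₃ w') = w' ⬝ᵥ (k ⨯₃ u) := by
    simp only [cross_apply, dotProduct, Fin.sum_univ_three, Matrix.cons_val]; ring
  have e2 : k ⬝ᵥ (u' ⨯₃ w) = -(u' ⬝ᵥ (k ⨯₃ w)) := by
    simp only [cross_apply, dotProduct, Fin.sum_univ_three, Matrix.cons_val]; ring
  have e3 : k ⬝ᵥ (w ⨯₃ u) = -(k ⬝ᵥ (u ⨯₃ w)) := by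
    rw [← cross_anticomm, dotProduct_neg]
  rw [d1, d2, dotProduct_add, e1, e2, e3, dotProduct_comm w u, dotProduct_comm u w']
  linear_combination (u ⬝ᵥ w) * d3

/-- The bridge from angles to turning rates. The right side is linear in the axis, which is what
later lets contributions of different angles be combined. -/
theorem angleDeriv_angleAbout {k u w : ℝ → R3} {t : ℝ} (hk : DifferentiableAt ℝ k t)
    (hu : DifferentiableAt ℝ u t) (hw : DifferentiableAt ℝ w t)
    (h : ∀ᶠ s in 𝓝 t, Transverse (k s) (u s) (w s)) :
    len (k t) * angleDeriv (fun s => angleAbout (k s) (u s) (w s)) t =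
      spin (k t) w t - spin (k t) u t := by
  have h0 := h.self_of_nhds
  have pk := len_pos h0.k0
  have pu := len_pos h0.u0
  have pw := len_pos h0.w0
  have dk := hasDerivAt_len hk.hasDerivAt h0.k0
  have du := hasDerivAt_len hu.hasDerivAt h0.u0
  have dw := hasDerivAt_len hw.hasDerivAt h0.w0
  -- The cosine is given the superfluous factor `len k` so that it shares its denominator with the
  -- sine, as `wronskian_div` requires.
  have ec : (fun s => (angleAbout (k s) (u s) (w s)).cos) =ᶠ[𝓝 t]
      fun s => len (k s) * (u s ⬝ᵥ w s) / (len (k s) * len (u s) * len (w s)) := by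
    filter_upwards [h] with s hs
    have := len_pos hs.k0; have := len_pos hs.u0; have := len_pos hs.w0
    rw [hs.cos_angle]; field_simp
  have es : (fun s => (angleAbout (k s) (u s) (w s)).sin) =ᶠ[𝓝 t]
      fun s => k s ⬝ᵥ (u s ⨯₃ w s) / (len (k s) * len (u s) * len (w s)) := by
    filter_upwards [h] with s hs using hs.sin_angle
  rw [angleDeriv, ec.deriv_eq, es.deriv_eq, show (angleAbout (k t) (u t) (w t)).cos = _ from ec.self_of_nhds,
    show (angleAbout (k t) (u t) (w t)).sin = _ from es.self_of_nhds,
    wronskian_div (dk.fun_mul (hasDerivAt_dot hu.hasDerivAt hw.hasDerivAt))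
      (hasDerivAt_dot hk.hasDerivAt (hasDerivAt_cross hu.hasDerivAt hw.hasDerivAt))
      ((dk.fun_mul du).fun_mul dw) (by positivity), spin, spin]
  have key := wronskian_identity (k' := deriv k t) (u' := deriv u t) (w' := deriv w t) h0.hu h0.hw
  simp only [← len_sq] at key ⊢
  field_simp
  linear_combination key

/-! ### Curves in `SU(2)` -/

theorem Tr_add (X Y Z : Matrix (Fin 2) (Fin 2) ℂ) : Tr X (Y + Z) = Tr X Y + Tr X Z := by
  simp [Tr, mul_add]

theorem Tr_smul (r : ℝ) (X Y : Matrix (Fin 2) (Fin 2) ℂ) : Tr ((r : ℂ) • X) Y = r * Tr X Y := by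
  simp [Tr]; ring

theorem Tr_add_left (X Y Z : Matrix (Fin 2) (Fin 2) ℂ) : Tr (X + Y) Z = Tr X Z + Tr Y Z := by
  simp [Tr, add_mul]; ring

theorem Tr_neg_left (X Y : Matrix (Fin 2) (Fin 2) ℂ) : Tr (-X) Y = -Tr X Y := by
  simp [Tr]

theorem dot_Tr_tau (Y : R3) (X : Matrix (Fin 2) (Fin 2) ℂ) :
    (fun i => Tr (tau i) X) ⬝ᵥ Y = Tr (su2 Y) X := by
  simp only [su2, dotProduct, Fin.sum_univ_three, Tr_add_left, Tr_smul]; ring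

/-- Cyclicity of the trace, in the form that moves a commutator from one argument to the other. -/
theorem Tr_commutator (A B X : Matrix (Fin 2) (Fin 2) ℂ) :
    Tr A (X * B - B * X) = Tr (B * A - A * B) X := by
  simp only [Tr]
  congr 2
  rw [mul_sub, sub_mul, Matrix.trace_sub, Matrix.trace_sub, ← mul_assoc A X B,
    Matrix.trace_mul_comm (A * X) B, mul_assoc B A X, ← mul_assoc A B X]

/-- Entrywise differentiability of a curve of matrices. -/
def MatrixDerivAt (A : ℝ → Matrix (Fin 2) (Fin 2) ℂ) (A' : Matrix (Fin 2) (Fin 2) ℂ) (t : ℝ) :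
    Prop := ∀ i j, HasDerivAt (fun s => A s i j) (A' i j) t

theorem MatrixDerivAt.mul {A B : ℝ → Matrix (Fin 2) (Fin 2) ℂ} {A' B' : Matrix (Fin 2) (Fin 2) ℂ}
    {t : ℝ} (hA : MatrixDerivAt A A' t) (hB : MatrixDerivAt B B' t) :
    MatrixDerivAt (fun s => A s * B s) (A' * B t + A t * B') t := by
  intro i j
  simp only [Matrix.mul_apply, Fin.sum_univ_two, Matrix.add_apply]
  refine (((hA i 0).mul (hB 0 j)).add ((hA i 1).mul (hB 1 j))).congr_deriv ?_
  ring

theorem MatrixDerivAt.star {A : ℝ → Matrix (Fin 2) (Fin 2) ℂ} {A' : Matrix (Fin 2) (Fin 2) ℂ}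
    {t : ℝ} (hA : MatrixDerivAt A A' t) : MatrixDerivAt (fun s => star (A s)) (star A') t :=
  fun i j => (hA j i).star

theorem MatrixDerivAt.unique {A : ℝ → Matrix (Fin 2) (Fin 2) ℂ}
    {A' A'' : Matrix (Fin 2) (Fin 2) ℂ} {t : ℝ} (h : MatrixDerivAt A A' t)
    (h' : MatrixDerivAt A A'' t) : A' = A'' := by
  ext i j; exact (h i j).unique (h' i j)

theorem MatrixDerivAt.Tr {A : ℝ → Matrix (Fin 2) (Fin 2) ℂ} {A' : Matrix (Fin 2) (Fin 2) ℂ}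
    {t : ℝ} (hA : MatrixDerivAt A A' t) (X : Matrix (Fin 2) (Fin 2) ℂ) :
    HasDerivAt (fun s => TwistedGeometry.Tr X (A s)) (TwistedGeometry.Tr X A') t := by
  have h (i j : Fin 2) : HasDerivAt (fun s => X i j * A s j i) (X i j * A' j i) t :=
    (hA j i).const_mul _
  have := (((h 0 0).add (h 0 1)).add ((h 1 0).add (h 1 1))).const_mul (-2 : ℂ)
  have h2 := Complex.reCLM.hasFDerivAt.comp_hasDerivAt t this
  simp only [TwistedGeometry.Tr, Matrix.trace_fin_two, Matrix.mul_apply, Fin.sum_univ_two]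
  exact h2

theorem matrixDerivAt_su2 {u : ℝ → R3} {u' : R3} {t : ℝ} (hu : HasDerivAt u u' t) :
    MatrixDerivAt (fun s => su2 (u s)) (su2 u') t := by
  rw [hasDerivAt_pi] at hu
  intro i j
  simp only [su2, Fin.sum_univ_three, Matrix.add_apply, Matrix.smul_apply, smul_eq_mul]
  exact (((hu 0).ofReal_comp.mul_const _).add ((hu 1).ofReal_comp.mul_const _)).add
    ((hu 2).ofReal_comp.mul_const _)

/-- Entrywise smoothness of a curve in `SU(2)`. -/
def SmoothSU2At (g : ℝ → SU2) (t : ℝ) : Prop :=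
  ∀ i j, ContDiffAt ℝ ∞ (fun s => (g s).1 i j) t

theorem SmoothSU2At.inv {g : ℝ → SU2} {t : ℝ} (hg : SmoothSU2At g t) :
    SmoothSU2At (fun s => (g s)⁻¹) t := fun i j =>
  Complex.conjCLE.contDiff.contDiffAt.comp t (hg j i)

theorem SmoothSU2At.mul {g h : ℝ → SU2} {t : ℝ} (hg : SmoothSU2At g t) (hh : SmoothSU2At h t) :
    SmoothSU2At (fun s => g s * h s) t := fun i j => by
  simp only [Submonoid.coe_mul, Matrix.mul_apply, Fin.sum_univ_two]
  exact ((hg i 0).mul (hh 0 j)).add ((hg i 1).mul (hh 1 j))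

theorem contDiffAt_rot {g : ℝ → SU2} {u : ℝ → R3} {t : ℝ} (hg : SmoothSU2At g t)
    (hu : ContDiffAt ℝ ∞ u t) : ContDiffAt ℝ ∞ (fun s => rot (g s) (u s)) t := by
  have hv : ∀ i j, ContDiffAt ℝ ∞ (fun s => su2 (u s) i j) t := by
    rw [contDiffAt_pi] at hu
    intro i j
    simp only [su2, Fin.sum_univ_three, Matrix.add_apply, Matrix.smul_apply, smul_eq_mul]
    have h (k : Fin 3) : ContDiffAt ℝ ∞ (fun s => ((u s k : ℝ) : ℂ) * tau k i j) t :=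
      (Complex.ofRealCLM.contDiff.contDiffAt.comp t (hu k)).mul contDiffAt_const
    exact ((h 0).add (h 1)).add (h 2)
  have hi := hg.inv
  rw [contDiffAt_pi]
  intro k
  simp only [rot, Tr, Matrix.trace_fin_two, Matrix.mul_apply, Fin.sum_univ_two]
  have h1 (i j : Fin 2) : ContDiffAt ℝ ∞
      (fun s => (g s).1 i 0 * su2 (u s) 0 j + (g s).1 i 1 * su2 (u s) 1 j) t :=
    ((hg i 0).mul (hv 0 j)).add ((hg i 1).mul (hv 1 j))
  have h2 (i j : Fin 2) : ContDiffAt ℝ ∞ (fun s =>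
      ((g s).1 i 0 * su2 (u s) 0 0 + (g s).1 i 1 * su2 (u s) 1 0) * ((g s)⁻¹).1 0 j +
      ((g s).1 i 0 * su2 (u s) 0 1 + (g s).1 i 1 * su2 (u s) 1 1) * ((g s)⁻¹).1 1 j) t :=
    ((h1 i 0).mul (hi 0 j)).add ((h1 i 1).mul (hi 1 j))
  have h3 (c₁ c₂ c₃ c₄ : ℂ) := ((((contDiffAt_const (c := c₁)).mul (h2 0 0)).add
    ((contDiffAt_const (c := c₂)).mul (h2 1 0))).add
    (((contDiffAt_const (c := c₃)).mul (h2 0 1)).add ((contDiffAt_const (c := c₄)).mul (h2 1 1))))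
  have h4 := (contDiffAt_const (c := (-2 : ℂ))).mul
    (h3 (tau k 0 0) (tau k 0 1) (tau k 1 0) (tau k 1 1))
  exact Complex.reCLM.contDiff.contDiffAt.comp t h4

theorem SectionSmoothAt.smoothSU2At {n : R3 → SU2} {V : ℝ → R3} {t : ℝ}
    (hn : SectionSmoothAt n (V t)) (hV : ContDiffAt ℝ ∞ V t) (h1 : ∀ᶠ s in 𝓝 t, V s ⬝ᵥ V s = 1) :
    SmoothSU2At (fun s => n (V s)) t := by
  obtain ⟨U, f, hU, hmem, hf, he⟩ := hn
  intro i j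
  have hnear : ∀ᶠ s in 𝓝 t, V s ∈ U := hV.continuousAt.eventually_mem (hU.mem_nhds hmem)
  refine (((hf i j).contDiffAt (hU.mem_nhds hmem)).comp t hV).congr_of_eventuallyEq ?_
  filter_upwards [hnear, h1] with s hs hs1
  rw [Function.comp_apply, he _ hs hs1]

/-- The turning rate of a direction that is carried along by a frame `g`. -/
theorem spin_rot {g : ℝ → SU2} {q : ℝ → R3} {t : ℝ} (hg : SmoothSU2At g t)
    (hq : DifferentiableAt ℝ q t) (h0 : q t ≠ 0) {k : R3} (hk : k ⬝ᵥ q t = 0) :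
    spin (rot (g t) k) (fun s => rot (g s) (q s)) t =
      Tr (su2 (rot (g t) k))
        ((Matrix.of fun i j => deriv (fun s => (g s).1 i j) t) * ((g t)⁻¹).1) + spin k q t := by
  set G : Matrix (Fin 2) (Fin 2) ℂ := Matrix.of fun i j => deriv (fun s => (g s).1 i j) t
  have hG : MatrixDerivAt (fun s => (g s).1) G t := fun i j =>
    ContDiffAt.hasDerivAt_infty (hg i j)
  have hGs := hG.star
  -- The derivative of `g g* = 1`; it expresses the derivative of the inverse through `G`.
  have hone : G * star (g t).1 + (g t).1 * star G = 0 := by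
    refine (hG.mul hGs).unique fun i j => ?_
    have : (fun s => ((g s).1 * star (g s).1) i j) = fun _ =>
        (1 : Matrix (Fin 2) (Fin 2) ℂ) i j := by
      funext s; rw [← SU2.val_inv, SU2.mul_inv]
    rw [this]; exact hasDerivAt_const _ _
  have hm := (hG.mul (matrixDerivAt_su2 hq.hasDerivAt)).mul hGs
  set X := G * ((g t)⁻¹).1 with hX
  -- With `X = dg g⁻¹`, the derivative of `g q g⁻¹` is the commutator of `X` with the rotated vector
  -- plus the rotated derivative of `q`.
  have hX' : (G * su2 (q t) + (g t).1 * su2 (deriv q t)) * star (g t).1 +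
      (g t).1 * su2 (q t) * star G = (X * su2 (rot (g t) (q t)) - su2 (rot (g t) (q t)) * X) +
        su2 (rot (g t) (deriv q t)) := by
    have hs : star G = -(star (g t).1 * G * star (g t).1) := by
      have h2 := congrArg (fun Y => star (g t).1 * Y) hone
      simp only [mul_add, mul_zero] at h2
      rw [← mul_assoc (star (g t).1) (g t).1, ← SU2.val_inv, SU2.inv_mul, one_mul,
        ← mul_assoc] at h2
      exact eq_neg_of_add_eq_zero_right h2
    rw [hs, su2_rot, su2_rot, hX, SU2.val_inv]
    have e1 : G * star (g t).1 * ((g t).1 * su2 (q t) * star (g t).1) =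
        G * su2 (q t) * star (g t).1 := by
      calc _ = G * (star (g t).1 * (g t).1) * su2 (q t) * star (g t).1 := by simp only [mul_assoc]
        _ = _ := by rw [← SU2.val_inv, SU2.inv_mul, mul_one]
    rw [e1]
    noncomm_ring
  have hder : HasDerivAt (fun s => rot (g s) (q s)) (fun i => Tr (tau i)
      ((X * su2 (rot (g t) (q t)) - su2 (rot (g t) (q t)) * X) +
        su2 (rot (g t) (deriv q t)))) t := by
    rw [hasDerivAt_pi]
    intro i
    rw [← hX']
    exact hm.Tr (tau i)
  have hp : 0 < q t ⬝ᵥ q t := dot_self_pos h0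
  -- For `l` orthogonal to `p` the double product is `|p|² l`; this turns the commutator term into
  -- `Tr` of the rotated axis with `X`.
  have ecr : ∀ p l : R3, p ⨯₃ (l ⨯₃ p) = (p ⬝ᵥ p) • l - (l ⬝ᵥ p) • p := by
    intro p l
    simp only [cross_apply, dotProduct, Fin.sum_univ_three, Matrix.cons_val]
    ext i
    simp only [Pi.sub_apply, Pi.smul_apply, smul_eq_mul]
    fin_cases i <;> simp <;> ring
  rw [spin, hder.deriv, dot_Tr_tau, Tr_add, Tr_commutator, ← su2_cross, ecr, rot_dot, rot_dot, hk,
    zero_smul, sub_zero, su2_smul, Tr_smul, Tr_su2, ← rot_cross, rot_dot, spin,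
    dotProduct_comm _ (deriv q t)]
  field_simp

/-! ### Reconstruction of polygons from lengths and dihedral angles -/

theorem Triangle.rotate {a b c : ℝ} (h : Triangle a b c) : Triangle c b a := by
  obtain ⟨h1, h2⟩ := h
  have := abs_lt.mp h1
  exact ⟨abs_lt.mpr ⟨by linarith, by linarith⟩, by linarith⟩

theorem dir_cross_smul {p r : ℝ} (hp : 0 < p) (hr : 0 < r) (u w : R3) :
    dir ((p • u) ⨯₃ (r • w)) = dir (u ⨯₃ w) := by
  simp only [map_smul, LinearMap.smul_apply, smul_smul]
  exact dir_smul (mul_pos hr hp) _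

theorem len_smul_unit {p : ℝ} (hp : 0 < p) {u : R3} (hu : u ⬝ᵥ u = 1) : len (p • u) = p := by
  rw [len_smul hp.le, len_eq_one hu, mul_one]

theorem dot_eq_zero_of_dir {k u : R3} (h : k ⬝ᵥ dir u = 0) (hu : u ≠ 0) : k ⬝ᵥ u = 0 := by
  rw [← len_smul_dir hu, dotProduct_smul, h, smul_zero]

theorem ne_zero_of_dir_unit {u : R3} (h : dir u ⬝ᵥ dir u = 1) : u ≠ 0 := by
  rintro rfl; simp [dir] at h

section Pair

variable {p r : ℝ} {M N : R3}

theorem pair_triangle (hp : 0 < p) (hr : 0 < r) (hM : M ⬝ᵥ M = 1) (hN : N ⬝ᵥ N = 1)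
    (h : Triangle (len (p • M + r • N)) p r) :
    Triangle (len (p • M + r • N)) (len (p • M)) (len (r • N)) := by
  rwa [len_smul_unit hp hM, len_smul_unit hr hN]

theorem pair_cross_ne_zero (hp : 0 < p) (hr : 0 < r) (hM : M ⬝ᵥ M = 1) (hN : N ⬝ᵥ N = 1)
    (h : Triangle (len (p • M + r • N)) p r) : M ⨯₃ N ≠ 0 := by
  intro h0
  apply cross_ne_zero_of_triangle (pair_triangle hp hr hM hN h)
  simp [h0]

theorem pair_dot_cross (p r : ℝ) (M N : R3) : (p • M + r • N) ⬝ᵥ (M ⨯₃ N) = 0 := by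
  simp

theorem pair_transverse (hp : 0 < p) (hr : 0 < r) (hM : M ⬝ᵥ M = 1) (hN : N ⬝ᵥ N = 1)
    (h : Triangle (len (p • M + r • N)) p r) {u : R3} (hu : u ≠ 0)
    (hku : (p • M + r • N) ⬝ᵥ u = 0) : Transverse (p • M + r • N) u (M ⨯₃ N) :=
  ⟨ne_zero_of_len_pos h.pos.1, hu, pair_cross_ne_zero hp hr hM hN h, hku, pair_dot_cross p r M N⟩

theorem pair_eq_hinge (hp : 0 < p) (hr : 0 < r) (hM : M ⬝ᵥ M = 1) (hN : N ⬝ᵥ N = 1)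
    (h : Triangle (len (p • M + r • N)) p r) {u : R3} (hu : u ≠ 0)
    (hku : (p • M + r • N) ⬝ᵥ u = 0) :
    p • M = hinge (p • M + r • N)
      (turn (p • M + r • N) (angleAbout (p • M + r • N) u (M ⨯₃ N)) (dir u)) p r := by
  rw [← (pair_transverse hp hr hM hN h hu hku).dir_eq_turn]
  have := eq_hinge (pair_triangle hp hr hM hN h)
  rwa [len_smul_unit hp hM, len_smul_unit hr hN, dir_cross_smul hp hr] at this

end Pair

/-- The two unit vectors, in the directions of the sides with lengths `p` and `r` of the triangle
with base `k` and oriented unit normal `a`. -/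
def sides (k a : R3) (p r : ℝ) : Fin 2 → R3 :=
  ![p⁻¹ • hinge k a p r, r⁻¹ • (k - hinge k a p r)]

/-- This and `sides_angle` say that lengths and plane angle can be prescribed; `pair_eq_sides` says
that they determine the two unit vectors. -/
theorem sides_spec {k a : R3} {p r : ℝ} (hka : k ⬝ᵥ a = 0) (ha : a ⬝ᵥ a = 1)
    (h : Triangle (len k) p r) :
    sides k a p r 0 ⬝ᵥ sides k a p r 0 = 1 ∧ sides k a p r 1 ⬝ᵥ sides k a p r 1 = 1 ∧
      p • sides k a p r 0 + r • sides k a p r 1 = k ∧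
      dir (sides k a p r 0 ⨯₃ sides k a p r 1) = a := by
  obtain ⟨h1, h2, h3⟩ := hinge_spec hka ha h
  obtain ⟨-, hp, hr⟩ := h.pos
  have e1 := len_sq (hinge k a p r)
  have e2 := len_sq (k - hinge k a p r)
  rw [h1] at e1; rw [h2] at e2
  simp only [sides, Matrix.cons_val_zero, Matrix.cons_val_one]
  refine ⟨?_, ?_, ?_, ?_⟩
  · simp only [dotProduct_smul, smul_dotProduct, ← e1, smul_eq_mul]; field_simp
  · simp only [dotProduct_smul, smul_dotProduct, ← e2, smul_eq_mul]; field_simp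
  · rw [smul_smul, smul_smul, mul_inv_cancel₀ hp.ne', mul_inv_cancel₀ hr.ne']; simp
  · rw [dir_cross_smul (inv_pos.mpr hp) (inv_pos.mpr hr), h3]

theorem sides_angle {k u : R3} {p r : ℝ} {θ : Real.Angle} (hu : u ≠ 0) (hku : k ⬝ᵥ u = 0)
    (h : Triangle (len k) p r) :
    angleAbout k u (sides k (turn k θ (dir u)) p r 0 ⨯₃ sides k (turn k θ (dir u)) p r 1) = θ := by
  have hk := ne_zero_of_len_pos h.pos.1
  have hd := dot_dir_eq_zero hku
  have hpos := h.pos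
  obtain ⟨h1, h2, h3, h4⟩ := sides_spec (dot_turn hd θ)
    ((turn_dot_self hk hd θ).trans (dir_unit hu)) h
  have ht := pair_transverse hpos.2.1 hpos.2.2 h1 h2 (by rwa [h3]) hu (by rwa [h3])
  rw [h3] at ht
  exact ht.angle_eq h4

theorem pair_eq_sides {p r : ℝ} {M N : R3} (hp : 0 < p) (hr : 0 < r) (hM : M ⬝ᵥ M = 1)
    (hN : N ⬝ᵥ N = 1) (h : Triangle (len (p • M + r • N)) p r) {u : R3} (hu : u ≠ 0)
    (hku : (p • M + r • N) ⬝ᵥ u = 0) :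
    M = sides (p • M + r • N)
      (turn (p • M + r • N) (angleAbout (p • M + r • N) u (M ⨯₃ N)) (dir u)) p r 0 ∧
    N = sides (p • M + r • N)
      (turn (p • M + r • N) (angleAbout (p • M + r • N) u (M ⨯₃ N)) (dir u)) p r 1 := by
  simp only [sides, Matrix.cons_val_zero, Matrix.cons_val_one]
  rw [← pair_eq_hinge hp hr hM hN h hu hku]
  simp [smul_smul, inv_mul_cancel₀ hp.ne', inv_mul_cancel₀ hr.ne']

theorem contDiffAt_sides {t : ℝ} {k a : ℝ → R3} {p r : ℝ → ℝ} (hk : ContDiffAt ℝ ∞ k t)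
    (ha : ContDiffAt ℝ ∞ a t) (hp : ContDiffAt ℝ ∞ p t) (hr : ContDiffAt ℝ ∞ r t)
    (h : Triangle (len (k t)) (p t) (r t)) (i : Fin 2) :
    ContDiffAt ℝ ∞ (fun s => sides (k s) (a s) (p s) (r s) i) t := by
  have hh := contDiffAt_hinge hk ha hp hr h
  fin_cases i
  · exact (hp.inv h.pos.2.1.ne').smul hh
  · exact (hr.inv h.pos.2.2.ne').smul (hk.sub hh)

theorem rot_sides (g : SU2) (k a : R3) (p r : ℝ) (i : Fin 2) :
    rot g (sides k a p r i) = sides (rot g k) (rot g a) p r i := by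
  have hs : ∀ u w : R3, rot g (u - w) = rot g u - rot g w := fun u w => by
    rw [sub_eq_add_neg, rot_add, rot_neg, ← sub_eq_add_neg]
  fin_cases i <;> simp [sides, rot_smul, rot_hinge, hs]

/-! ### Six-sided polygons rebuilt from the sums of consecutive pairs. -/

/-- The partial sums of the sides of a polygon, as in `etaVec`. -/
def polygonVec (η : Fin 6 → ℝ) (N : Fin 6 → R3) : Fin 4 → R3 :=
  let w : Fin 6 → R3 := fun I => η I • N I
  ![w 0 + w 1, w 2 + w 3, w 4 + w 5, (w 0 + w 1) + (w 2 + w 3)]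

/-- The dihedral angles of a polygon, as in `rhoV`. -/
def polygonRho (η : Fin 6 → ℝ) (N : Fin 6 → R3) : Fin 4 → Real.Angle :=
  let E : Fin 4 → R3 := polygonVec η N
  ![angleAbout (E 0) (E 0 ⨯₃ E 1) (N 0 ⨯₃ N 1),
    angleAbout (E 1) (E 0 ⨯₃ E 1) (N 2 ⨯₃ N 3),
    angleAbout (E 2) (E 2 ⨯₃ E 3) (N 4 ⨯₃ N 5),
    angleAbout (E 3) (E 2 ⨯₃ E 3) (E 0 ⨯₃ E 1)]

/-- The unit vectors along the six sides of a polygon whose consecutive pairs of sides have the sums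
`E₀`, `E₁`, `E₂`, the planes of the pairs being turned by `ρ₀`, `ρ₁` from the direction `b` and by
`ρ₂` from the direction `a`. -/
def spread (E₀ E₁ E₂ b a : R3) (η : Fin 6 → ℝ) (ρ₀ ρ₁ ρ₂ : Real.Angle) : Fin 6 → R3 :=
  let A := sides E₀ (turn E₀ ρ₀ b) (η 0) (η 1)
  let B := sides E₁ (turn E₁ ρ₁ b) (η 2) (η 3)
  let C := sides E₂ (turn E₂ ρ₂ a) (η 4) (η 5)
  ![A 0, A 1, B 0, B 1, C 0, C 1]

theorem Fin.forall_six {P : Fin 6 → Prop} (h0 : P 0) (h1 : P 1) (h2 : P 2) (h3 : P 3) (h4 : P 4)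
    (h5 : P 5) : ∀ i, P i := fun i => by fin_cases i <;> assumption

theorem rot_spread (g : SU2) (E₀ E₁ E₂ b a : R3) (η : Fin 6 → ℝ) (ρ₀ ρ₁ ρ₂ : Real.Angle)
    (I : Fin 6) : rot g (spread E₀ E₁ E₂ b a η ρ₀ ρ₁ ρ₂ I) =
      spread (rot g E₀) (rot g E₁) (rot g E₂) (rot g b) (rot g a) η ρ₀ ρ₁ ρ₂ I := by
  fin_cases I <;> simp [spread, rot_sides, rot_turn]

theorem contDiffAt_spread {t : ℝ} {E₀ E₁ E₂ b a : ℝ → R3} {η : ℝ → Fin 6 → ℝ}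
    {ρ₀ ρ₁ ρ₂ : ℝ → Real.Angle} (h0 : ContDiffAt ℝ ∞ E₀ t) (h1 : ContDiffAt ℝ ∞ E₁ t)
    (h2 : ContDiffAt ℝ ∞ E₂ t) (hb : ContDiffAt ℝ ∞ b t) (ha : ContDiffAt ℝ ∞ a t)
    (hη : ∀ I, ContDiffAt ℝ ∞ (fun s => η s I) t) (r0 : SmoothAngleAt ρ₀ t)
    (r1 : SmoothAngleAt ρ₁ t) (r2 : SmoothAngleAt ρ₂ t)
    (T0 : Triangle (len (E₀ t)) (η t 0) (η t 1)) (T1 : Triangle (len (E₁ t)) (η t 2) (η t 3))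
    (T2 : Triangle (len (E₂ t)) (η t 4) (η t 5)) (I : Fin 6) :
    ContDiffAt ℝ ∞
      (fun s => spread (E₀ s) (E₁ s) (E₂ s) (b s) (a s) (η s) (ρ₀ s) (ρ₁ s) (ρ₂ s) I) t := by
  have z0 := ne_zero_of_len_pos T0.pos.1
  have z1 := ne_zero_of_len_pos T1.pos.1
  have z2 := ne_zero_of_len_pos T2.pos.1
  have s0 := contDiffAt_sides h0 (contDiffAt_turn h0 z0 r0 hb) (hη 0) (hη 1) T0
  have s1 := contDiffAt_sides h1 (contDiffAt_turn h1 z1 r1 hb) (hη 2) (hη 3) T1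
  have s2 := contDiffAt_sides h2 (contDiffAt_turn h2 z2 r2 ha) (hη 4) (hη 5) T2
  revert I
  exact Fin.forall_six (s0 0) (s0 1) (s1 0) (s1 1) (s2 0) (s2 1)

/-- The angle clauses allow any `u` in the given direction because the dihedral angles are measured
from cross products that are not normalized. -/
theorem spread_spec {E₀ E₁ E₂ b a : R3} {η : Fin 6 → ℝ} (ρ₀ ρ₁ ρ₂ : Real.Angle)
    (hb : b ⬝ᵥ b = 1) (ha : a ⬝ᵥ a = 1) (h0 : E₀ ⬝ᵥ b = 0) (h1 : E₁ ⬝ᵥ b = 0) (h2 : E₂ ⬝ᵥ a = 0)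
    (T0 : Triangle (len E₀) (η 0) (η 1)) (T1 : Triangle (len E₁) (η 2) (η 3))
    (T2 : Triangle (len E₂) (η 4) (η 5)) {N : Fin 6 → R3}
    (hN : N = spread E₀ E₁ E₂ b a η ρ₀ ρ₁ ρ₂) :
    (∀ I, N I ⬝ᵥ N I = 1) ∧ polygonVec η N = ![E₀, E₁, E₂, E₀ + E₁] ∧
      (∀ u, dir u = b → angleAbout E₀ u (N 0 ⨯₃ N 1) = ρ₀) ∧
      (∀ u, dir u = b → angleAbout E₁ u (N 2 ⨯₃ N 3) = ρ₁) ∧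
      (∀ u, dir u = a → angleAbout E₂ u (N 4 ⨯₃ N 5) = ρ₂) := by
  -- The three pairs are independent of each other once their sums and reference normals are known,
  -- so one statement serves for all.
  have key : ∀ {E c : R3} {p r : ℝ} (θ : Real.Angle), c ⬝ᵥ c = 1 → E ⬝ᵥ c = 0 →
      Triangle (len E) p r →
      (sides E (turn E θ c) p r 0 ⬝ᵥ sides E (turn E θ c) p r 0 = 1 ∧
      sides E (turn E θ c) p r 1 ⬝ᵥ sides E (turn E θ c) p r 1 = 1 ∧
      p • sides E (turn E θ c) p r 0 + r • sides E (turn E θ c) p r 1 = E) ∧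
      ∀ u, dir u = c →
        angleAbout E u (sides E (turn E θ c) p r 0 ⨯₃ sides E (turn E θ c) p r 1) = θ := by
    intro E c p r θ hc hE T
    have hk := ne_zero_of_len_pos T.pos.1
    obtain ⟨k1, k2, k3, -⟩ := sides_spec (dot_turn hE θ) ((turn_dot_self hk hE θ).trans hc) T
    refine ⟨⟨k1, k2, k3⟩, ?_⟩
    rintro u rfl
    have hu := ne_zero_of_dir_unit hc
    exact sides_angle hu (dot_eq_zero_of_dir hE hu) T
  obtain ⟨⟨a1, a2, a3⟩, a4⟩ := key ρ₀ hb h0 T0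
  obtain ⟨⟨b1, b2, b3⟩, b4⟩ := key ρ₁ hb h1 T1
  obtain ⟨⟨c1, c2, c3⟩, c4⟩ := key ρ₂ ha h2 T2
  subst hN
  refine ⟨Fin.forall_six a1 a2 b1 b2 c1 c2, ?_, a4, b4, c4⟩
  simp only [polygonVec, spread, Matrix.cons_val, a3, b3, c3]

theorem eq_spread {η : Fin 6 → ℝ} {N : Fin 6 → R3} (hη : ∀ I, 0 < η I)
    (hN : ∀ I, N I ⬝ᵥ N I = 1) {E : Fin 4 → R3} (hE : polygonVec η N = E)
    (T0 : Triangle (len (E 0)) (η 0) (η 1)) (T1 : Triangle (len (E 1)) (η 2) (η 3))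
    (T2 : Triangle (len (E 2)) (η 4) (η 5)) {u w : R3} (hu : u ≠ 0) (hw : w ≠ 0)
    (u0 : E 0 ⬝ᵥ u = 0) (u1 : E 1 ⬝ᵥ u = 0) (w2 : E 2 ⬝ᵥ w = 0) :
    N = spread (E 0) (E 1) (E 2) (dir u) (dir w) η (angleAbout (E 0) u (N 0 ⨯₃ N 1))
      (angleAbout (E 1) u (N 2 ⨯₃ N 3)) (angleAbout (E 2) w (N 4 ⨯₃ N 5)) := by
  subst hE
  obtain ⟨a0, a1⟩ := pair_eq_sides (hη 0) (hη 1) (hN 0) (hN 1) T0 hu u0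
  obtain ⟨b0, b1⟩ := pair_eq_sides (hη 2) (hη 3) (hN 2) (hN 3) T1 hu u1
  obtain ⟨c0, c1⟩ := pair_eq_sides (hη 4) (hη 5) (hN 4) (hN 5) T2 hw w2
  funext I
  revert I
  exact Fin.forall_six a0 a1 b0 b1 c0 c1

/-! ### Open polygons -/

/-- A polygon with six sides, closed by a seventh side of length `ηb` and direction `W`, all of whose
triangles are nondegenerate. -/
structure IsOpenPolygon (η : Fin 6 → ℝ) (N : Fin 6 → R3) (ηb : ℝ) (W : R3) : Prop where
  pos : ∀ I, 0 < η I
  unit : ∀ I, N I ⬝ᵥ N I = 1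
  T0 : Triangle (len (polygonVec η N 0)) (η 0) (η 1)
  T1 : Triangle (len (polygonVec η N 1)) (η 2) (η 3)
  T2 : Triangle (len (polygonVec η N 2)) (η 4) (η 5)
  T3 : Triangle (len (polygonVec η N 3)) (len (polygonVec η N 0)) (len (polygonVec η N 1))
  T4 : Triangle (len (polygonVec η N 3)) (len (polygonVec η N 2)) ηb
  sum : polygonVec η N 2 + polygonVec η N 3 = ηb • W
  W_unit : W ⬝ᵥ W = 1

theorem polygonVec_three (η : Fin 6 → ℝ) (N : Fin 6 → R3) :
    polygonVec η N 3 = polygonVec η N 0 + polygonVec η N 1 := rfl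

theorem sum_dot_cross (P Q : R3) : (P + Q) ⬝ᵥ (P ⨯₃ Q) = 0 := by
  simp

namespace IsOpenPolygon

variable {η : Fin 6 → ℝ} {N : Fin 6 → R3} {ηb : ℝ} {W : R3} (h : IsOpenPolygon η N ηb W)
include h

theorem ηb_pos : 0 < ηb := h.T4.pos.2.2

theorem triangle_sum : Triangle (len (polygonVec η N 2 + polygonVec η N 3))
    (len (polygonVec η N 2)) (len (polygonVec η N 3)) := by
  rw [h.sum, len_smul_unit h.ηb_pos h.W_unit]; exact h.T4.rotate

theorem cross_ne_zero : polygonVec η N 2 ⨯₃ polygonVec η N 3 ≠ 0 :=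
  cross_ne_zero_of_triangle h.triangle_sum

theorem cross_ne_zero' : polygonVec η N 0 ⨯₃ polygonVec η N 1 ≠ 0 :=
  cross_ne_zero_of_triangle h.T3

/-- As the third vertex of the triangle is fixed by the other two sides, the plane of `E₂`, `E₃` is
also that of `E₂`, `W`. Hence the plane reached by the angle about `W` is the one from which the
angles about `E₂` and `E₃` start. -/
theorem cross_eq : polygonVec η N 2 ⨯₃ polygonVec η N 3 = ηb • (polygonVec η N 2 ⨯₃ W) := by
  have : polygonVec η N 3 = ηb • W - polygonVec η N 2 := by rw [← h.sum]; abel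
  rw [this, map_sub, cross_self, sub_zero, map_smul]

theorem dir_cross : dir (polygonVec η N 2 ⨯₃ W) =
    dir (polygonVec η N 2 ⨯₃ polygonVec η N 3) := by
  rw [h.cross_eq, dir_smul h.ηb_pos]

theorem cross_W_ne_zero : polygonVec η N 2 ⨯₃ W ≠ 0 := fun h0 =>
  h.cross_ne_zero (by rw [h.cross_eq, h0, smul_zero])

theorem transverse_breve {u : R3} (hu : u ≠ 0) (hWu : W ⬝ᵥ u = 0) :
    Transverse W u (polygonVec η N 2 ⨯₃ W) :=
  ⟨ne_zero_of_unit h.W_unit, hu, h.cross_W_ne_zero, hWu, dot_cross_right _ _⟩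

theorem transverse0 : Transverse (polygonVec η N 0) (polygonVec η N 0 ⨯₃ polygonVec η N 1)
    (N 0 ⨯₃ N 1) :=
  pair_transverse (h.pos 0) (h.pos 1) (h.unit 0) (h.unit 1) h.T0 h.cross_ne_zero'
    (dot_cross_left _ _)

theorem transverse1 : Transverse (polygonVec η N 1) (polygonVec η N 0 ⨯₃ polygonVec η N 1)
    (N 2 ⨯₃ N 3) :=
  pair_transverse (h.pos 2) (h.pos 3) (h.unit 2) (h.unit 3) h.T1 h.cross_ne_zero'
    (dot_cross_right _ _)

theorem transverse2 : Transverse (polygonVec η N 2) (polygonVec η N 2 ⨯₃ polygonVec η N 3)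
    (N 4 ⨯₃ N 5) :=
  pair_transverse (h.pos 4) (h.pos 5) (h.unit 4) (h.unit 5) h.T2 h.cross_ne_zero
    (dot_cross_left _ _)

theorem transverse3 : Transverse (polygonVec η N 3) (polygonVec η N 2 ⨯₃ polygonVec η N 3)
    (polygonVec η N 0 ⨯₃ polygonVec η N 1) :=
  ⟨ne_zero_of_len_pos h.T3.pos.1, h.cross_ne_zero, h.cross_ne_zero', dot_cross_right _ _,
    sum_dot_cross _ _⟩

end IsOpenPolygon

/-- The sum of the last two sides of an open polygon, in terms of its lengths and angles and of a
reference direction `u` orthogonal to `W`. -/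
def openLeg (W u : R3) (ηb : ℝ) (ρb : Real.Angle) (ηv : Fin 4 → ℝ) : R3 :=
  hinge (ηb • W) (turn W ρb u) (ηv 2) (ηv 3)

/-- The sum of the first four sides. -/
def openBase (W u : R3) (ηb : ℝ) (ρb : Real.Angle) (ηv : Fin 4 → ℝ) : R3 :=
  ηb • W - openLeg W u ηb ρb ηv

/-- The oriented normal of the triangle formed by the first two pairs of sides. -/
def openNormal (W u : R3) (ηb : ℝ) (ρb : Real.Angle) (ηv : Fin 4 → ℝ) (ρv : Fin 4 → Real.Angle) :
    R3 :=
  turn (openBase W u ηb ρb ηv) (ρv 3) (turn W ρb u)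

/-- The sum of the first two sides. -/
def openFirst (W u : R3) (ηb : ℝ) (ρb : Real.Angle) (ηv : Fin 4 → ℝ) (ρv : Fin 4 → Real.Angle) :
    R3 :=
  hinge (openBase W u ηb ρb ηv) (openNormal W u ηb ρb ηv ρv) (ηv 0) (ηv 1)

/-- The directions of the sides of an open polygon. -/
def openPolygon (W u : R3) (ηb : ℝ) (ρb : Real.Angle) (ηv : Fin 4 → ℝ) (ρv : Fin 4 → Real.Angle)
    (η : Fin 6 → ℝ) : Fin 6 → R3 :=
  spread (openFirst W u ηb ρb ηv ρv)
    (openBase W u ηb ρb ηv - openFirst W u ηb ρb ηv ρv) (openLeg W u ηb ρb ηv)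
    (openNormal W u ηb ρb ηv ρv) (turn W ρb u) η (ρv 0) (ρv 1) (ρv 2)

/-- The chain of reconstruction: the angle about `W` gives the plane of the outer triangle and its
lengths give `E₂` and `E₃`; the angle about `E₃` gives the plane of the next triangle and its
lengths give `E₀` and `E₁`; the remaining three angles open the pairs. -/
theorem IsOpenPolygon.eq_openPolygon {η : Fin 6 → ℝ} {N : Fin 6 → R3} {ηb : ℝ} {W : R3}
    (h : IsOpenPolygon η N ηb W) {u : R3} (hu : u ⬝ᵥ u = 1) (hWu : W ⬝ᵥ u = 0) :
    N = openPolygon W u ηb (angleAbout W u (polygonVec η N 2 ⨯₃ W))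
      (fun I => len (polygonVec η N I)) (polygonRho η N) η := by
  have ht := (h.transverse_breve (ne_zero_of_unit hu) hWu).dir_eq_turn
  rw [dir_of_unit hu, h.dir_cross] at ht
  have e2 : openLeg W u ηb (angleAbout W u (polygonVec η N 2 ⨯₃ W))
      (fun I => len (polygonVec η N I)) = polygonVec η N 2 := by
    rw [openLeg, ← ht, ← h.sum]; exact (eq_hinge h.triangle_sum).symm
  have e3 : openBase W u ηb (angleAbout W u (polygonVec η N 2 ⨯₃ W))
      (fun I => len (polygonVec η N I)) = polygonVec η N 3 := by
    rw [openBase, e2, ← h.sum]; abel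
  have eb : openNormal W u ηb (angleAbout W u (polygonVec η N 2 ⨯₃ W))
      (fun I => len (polygonVec η N I)) (polygonRho η N) =
        dir (polygonVec η N 0 ⨯₃ polygonVec η N 1) := by
    rw [openNormal, e3, ← ht]; exact h.transverse3.dir_eq_turn.symm
  have e0 : openFirst W u ηb (angleAbout W u (polygonVec η N 2 ⨯₃ W))
      (fun I => len (polygonVec η N I)) (polygonRho η N) = polygonVec η N 0 := by
    rw [openFirst, e3, eb]; exact (eq_hinge h.T3).symm
  rw [openPolygon, e0, e2, e3, eb, ← ht, polygonVec_three, add_sub_cancel_left]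
  exact eq_spread h.pos h.unit rfl h.T0 h.T1 h.T2 h.cross_ne_zero' h.cross_ne_zero
    (dot_cross_left _ _) (dot_cross_right _ _) (dot_cross_left _ _)

/-- The same chain read as a construction. At every stage the triangle just built has the prescribed
lengths, so the next triangle inequality applies to its actual base. -/
theorem openPolygon_spec {W u : R3} {ηb : ℝ} {ηv : Fin 4 → ℝ} {η : Fin 6 → ℝ} (ρb : Real.Angle)
    (ρv : Fin 4 → Real.Angle) (hW : W ⬝ᵥ W = 1) (hu : u ⬝ᵥ u = 1) (hWu : W ⬝ᵥ u = 0)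
    (hη : ∀ I, 0 < η I)
    (T0 : Triangle (ηv 0) (η 0) (η 1)) (T1 : Triangle (ηv 1) (η 2) (η 3))
    (T2 : Triangle (ηv 2) (η 4) (η 5)) (T3 : Triangle (ηv 3) (ηv 0) (ηv 1))
    (T4 : Triangle (ηv 3) (ηv 2) ηb) {N : Fin 6 → R3} (hN : N = openPolygon W u ηb ρb ηv ρv η) :
    IsOpenPolygon η N ηb W ∧ (∀ I, len (polygonVec η N I) = ηv I) ∧ polygonRho η N = ρv ∧
      angleAbout W u (polygonVec η N 2 ⨯₃ W) = ρb := by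
  have hW0 := ne_zero_of_unit hW
  set a := turn W ρb u with ha
  have haa : a ⬝ᵥ a = 1 := (turn_dot_self hW0 hWu ρb).trans hu
  have hWa : W ⬝ᵥ a = 0 := dot_turn hWu ρb
  have hlen : len (ηb • W) = ηb := len_smul_unit T4.pos.2.2 hW
  obtain ⟨l2, l3, n23⟩ := hinge_spec (k := ηb • W) (a := a) (p := ηv 2) (r := ηv 3)
    (by rw [smul_dotProduct, hWa, smul_zero]) haa (by rw [hlen]; exact T4.rotate)
  set E₂ := openLeg W u ηb ρb ηv with hE2
  set E₃ := openBase W u ηb ρb ηv with hE3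
  change len E₂ = ηv 2 at l2
  change len E₃ = ηv 3 at l3
  change dir (E₂ ⨯₃ E₃) = a at n23
  have z23 : E₂ ⨯₃ E₃ ≠ 0 := ne_zero_of_dir_unit (by rw [n23, haa])
  have h2a : E₂ ⬝ᵥ a = 0 := by rw [← n23]; exact dot_dir_eq_zero (dot_cross_left _ _)
  have h3a : E₃ ⬝ᵥ a = 0 := by rw [← n23]; exact dot_dir_eq_zero (dot_cross_right _ _)
  have hE30 : E₃ ≠ 0 := ne_zero_of_len_pos (by rw [l3]; exact T4.pos.1)
  set b := openNormal W u ηb ρb ηv ρv with hb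
  have hbt : b = turn E₃ (ρv 3) a := rfl
  have hbb : b ⬝ᵥ b = 1 := by rw [hbt, turn_dot_self hE30 h3a, haa]
  have h3b : E₃ ⬝ᵥ b = 0 := by rw [hbt]; exact dot_turn h3a _
  obtain ⟨l0, l1, n01⟩ := hinge_spec (k := E₃) (a := b) (p := ηv 0) (r := ηv 1) h3b hbb
    (by rw [l3]; exact T3)
  set E₀ := openFirst W u ηb ρb ηv ρv with hE0
  change len E₀ = ηv 0 at l0
  change len (E₃ - E₀) = ηv 1 at l1
  change dir (E₀ ⨯₃ (E₃ - E₀)) = b at n01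
  have h0b : E₀ ⬝ᵥ b = 0 := by rw [← n01]; exact dot_dir_eq_zero (dot_cross_left _ _)
  have h1b : (E₃ - E₀) ⬝ᵥ b = 0 := by rw [← n01]; exact dot_dir_eq_zero (dot_cross_right _ _)
  have z01 : E₀ ⨯₃ (E₃ - E₀) ≠ 0 := ne_zero_of_dir_unit (by rw [n01, hbb])
  obtain ⟨hunit, hvec, r0, r1, r2⟩ := spread_spec (ρv 0) (ρv 1) (ρv 2) hbb haa h0b h1b h2a
    (by rwa [l0]) (by rwa [l1]) (by rwa [l2]) hN
  rw [add_sub_cancel] at hvec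
  have v0 : polygonVec η N 0 = E₀ := by rw [hvec]; rfl
  have v1 : polygonVec η N 1 = E₃ - E₀ := by rw [hvec]; rfl
  have v2 : polygonVec η N 2 = E₂ := by rw [hvec]; rfl
  have v3 : polygonVec η N 3 = E₃ := by rw [hvec]; rfl
  have hpoly : IsOpenPolygon η N ηb W := by
    refine ⟨hη, hunit, ?_, ?_, ?_, ?_, ?_, ?_, hW⟩
    · rwa [v0, l0]
    · rwa [v1, l1]
    · rwa [v2, l2]
    · rwa [v3, v0, v1, l3, l0, l1]
    · rwa [v3, v2, l3, l2]
    · rw [v2, v3, hE3, openBase, ← hE2]; abel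
  refine ⟨hpoly, ?_, ?_, ?_⟩
  · intro I
    fin_cases I
    · exact (congrArg len v0).trans l0
    · exact (congrArg len v1).trans l1
    · exact (congrArg len v2).trans l2
    · exact (congrArg len v3).trans l3
  · funext I
    simp only [polygonRho, v0, v1, v2, v3]
    fin_cases I
    · exact r0 _ n01
    · exact r1 _ n01
    · exact r2 _ n23
    · have := hpoly.transverse3
      rw [v0, v1, v2, v3] at this
      exact this.angle_eq (by rw [n01, n23]; exact hbt)
  · apply (hpoly.transverse_breve (ne_zero_of_unit hu) hWu).angle_eq
    rw [hpoly.dir_cross, v2, v3, n23, dir_of_unit hu]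

theorem contDiffAt_openPolygon {t : ℝ} {W u : ℝ → R3} {ηb : ℝ → ℝ} {ρb : ℝ → Real.Angle}
    {ηv : ℝ → Fin 4 → ℝ} {ρv : ℝ → Fin 4 → Real.Angle} {η : ℝ → Fin 6 → ℝ}
    (hW : ContDiffAt ℝ ∞ W t) (hu : ContDiffAt ℝ ∞ u t) (hηb : ContDiffAt ℝ ∞ ηb t)
    (hρb : SmoothAngleAt ρb t) (hηv : ∀ I, ContDiffAt ℝ ∞ (fun s => ηv s I) t)
    (hρv : ∀ I, SmoothAngleAt (fun s => ρv s I) t) (hη : ∀ I, ContDiffAt ℝ ∞ (fun s => η s I) t)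
    (W1 : W t ⬝ᵥ W t = 1) (u1 : u t ⬝ᵥ u t = 1) (Wu : W t ⬝ᵥ u t = 0)
    (T0 : Triangle (ηv t 0) (η t 0) (η t 1)) (T1 : Triangle (ηv t 1) (η t 2) (η t 3))
    (T2 : Triangle (ηv t 2) (η t 4) (η t 5)) (T3 : Triangle (ηv t 3) (ηv t 0) (ηv t 1))
    (T4 : Triangle (ηv t 3) (ηv t 2) (ηb t)) (I : Fin 6) :
    ContDiffAt ℝ ∞
      (fun s => openPolygon (W s) (u s) (ηb s) (ρb s) (ηv s) (ρv s) (η s) I) t := by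
  have hW0 := ne_zero_of_unit W1
  have haa : turn (W t) (ρb t) (u t) ⬝ᵥ turn (W t) (ρb t) (u t) = 1 :=
    (turn_dot_self hW0 Wu _).trans u1
  have hlen : len (ηb t • W t) = ηb t := len_smul_unit T4.pos.2.2 W1
  -- Only values at `t` are needed here: the formulas of the construction are defined for all `s`,
  -- and smoothness at `t` depends on nondegeneracy at `t` alone.
  have hT : Triangle (len (ηb t • W t)) (ηv t 2) (ηv t 3) := by rw [hlen]; exact T4.rotate
  obtain ⟨l2, l3, n23⟩ := hinge_spec (by rw [smul_dotProduct, dot_turn Wu, smul_zero]) haa hT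
  change len (openBase (W t) (u t) (ηb t) (ρb t) (ηv t)) = ηv t 3 at l3
  change len (openLeg (W t) (u t) (ηb t) (ρb t) (ηv t)) = ηv t 2 at l2
  change dir (openLeg (W t) (u t) (ηb t) (ρb t) (ηv t) ⨯₃
    openBase (W t) (u t) (ηb t) (ρb t) (ηv t)) = _ at n23
  have h3a : openBase (W t) (u t) (ηb t) (ρb t) (ηv t) ⬝ᵥ turn (W t) (ρb t) (u t) = 0 := by
    rw [← n23]; exact dot_dir_eq_zero (dot_cross_right _ _)
  have hE30 : openBase (W t) (u t) (ηb t) (ρb t) (ηv t) ≠ 0 :=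
    ne_zero_of_len_pos (by rw [l3]; exact T4.pos.1)
  have hT3 : Triangle (len (openBase (W t) (u t) (ηb t) (ρb t) (ηv t))) (ηv t 0) (ηv t 1) := by
    rw [l3]; exact T3
  obtain ⟨l0, l1, n01⟩ := hinge_spec (dot_turn h3a (ρv t 3))
    ((turn_dot_self hE30 h3a (ρv t 3)).trans haa) hT3
  have sa : ContDiffAt ℝ ∞ (fun s => turn (W s) (ρb s) (u s)) t := contDiffAt_turn hW hW0 hρb hu
  have s2 : ContDiffAt ℝ ∞ (fun s => openLeg (W s) (u s) (ηb s) (ρb s) (ηv s)) t :=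
    contDiffAt_hinge (hηb.smul hW) sa (hηv 2) (hηv 3) hT
  have s3 : ContDiffAt ℝ ∞ (fun s => openBase (W s) (u s) (ηb s) (ρb s) (ηv s)) t :=
    (hηb.smul hW).sub s2
  have sb : ContDiffAt ℝ ∞ (fun s => openNormal (W s) (u s) (ηb s) (ρb s) (ηv s) (ρv s)) t :=
    contDiffAt_turn s3 hE30 (hρv 3) sa
  have s0 : ContDiffAt ℝ ∞ (fun s => openFirst (W s) (u s) (ηb s) (ρb s) (ηv s) (ρv s)) t :=
    contDiffAt_hinge s3 sb (hηv 0) (hηv 1) hT3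
  refine contDiffAt_spread s0 (s3.sub s0) s2 sb sa hη (hρv 0) (hρv 1) (hρv 2) ?_ ?_ ?_ I
  · change Triangle (len (hinge _ _ _ _)) _ _
    rw [openNormal, l0]; exact T0
  · change Triangle (len (_ - hinge _ _ _ _)) _ _
    rw [openNormal, l1]; exact T1
  · rw [l2]; exact T2

/-! ### Closed polygons -/

/-- A closed polygon with six sides, all of whose triangles are nondegenerate. -/
structure IsClosedPolygon (η : Fin 6 → ℝ) (N : Fin 6 → R3) : Prop where
  pos : ∀ I, 0 < η I
  unit : ∀ I, N I ⬝ᵥ N I = 1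
  T0 : Triangle (len (polygonVec η N 0)) (η 0) (η 1)
  T1 : Triangle (len (polygonVec η N 1)) (η 2) (η 3)
  T2 : Triangle (len (polygonVec η N 2)) (η 4) (η 5)
  T3 : Triangle (len (polygonVec η N 2)) (len (polygonVec η N 0)) (len (polygonVec η N 1))
  sum : polygonVec η N 0 + polygonVec η N 1 + polygonVec η N 2 = 0

/-- The dihedral angles of a closed polygon, as in `reducedVariables`. -/
def closedRho (η : Fin 6 → ℝ) (N : Fin 6 → R3) : Fin 3 → Real.Angle :=
  let E : Fin 4 → R3 := polygonVec η N
  ![angleAbout (E 0) (E 0 ⨯₃ E 1) (N 0 ⨯₃ N 1),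
    angleAbout (E 1) (E 0 ⨯₃ E 1) (N 2 ⨯₃ N 3),
    angleAbout (E 2) (E 0 ⨯₃ E 1) (N 4 ⨯₃ N 5)]

/-- The three diagonal lengths of a closed polygon. -/
def closedLen (η : Fin 6 → ℝ) (N : Fin 6 → R3) : Fin 3 → ℝ :=
  ![len (polygonVec η N 0), len (polygonVec η N 1), len (polygonVec η N 2)]

namespace IsClosedPolygon

variable {η : Fin 6 → ℝ} {N : Fin 6 → R3} (h : IsClosedPolygon η N)
include h

theorem sum_eq : polygonVec η N 0 + polygonVec η N 1 = -polygonVec η N 2 :=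
  eq_neg_of_add_eq_zero_left h.sum

theorem triangle_sum : Triangle (len (polygonVec η N 0 + polygonVec η N 1))
    (len (polygonVec η N 0)) (len (polygonVec η N 1)) := by
  rw [h.sum_eq, len_neg]; exact h.T3

theorem cross_ne_zero : polygonVec η N 0 ⨯₃ polygonVec η N 1 ≠ 0 :=
  cross_ne_zero_of_triangle h.triangle_sum

theorem dot_cross : polygonVec η N 2 ⬝ᵥ (polygonVec η N 0 ⨯₃ polygonVec η N 1) = 0 := by
  have := sum_dot_cross (polygonVec η N 0) (polygonVec η N 1)
  rwa [h.sum_eq, neg_dotProduct, neg_eq_zero] at this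

theorem transverse0 : Transverse (polygonVec η N 0) (polygonVec η N 0 ⨯₃ polygonVec η N 1)
    (N 0 ⨯₃ N 1) :=
  pair_transverse (h.pos 0) (h.pos 1) (h.unit 0) (h.unit 1) h.T0 h.cross_ne_zero
    (dot_cross_left _ _)

theorem transverse1 : Transverse (polygonVec η N 1) (polygonVec η N 0 ⨯₃ polygonVec η N 1)
    (N 2 ⨯₃ N 3) :=
  pair_transverse (h.pos 2) (h.pos 3) (h.unit 2) (h.unit 3) h.T1 h.cross_ne_zero
    (dot_cross_right _ _)

theorem transverse2 : Transverse (polygonVec η N 2) (polygonVec η N 0 ⨯₃ polygonVec η N 1)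
    (N 4 ⨯₃ N 5) :=
  pair_transverse (h.pos 4) (h.pos 5) (h.unit 4) (h.unit 5) h.T2 h.cross_ne_zero h.dot_cross

end IsClosedPolygon

/-- The sum of the first two sides of a closed polygon, in terms of its diagonal lengths, the
direction `k` of the third diagonal, and the normal `a` of the triangle of the diagonals. -/
def closedFirst (k a : R3) (ηv : Fin 3 → ℝ) : R3 := hinge (-(ηv 2 • k)) a (ηv 0) (ηv 1)

/-- The directions of the sides of a closed polygon. -/
def closedPolygon (k a : R3) (ηv : Fin 3 → ℝ) (ρv : Fin 3 → Real.Angle) (η : Fin 6 → ℝ) :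
    Fin 6 → R3 :=
  spread (closedFirst k a ηv) (-(ηv 2 • k) - closedFirst k a ηv) (ηv 2 • k) a a η
    (ρv 0) (ρv 1) (ρv 2)

theorem rot_sub (g : SU2) (u w : R3) : rot g (u - w) = rot g u - rot g w := by
  rw [sub_eq_add_neg, rot_add, rot_neg, ← sub_eq_add_neg]

theorem rot_closedPolygon (g : SU2) (k a : R3) (ηv : Fin 3 → ℝ) (ρv : Fin 3 → Real.Angle)
    (η : Fin 6 → ℝ) (I : Fin 6) :
    rot g (closedPolygon k a ηv ρv η I) = closedPolygon (rot g k) (rot g a) ηv ρv η I := by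
  simp only [closedPolygon, closedFirst, rot_spread, rot_sub, rot_hinge, rot_neg, rot_smul]

/-- Closure gives `E₀ + E₁ = -E₂`, so the three diagonals lie in one plane. The direction of `E₂`
and the normal of this plane are the only data besides lengths and angles, and they form the frame
on which the gauge group acts. -/
theorem IsClosedPolygon.eq_closedPolygon {η : Fin 6 → ℝ} {N : Fin 6 → R3}
    (h : IsClosedPolygon η N) :
    N = closedPolygon (dir (polygonVec η N 2)) (dir (polygonVec η N 0 ⨯₃ polygonVec η N 1))
      (closedLen η N) (closedRho η N) η := by
  have e2 : closedLen η N 2 • dir (polygonVec η N 2) = polygonVec η N 2 :=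
    len_smul_dir (ne_zero_of_len_pos h.T2.pos.1)
  have e0 : closedFirst (dir (polygonVec η N 2)) (dir (polygonVec η N 0 ⨯₃ polygonVec η N 1))
      (closedLen η N) = polygonVec η N 0 := by
    rw [closedFirst, e2, ← h.sum_eq]; exact (eq_hinge h.triangle_sum).symm
  rw [closedPolygon, e0, e2, ← h.sum_eq, add_sub_cancel_left]
  exact eq_spread h.pos h.unit rfl h.T0 h.T1 h.T2 h.cross_ne_zero h.cross_ne_zero
    (dot_cross_left _ _) (dot_cross_right _ _) h.dot_cross

theorem closedPolygon_spec {k a : R3} {ηv : Fin 3 → ℝ} {η : Fin 6 → ℝ} (ρv : Fin 3 → Real.Angle)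
    (hk : k ⬝ᵥ k = 1) (ha : a ⬝ᵥ a = 1) (hka : k ⬝ᵥ a = 0) (hη : ∀ I, 0 < η I)
    (T0 : Triangle (ηv 0) (η 0) (η 1)) (T1 : Triangle (ηv 1) (η 2) (η 3))
    (T2 : Triangle (ηv 2) (η 4) (η 5)) (T3 : Triangle (ηv 2) (ηv 0) (ηv 1))
    {N : Fin 6 → R3} (hN : N = closedPolygon k a ηv ρv η) :
    IsClosedPolygon η N ∧ closedLen η N = ηv ∧ closedRho η N = ρv := by
  have l2 : len (ηv 2 • k) = ηv 2 := len_smul_unit T2.pos.1 hk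
  have h2a : (ηv 2 • k) ⬝ᵥ a = 0 := by rw [smul_dotProduct, hka, smul_zero]
  obtain ⟨l0, l1, n01⟩ := hinge_spec (k := -(ηv 2 • k)) (a := a) (p := ηv 0) (r := ηv 1)
    (by rw [neg_dotProduct, h2a, neg_zero]) ha (by rw [len_neg, l2]; exact T3)
  set E₀ := closedFirst k a ηv with hE0
  change len E₀ = ηv 0 at l0
  change len (-(ηv 2 • k) - E₀) = ηv 1 at l1
  change dir (E₀ ⨯₃ (-(ηv 2 • k) - E₀)) = a at n01
  have h0a : E₀ ⬝ᵥ a = 0 := by rw [← n01]; exact dot_dir_eq_zero (dot_cross_left _ _)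
  have h1a : (-(ηv 2 • k) - E₀) ⬝ᵥ a = 0 := by
    rw [← n01]; exact dot_dir_eq_zero (dot_cross_right _ _)
  obtain ⟨hunit, hvec, r0, r1, r2⟩ := spread_spec (ρv 0) (ρv 1) (ρv 2) ha ha h0a h1a h2a
    (by rwa [l0]) (by rwa [l1]) (by rwa [l2]) hN
  have v0 : polygonVec η N 0 = E₀ := by rw [hvec]; rfl
  have v1 : polygonVec η N 1 = -(ηv 2 • k) - E₀ := by rw [hvec]; rfl
  have v2 : polygonVec η N 2 = ηv 2 • k := by rw [hvec]; rfl
  refine ⟨⟨hη, hunit, ?_, ?_, ?_, ?_, ?_⟩, ?_, ?_⟩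
  · rwa [v0, l0]
  · rwa [v1, l1]
  · rwa [v2, l2]
  · rwa [v2, v0, v1, l2, l0, l1]
  · rw [v0, v1, v2]; abel
  · rw [closedLen, v0, v1, v2, l0, l1, l2]
    ext I; fin_cases I <;> rfl
  · rw [closedRho, v0, v1, v2]
    funext I
    fin_cases I
    · exact r0 _ n01
    · exact r1 _ n01
    · exact r2 _ n01

theorem closedPolygon_frame {k a : R3} {ηv : Fin 3 → ℝ} {η : Fin 6 → ℝ}
    (hk : k ⬝ᵥ k = 1) (ha : a ⬝ᵥ a = 1) (hka : k ⬝ᵥ a = 0)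
    (T0 : Triangle (ηv 0) (η 0) (η 1)) (T1 : Triangle (ηv 1) (η 2) (η 3))
    (T2 : Triangle (ηv 2) (η 4) (η 5)) (T3 : Triangle (ηv 2) (ηv 0) (ηv 1)) :
    Triangle (len (closedFirst k a ηv)) (η 0) (η 1) ∧
      Triangle (len (-(ηv 2 • k) - closedFirst k a ηv)) (η 2) (η 3) ∧
      Triangle (len (ηv 2 • k)) (η 4) (η 5) := by
  have l2 : len (ηv 2 • k) = ηv 2 := len_smul_unit T2.pos.1 hk
  obtain ⟨l0, l1, -⟩ := hinge_spec (k := -(ηv 2 • k)) (a := a) (p := ηv 0) (r := ηv 1)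
    (by rw [neg_dotProduct, smul_dotProduct, hka, smul_zero, neg_zero]) ha
    (by rw [len_neg, l2]; exact T3)
  rw [closedFirst, l0, l1, l2]
  exact ⟨T0, T1, T2⟩

/-- The frame `k`, `a` is constant along the curve: this is the gauge in which reduced curves are
lifted. -/
theorem contDiffAt_closedPolygon {t : ℝ} {k a : R3} {ηv : ℝ → Fin 3 → ℝ}
    {ρv : ℝ → Fin 3 → Real.Angle} {η : ℝ → Fin 6 → ℝ}
    (hηv : ∀ I, ContDiffAt ℝ ∞ (fun s => ηv s I) t)
    (hρv : ∀ I, SmoothAngleAt (fun s => ρv s I) t) (hη : ∀ I, ContDiffAt ℝ ∞ (fun s => η s I) t)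
    (hk : k ⬝ᵥ k = 1) (ha : a ⬝ᵥ a = 1) (hka : k ⬝ᵥ a = 0)
    (T0 : Triangle (ηv t 0) (η t 0) (η t 1)) (T1 : Triangle (ηv t 1) (η t 2) (η t 3))
    (T2 : Triangle (ηv t 2) (η t 4) (η t 5)) (T3 : Triangle (ηv t 2) (ηv t 0) (ηv t 1))
    (I : Fin 6) : ContDiffAt ℝ ∞ (fun s => closedPolygon k a (ηv s) (ρv s) (η s) I) t := by
  obtain ⟨t0, t1, t2⟩ := closedPolygon_frame hk ha hka T0 T1 T2 T3
  have sk : ContDiffAt ℝ ∞ (fun s => ηv s 2 • k) t := (hηv 2).smul contDiffAt_const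
  have s0 : ContDiffAt ℝ ∞ (fun s => closedFirst k a (ηv s)) t :=
    contDiffAt_hinge sk.neg contDiffAt_const (hηv 0) (hηv 1)
      (by rw [len_neg, len_smul_unit T2.pos.1 hk]; exact T3)
  exact contDiffAt_spread s0 (sk.neg.sub s0) sk contDiffAt_const contDiffAt_const hη (hρv 0)
    (hρv 1) (hρv 2) t0 t1 t2 I

/-! ### Moving polygons -/

section Polygons

variable {t : ℝ} {η : ℝ → Fin 6 → ℝ} {N : ℝ → Fin 6 → R3}

theorem contDiffAt_polygonVec (hη : ∀ I, ContDiffAt ℝ ∞ (fun s => η s I) t)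
    (hN : ∀ I, ContDiffAt ℝ ∞ (fun s => N s I) t) (I : Fin 4) :
    ContDiffAt ℝ ∞ (fun s => polygonVec (η s) (N s) I) t := by
  have h (I : Fin 6) : ContDiffAt ℝ ∞ (fun s => η s I • N s I) t := (hη I).smul (hN I)
  fin_cases I
  · exact (h 0).add (h 1)
  · exact (h 2).add (h 3)
  · exact (h 4).add (h 5)
  · exact ((h 0).add (h 1)).add ((h 2).add (h 3))

theorem ContDiffAt.differentiableAt_infty {E : Type*} [NormedAddCommGroup E] [NormedSpace ℝ E]
    {f : ℝ → E} (hf : ContDiffAt ℝ ∞ f t) : DifferentiableAt ℝ f t :=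
  hf.differentiableAt (by simp)

variable {ηb : ℝ → ℝ} {W u : ℝ → R3}

theorem smoothAngleAt_polygonRho (hη : ∀ I, ContDiffAt ℝ ∞ (fun s => η s I) t)
    (hN : ∀ I, ContDiffAt ℝ ∞ (fun s => N s I) t)
    (h : ∀ᶠ s in 𝓝 t, IsOpenPolygon (η s) (N s) (ηb s) (W s)) (I : Fin 4) :
    SmoothAngleAt (fun s => polygonRho (η s) (N s) I) t := by
  have hE := contDiffAt_polygonVec hη hN
  fin_cases I
  · exact smoothAngleAt_angleAbout (hE 0) (contDiffAt_cross (hE 0) (hE 1))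
      (contDiffAt_cross (hN 0) (hN 1)) (h.mono fun _ hs => hs.transverse0)
  · exact smoothAngleAt_angleAbout (hE 1) (contDiffAt_cross (hE 0) (hE 1))
      (contDiffAt_cross (hN 2) (hN 3)) (h.mono fun _ hs => hs.transverse1)
  · exact smoothAngleAt_angleAbout (hE 2) (contDiffAt_cross (hE 2) (hE 3))
      (contDiffAt_cross (hN 4) (hN 5)) (h.mono fun _ hs => hs.transverse2)
  · exact smoothAngleAt_angleAbout (hE 3) (contDiffAt_cross (hE 2) (hE 3))
      (contDiffAt_cross (hE 0) (hE 1)) (h.mono fun _ hs => hs.transverse3)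

theorem smoothAngleAt_breve (hη : ∀ I, ContDiffAt ℝ ∞ (fun s => η s I) t)
    (hN : ∀ I, ContDiffAt ℝ ∞ (fun s => N s I) t) (hW : ContDiffAt ℝ ∞ W t)
    (hu : ContDiffAt ℝ ∞ u t) (h : ∀ᶠ s in 𝓝 t, IsOpenPolygon (η s) (N s) (ηb s) (W s))
    (h1 : ∀ᶠ s in 𝓝 t, u s ≠ 0 ∧ W s ⬝ᵥ u s = 0) :
    SmoothAngleAt (fun s => angleAbout (W s) (u s) (polygonVec (η s) (N s) 2 ⨯₃ W s)) t :=
  smoothAngleAt_angleAbout hW hu (contDiffAt_cross (contDiffAt_polygonVec hη hN 2) hW)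
    (by filter_upwards [h, h1] with s hs h1s using hs.transverse_breve h1s.1 h1s.2)

/-- The turning rates of the planes of the pairs of sides of an open polygon. -/
theorem open_spin_sum (hη : ∀ I, ContDiffAt ℝ ∞ (fun s => η s I) t)
    (hN : ∀ I, ContDiffAt ℝ ∞ (fun s => N s I) t) (hηb : ContDiffAt ℝ ∞ ηb t)
    (hW : ContDiffAt ℝ ∞ W t)
    (hu : ContDiffAt ℝ ∞ u t) (h : ∀ᶠ s in 𝓝 t, IsOpenPolygon (η s) (N s) (ηb s) (W s))
    (h1 : ∀ᶠ s in 𝓝 t, u s ≠ 0 ∧ W s ⬝ᵥ u s = 0) :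
    spin (polygonVec (η t) (N t) 0) (fun s => N s 0 ⨯₃ N s 1) t +
      spin (polygonVec (η t) (N t) 1) (fun s => N s 2 ⨯₃ N s 3) t +
      spin (polygonVec (η t) (N t) 2) (fun s => N s 4 ⨯₃ N s 5) t =
    ηb t * spin (W t) u t +
      ∑ I, len (polygonVec (η t) (N t) I) * angleDeriv (fun s => polygonRho (η s) (N s) I) t +
      ηb t * angleDeriv
        (fun s => angleAbout (W s) (u s) (polygonVec (η s) (N s) 2 ⨯₃ W s)) t := by
  have hE := contDiffAt_polygonVec hη hN
  have dE := fun I => ContDiffAt.differentiableAt_infty (hE I)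
  have dc : ∀ {a b : ℝ → R3}, ContDiffAt ℝ ∞ a t → ContDiffAt ℝ ∞ b t →
      DifferentiableAt ℝ (fun s => a s ⨯₃ b s) t := fun ha hb =>
    ContDiffAt.differentiableAt_infty (contDiffAt_cross ha hb)
  have h0 := h.self_of_nhds
  -- Each angle contributes the rate of the plane where it ends minus the rate of the plane where it
  -- starts.
  have a0 : len (polygonVec (η t) (N t) 0) * angleDeriv (fun s => polygonRho (η s) (N s) 0) t = _ :=
    angleDeriv_angleAbout (dE 0) (dc (hE 0) (hE 1)) (dc (hN 0) (hN 1))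
      (h.mono fun _ hs => hs.transverse0)
  have a1 : len (polygonVec (η t) (N t) 1) * angleDeriv (fun s => polygonRho (η s) (N s) 1) t = _ :=
    angleDeriv_angleAbout (dE 1) (dc (hE 0) (hE 1)) (dc (hN 2) (hN 3))
      (h.mono fun _ hs => hs.transverse1)
  have a2 : len (polygonVec (η t) (N t) 2) * angleDeriv (fun s => polygonRho (η s) (N s) 2) t = _ :=
    angleDeriv_angleAbout (dE 2) (dc (hE 2) (hE 3)) (dc (hN 4) (hN 5))
      (h.mono fun _ hs => hs.transverse2)
  have a3 : len (polygonVec (η t) (N t) 3) * angleDeriv (fun s => polygonRho (η s) (N s) 3) t = _ :=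
    angleDeriv_angleAbout (dE 3) (dc (hE 2) (hE 3)) (dc (hE 0) (hE 1))
      (h.mono fun _ hs => hs.transverse3)
  have ab := angleDeriv_angleAbout (ContDiffAt.differentiableAt_infty hW)
    (ContDiffAt.differentiableAt_infty hu) (dc (hE 2) hW)
    (by filter_upwards [h, h1] with s hs h1s using hs.transverse_breve h1s.1 h1s.2)
  rw [len_eq_one h0.W_unit, one_mul] at ab
  -- The two normals differ by the positive factor `ηb`, which the turning rate does not see.
  have hsm : spin (W t) (fun s => polygonVec (η s) (N s) 2 ⨯₃ polygonVec (η s) (N s) 3) t =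
      spin (W t) (fun s => polygonVec (η s) (N s) 2 ⨯₃ W s) t := by
    rw [spin_congr (h.mono fun s hs => hs.cross_eq)]
    exact spin_smul (ContDiffAt.differentiableAt_infty hηb) (dc (hE 2) hW) h0.ηb_pos.ne'
  -- Telescoping: rates of the normal `E₂ × E₃` about `E₂` and `E₃` add up to its rate about `ηb W`.
  -- Likewise, in `hs3`, those of `E₀ × E₁` about `E₀` and `E₁` add up to its rate about `E₃`.
  have hsum := congrArg (fun k => spin k
    (fun s => polygonVec (η s) (N s) 2 ⨯₃ polygonVec (η s) (N s) 3) t) h0.sum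
  simp only [spin_add, spin_smul_axis] at hsum
  have hs3 := congrArg (fun k => spin k
    (fun s => polygonVec (η s) (N s) 0 ⨯₃ polygonVec (η s) (N s) 1) t)
    (polygonVec_three (η t) (N t))
  simp only [spin_add] at hs3
  rw [Fin.sum_univ_four, a0, a1, a2, a3, ab]
  linear_combination hsum - hs3 + ηb t * hsm

theorem smoothAngleAt_closedRho (hη : ∀ I, ContDiffAt ℝ ∞ (fun s => η s I) t)
    (hN : ∀ I, ContDiffAt ℝ ∞ (fun s => N s I) t)
    (h : ∀ᶠ s in 𝓝 t, IsClosedPolygon (η s) (N s)) (I : Fin 3) :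
    SmoothAngleAt (fun s => closedRho (η s) (N s) I) t := by
  have hE := contDiffAt_polygonVec hη hN
  have hc := contDiffAt_cross (hE 0) (hE 1)
  fin_cases I
  · exact smoothAngleAt_angleAbout (hE 0) hc (contDiffAt_cross (hN 0) (hN 1))
      (h.mono fun _ hs => hs.transverse0)
  · exact smoothAngleAt_angleAbout (hE 1) hc (contDiffAt_cross (hN 2) (hN 3))
      (h.mono fun _ hs => hs.transverse1)
  · exact smoothAngleAt_angleAbout (hE 2) hc (contDiffAt_cross (hN 4) (hN 5))
      (h.mono fun _ hs => hs.transverse2)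

theorem contDiffAt_closedLen (hη : ∀ I, ContDiffAt ℝ ∞ (fun s => η s I) t)
    (hN : ∀ I, ContDiffAt ℝ ∞ (fun s => N s I) t) (h : IsClosedPolygon (η t) (N t)) (I : Fin 3) :
    ContDiffAt ℝ ∞ (fun s => closedLen (η s) (N s) I) t := by
  have hE := contDiffAt_polygonVec hη hN
  fin_cases I
  · exact contDiffAt_len (hE 0) (ne_zero_of_len_pos h.T0.pos.1)
  · exact contDiffAt_len (hE 1) (ne_zero_of_len_pos h.T1.pos.1)
  · exact contDiffAt_len (hE 2) (ne_zero_of_len_pos h.T2.pos.1)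

theorem contDiffAt_len_polygonVec (hη : ∀ I, ContDiffAt ℝ ∞ (fun s => η s I) t)
    (hN : ∀ I, ContDiffAt ℝ ∞ (fun s => N s I) t) {b : ℝ} {w : R3}
    (h : IsOpenPolygon (η t) (N t) b w) (I : Fin 4) :
    ContDiffAt ℝ ∞ (fun s => len (polygonVec (η s) (N s) I)) t := by
  have hE := contDiffAt_polygonVec hη hN
  fin_cases I
  · exact contDiffAt_len (hE 0) (ne_zero_of_len_pos h.T0.pos.1)
  · exact contDiffAt_len (hE 1) (ne_zero_of_len_pos h.T1.pos.1)
  · exact contDiffAt_len (hE 2) (ne_zero_of_len_pos h.T2.pos.1)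
  · exact contDiffAt_len (hE 3) (ne_zero_of_len_pos h.T3.pos.1)

/-- The turning rates of the planes of the pairs of sides of a closed polygon. -/
theorem closed_spin_sum (hη : ∀ I, ContDiffAt ℝ ∞ (fun s => η s I) t)
    (hN : ∀ I, ContDiffAt ℝ ∞ (fun s => N s I) t)
    (h : ∀ᶠ s in 𝓝 t, IsClosedPolygon (η s) (N s)) :
    spin (polygonVec (η t) (N t) 0) (fun s => N s 0 ⨯₃ N s 1) t +
      spin (polygonVec (η t) (N t) 1) (fun s => N s 2 ⨯₃ N s 3) t +
      spin (polygonVec (η t) (N t) 2) (fun s => N s 4 ⨯₃ N s 5) t =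
    ∑ I, closedLen (η t) (N t) I * angleDeriv (fun s => closedRho (η s) (N s) I) t := by
  have hE := contDiffAt_polygonVec hη hN
  have dE := fun I => ContDiffAt.differentiableAt_infty (hE I)
  have dc : ∀ {a b : ℝ → R3}, ContDiffAt ℝ ∞ a t → ContDiffAt ℝ ∞ b t →
      DifferentiableAt ℝ (fun s => a s ⨯₃ b s) t := fun ha hb =>
    ContDiffAt.differentiableAt_infty (contDiffAt_cross ha hb)
  have h0 := h.self_of_nhds
  have a0 : closedLen (η t) (N t) 0 * angleDeriv (fun s => closedRho (η s) (N s) 0) t = _ :=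
    angleDeriv_angleAbout (dE 0) (dc (hE 0) (hE 1)) (dc (hN 0) (hN 1))
      (h.mono fun _ hs => hs.transverse0)
  have a1 : closedLen (η t) (N t) 1 * angleDeriv (fun s => closedRho (η s) (N s) 1) t = _ :=
    angleDeriv_angleAbout (dE 1) (dc (hE 0) (hE 1)) (dc (hN 2) (hN 3))
      (h.mono fun _ hs => hs.transverse1)
  have a2 : closedLen (η t) (N t) 2 * angleDeriv (fun s => closedRho (η s) (N s) 2) t = _ :=
    angleDeriv_angleAbout (dE 2) (dc (hE 0) (hE 1)) (dc (hN 4) (hN 5))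
      (h.mono fun _ hs => hs.transverse2)
  -- All three angles start from the same plane and their axes sum to zero, so the reference rates
  -- cancel.
  have hsum := congrArg (fun k => spin k
    (fun s => polygonVec (η s) (N s) 0 ⨯₃ polygonVec (η s) (N s) 1) t) h0.sum
  simp only [spin_add, spin_zero] at hsum
  rw [Fin.sum_univ_three, a0, a1, a2]
  linear_combination hsum

end Polygons

/-! ### The holonomy angle of an edge -/

/-- The angle `ζ` of `zeta`, as a function of the normals `V`, `Vt` of an edge, of the normals `P`,
`Q` of its neighbours at the source and at the target, and of the frames at its ends. -/
def holonomyAngle (n nt : SU2) (V Vt P Q : R3) : Real.Angle :=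
  angleAbout V (rot (n * nt⁻¹) (Vt ⨯₃ Q)) (P ⨯₃ V)

theorem frame_dot_cross {nt : SU2} {Vt : R3} (h : rot nt axis = -Vt) (Q : R3) :
    axis ⬝ᵥ rot nt⁻¹ (Vt ⨯₃ Q) = 0 := by
  rw [← rot_dot nt, rot_rot_inv, h, neg_dotProduct, dot_cross_left, neg_zero]

theorem rot_ne_zero (g : SU2) {u : R3} (h : u ≠ 0) : rot g u ≠ 0 := fun h0 =>
  h (rot_injective g (by rw [h0, rot_zero]))

/-- The holonomy takes `-Ṽ` to `V`, both being images of the third axis, so it takes directions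
orthogonal to `Ṽ` to directions orthogonal to `V`. -/
theorem holonomy_transverse {n nt : SU2} {V Vt P Q : R3} (hV : rot n axis = V)
    (hVt : rot nt axis = -Vt) (hPV : P ⨯₃ V ≠ 0) (hVQ : Vt ⨯₃ Q ≠ 0) :
    Transverse V (rot (n * nt⁻¹) (Vt ⨯₃ Q)) (P ⨯₃ V) := by
  refine ⟨?_, rot_ne_zero _ hVQ, hPV, ?_, dot_cross_right _ _⟩
  · rintro rfl; exact hPV (by simp)
  · rw [rot_mul, ← hV, rot_dot, frame_dot_cross hVt]

section Edge

variable {t : ℝ} {n nt : R3 → SU2} {V Vt P Q : ℝ → R3}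

theorem smoothAngleAt_holonomy (hn : SmoothSU2At (fun s => n (V s)) t)
    (hnt : SmoothSU2At (fun s => nt (Vt s)) t) (hV : ContDiffAt ℝ ∞ V t)
    (hVt : ContDiffAt ℝ ∞ Vt t) (hP : ContDiffAt ℝ ∞ P t) (hQ : ContDiffAt ℝ ∞ Q t)
    (h : ∀ᶠ s in 𝓝 t, rot (n (V s)) axis = V s ∧ rot (nt (Vt s)) axis = -Vt s ∧
      P s ⨯₃ V s ≠ 0 ∧ Vt s ⨯₃ Q s ≠ 0) :
    SmoothAngleAt (fun s => holonomyAngle (n (V s)) (nt (Vt s)) (V s) (Vt s) (P s) (Q s)) t :=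
  smoothAngleAt_angleAbout hV (contDiffAt_rot (hn.mul hnt.inv) (contDiffAt_cross hVt hQ))
    (contDiffAt_cross hP hV)
    (h.mono fun _ hs => holonomy_transverse hs.1 hs.2.1 hs.2.2.1 hs.2.2.2)

/-- Let `q` be the direction of `Ṽ × Q` pulled back to the fixed frame by `ñ`. Then `spin_rot` for
`n` and for `ñ` gives the two sphere terms, each with the same extra rate of `q` about the third
axis, and this rate cancels. The sign in `V = -ñ τ_3 ñ⁻¹` is what makes the two sphere terms add. -/
theorem sphereForm_add_angleDeriv_holonomy (hn : SmoothSU2At (fun s => n (V s)) t)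
    (hnt : SmoothSU2At (fun s => nt (Vt s)) t) (hV : ContDiffAt ℝ ∞ V t)
    (hVt : ContDiffAt ℝ ∞ Vt t) (hP : ContDiffAt ℝ ∞ P t) (hQ : ContDiffAt ℝ ∞ Q t)
    (h : ∀ᶠ s in 𝓝 t, rot (n (V s)) axis = V s ∧ rot (nt (Vt s)) axis = -Vt s ∧
      P s ⨯₃ V s ≠ 0 ∧ Vt s ⨯₃ Q s ≠ 0) (hV1 : V t ⬝ᵥ V t = 1) :
    sphereForm n V t +
      angleDeriv (fun s => holonomyAngle (n (V s)) (nt (Vt s)) (V s) (Vt s) (P s) (Q s)) t +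
      sphereForm nt Vt t =
    spin (V t) (fun s => P s ⨯₃ V s) t + spin (Vt t) (fun s => Vt s ⨯₃ Q s) t := by
  obtain ⟨e1, e2, hPV, hVQ⟩ := h.self_of_nhds
  set q : ℝ → R3 := fun s => rot (nt (Vt s))⁻¹ (Vt s ⨯₃ Q s) with hq
  have sq : ContDiffAt ℝ ∞ q t := contDiffAt_rot hnt.inv (contDiffAt_cross hVt hQ)
  have dq := ContDiffAt.differentiableAt_infty sq
  have hq0 : q t ≠ 0 := rot_ne_zero _ hVQ
  have hqa : axis ⬝ᵥ q t = 0 := frame_dot_cross e2 _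
  have s1 := spin_rot hn dq hq0 hqa
  have s2 := spin_rot hnt dq hq0 hqa
  rw [e1] at s1
  rw [e2] at s2
  have e3 : (fun s => rot (nt (Vt s)) (q s)) = fun s => Vt s ⨯₃ Q s := by
    funext s; rw [hq]; exact rot_rot_inv _ _
  have e4 : spin (-Vt t) (fun s => Vt s ⨯₃ Q s) t = -spin (Vt t) (fun s => Vt s ⨯₃ Q s) t := by
    have := spin_smul_axis (-1) (Vt t) (fun s => Vt s ⨯₃ Q s) t
    simpa using this
  rw [e3, e4, su2_neg, Tr_neg_left] at s2
  have ha := angleDeriv_angleAbout (ContDiffAt.differentiableAt_infty hV)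
    (ContDiffAt.differentiableAt_infty
      (contDiffAt_rot (hn.mul hnt.inv) (contDiffAt_cross hVt hQ)))
    (ContDiffAt.differentiableAt_infty (contDiffAt_cross hP hV))
    (h.mono fun _ hs => holonomy_transverse hs.1 hs.2.1 hs.2.2.1 hs.2.2.2)
  have e5 : (fun s => rot (n (V s) * (nt (Vt s))⁻¹) (Vt s ⨯₃ Q s)) =
      fun s => rot (n (V s)) (q s) := by funext s; rw [rot_mul]
  rw [len_eq_one hV1, one_mul, e5] at ha
  simp only [holonomyAngle]
  rw [ha, sphereForm, sphereForm]
  linear_combination -s1 + s2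

end Edge

/-- Covariance of the holonomy angle under rotations at both ends and changes of section. -/
theorem holonomyAngle_gauge {n nt n' nt' g h : SU2} {α β : ℝ} {V Vt P Q : R3}
    (hV : rot n axis = V) (hVt : rot nt axis = -Vt) (hPV : P ⨯₃ V ≠ 0) (hVQ : Vt ⨯₃ Q ≠ 0)
    (hn : g * n = n' * axial α) (hnt : h * nt = nt' * axial β) :
    holonomyAngle n' nt' (rot g V) (rot h Vt) (rot g P) (rot h Q) =
      holonomyAngle n nt V Vt P Q + ((α - β : ℝ) : Real.Angle) := by
  have hn' : n' = g * n * (axial α)⁻¹ := by rw [hn]; group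
  have hnt' : nt' = h * nt * (axial β)⁻¹ := by rw [hnt]; group
  set q := rot nt⁻¹ (Vt ⨯₃ Q) with hq
  have hqa : axis ⬝ᵥ q = 0 := frame_dot_cross hVt Q
  have hV0 : V ≠ 0 := by rintro rfl; exact hPV (by simp)
  -- Both rotations of the ends drop out except for an overall `g`; the changes of section remain as
  -- rotations about the third axis.
  have e1 : rot (n' * nt'⁻¹) (rot h Vt ⨯₃ rot h Q) =
      rot g (rot n (rot (axial (-α)) (rot (axial β) q))) := by
    rw [← rot_cross, hq]
    simp only [← rot_mul, hn', hnt', ← axial_neg]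
    congr 1; group
  have hmul : axial (-α) * axial β = axial (β - α) := by
    apply Subtype.ext
    change expTau3 (-α) * expTau3 β = expTau3 (β - α)
    simp only [expTau3_eq]
    ext i j
    fin_cases i <;> fin_cases j <;>
      simp [Matrix.mul_apply, Fin.sum_univ_two, ← Complex.exp_add] <;> ring_nf
  rw [holonomyAngle, e1, ← rot_cross, rot_angleAbout, ← rot_mul (axial (-α)), hmul,
    rot_axial_eq_turn _ hqa, rot_turn, hV]
  have hT := holonomy_transverse hV hVt hPV hVQ
  have hu : V ⬝ᵥ rot n q = 0 := by rw [← hV, rot_dot, hqa]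
  have hqn : rot n q ≠ 0 := by
    have := hT.u0; rwa [rot_mul] at this
  set θ := holonomyAngle n nt V Vt P Q with hθ
  have hdir : dir (P ⨯₃ V) = turn V θ (dir (rot n q)) := by
    rw [hθ, holonomyAngle, hT.dir_eq_turn, rot_mul]
  set γ : Real.Angle := ((β - α : ℝ) : Real.Angle) with hγ
  have hγ' : ((α - β : ℝ) : Real.Angle) = -γ := by rw [hγ, ← Real.Angle.coe_neg, neg_sub]
  have hlen : len (turn V γ (rot n q)) = len (rot n q) := by
    rw [len, turn_dot_self hV0 hu, len]
  have hdt : dir (turn V γ (rot n q)) = turn V γ (dir (rot n q)) := by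
    rw [dir, hlen, dir, turn, turn, map_smul, smul_add, smul_comm, smul_comm (len _)⁻¹]
  have hd0 : dir V ⬝ᵥ dir (rot n q) = 0 := by
    rw [dir, smul_dotProduct, dot_dir_eq_zero hu, smul_zero]
  -- Rotations about `V` compose additively on the orthogonal plane, where the double cross product
  -- with the unit axis is minus the identity.
  have hturn : turn V (θ + -γ) (turn V γ (dir (rot n q))) = turn V θ (dir (rot n q)) := by
    have hcc : dir V ⨯₃ (dir V ⨯₃ dir (rot n q)) = -dir (rot n q) := by
      have : ∀ a b : R3, a ⨯₃ (a ⨯₃ b) = (a ⬝ᵥ b) • a - (a ⬝ᵥ a) • b := by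
        intro a b
        simp only [cross_apply, dotProduct, Fin.sum_univ_three, Matrix.cons_val]
        ext i
        simp only [Pi.sub_apply, Pi.smul_apply, smul_eq_mul]
        fin_cases i <;> simp <;> ring
      rw [this, hd0, dir_unit hV0]; simp
    have h1 := γ.cos_sq_add_sin_sq
    simp only [turn, map_add, map_smul, hcc, Real.Angle.cos_add, Real.Angle.sin_add,
      Real.Angle.cos_neg, Real.Angle.sin_neg]
    ext i
    simp only [Pi.add_apply, Pi.smul_apply, smul_eq_mul, Pi.neg_apply]
    linear_combination (θ.cos * dir (rot n q) i +
      θ.sin * (dir V ⨯₃ dir (rot n q)) i) * h1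
  rw [hγ']
  refine Transverse.angle_eq ⟨hV0, ?_, hPV, dot_turn hu _, dot_cross_right _ _⟩ ?_
  · exact ne_zero_of_len_pos (by rw [hlen]; exact len_pos hqn)
  · rw [hdt, hturn, hdir]

section Lattice

variable {L : Fin 3 → ℕ}

/-! ### Edges and half-edges -/

theorem edgeAt_source (e : Edge L) : edgeAt (source e) (e.2, true) = e := rfl

theorem edgeAt_target (e : Edge L) : edgeAt (target e) (e.2, false) = e := by
  simp [edgeAt, target]

theorem target_edgeAt (v : Vertex L) (i : Fin 3) : target (edgeAt v (i, false)) = v := by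
  simp [edgeAt, target]

theorem Point.normal_source (x : Point L) (e : Edge L) :
    x.normal (source e) (e.2, true) = x.V e := rfl

theorem Point.normal_target (x : Point L) (e : Edge L) :
    x.normal (target e) (e.2, false) = x.Vt e := by
  rw [Point.normal, edgeAt_target]; rfl

theorem Point.normal_unit (x : Point L) (v : Vertex L) (h : HalfEdge) :
    x.normal v h ⬝ᵥ x.normal v h = 1 := by
  rw [Point.normal]; split_ifs
  · exact x.V_unit _
  · exact x.Vt_unit _

/-- Every edge has one end at its source and one at its target; translation by a unit step permutes
the vertices of the torus, so the second kind of end can be reindexed by the target. -/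
theorem sum_half_edges [∀ i, NeZero (L i)] (f : Vertex L → HalfEdge → ℝ) :
    ∑ e : Edge L, (f (source e) (e.2, true) + f (target e) (e.2, false)) = ∑ v, ∑ h, f v h := by
  have h1 : ∀ i : Fin 3, ∑ v : Vertex L, f (v + step i) (i, false) = ∑ v, f v (i, false) :=
    fun i => Equiv.sum_comp (Equiv.addRight (step i)) fun v => f v (i, false)
  simp only [Fintype.sum_prod_type, source, target, Finset.sum_add_distrib, Fintype.sum_bool]
  congr 1
  rw [Finset.sum_comm]
  simp only [h1]
  rw [Finset.sum_comm]

theorem contDiffAt_normal {c : ℝ → Point L} {t : ℝ}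
    (hV : ∀ e, ContDiffAt ℝ ∞ (fun s => (c s).V e) t)
    (hVt : ∀ e, ContDiffAt ℝ ∞ (fun s => (c s).Vt e) t) (v : Vertex L) (h : HalfEdge) :
    ContDiffAt ℝ ∞ (fun s => (c s).normal v h) t := by
  obtain ⟨i, b⟩ := h
  cases b
  · exact hVt _
  · exact hV _

/-! ### The polygons at the vertices of the graph. -/

variable (D : LoopChoice L)

theorem etaVec_eq (x : Point L) (v : Vertex L) :
    etaVec D x v = polygonVec (etaL D x v) (normalL D x v) := rfl

theorem normal_eq_normalL (x : Point L) (v : Vertex L) (h : HalfEdge) :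
    x.normal v h = normalL D x v ((D.label v).symm h) := by simp [normalL]

theorem normal_partner (x : Point L) (v : Vertex L) (h : HalfEdge) :
    x.normal v (D.partner v h) =
      normalL D x v (![1, 0, 3, 2, 5, 4] ((D.label v).symm h)) := rfl

theorem gauss_eq (x : Point L) (v : Vertex L) :
    x.gauss v = -(etaVec D x v 2 + etaVec D x v 3) := by
  rw [Point.gauss, ← Equiv.sum_comp (D.label v), Fin.sum_univ_six]
  simp only [etaVec, Matrix.cons_val, etaL, normalL]
  abel_nf

/-- Neighbouring edges of a minimal loop are nowhere parallel. -/
def Nondegenerate (x : Point L) : Prop :=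
  ∀ v h, x.normal v h ⨯₃ x.normal v (D.partner v h) ≠ 0

variable {D}

theorem nondegenerate_of_pairs {x : Point L} (h : ∀ v, normalL D x v 0 ⨯₃ normalL D x v 1 ≠ 0 ∧
    normalL D x v 2 ⨯₃ normalL D x v 3 ≠ 0 ∧ normalL D x v 4 ⨯₃ normalL D x v 5 ≠ 0) :
    Nondegenerate D x := by
  intro v e
  rw [normal_eq_normalL D, normal_partner]
  generalize (D.label v).symm e = I
  have hsymm : ∀ {a b : R3}, a ⨯₃ b ≠ 0 → b ⨯₃ a ≠ 0 := fun hab h0 =>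
    hab (by rw [← cross_anticomm, h0, neg_zero])
  obtain ⟨h0, h1, h2⟩ := h v
  revert I
  exact Fin.forall_six h0 (hsymm h0) h1 (hsymm h1) h2 (hsymm h2)

theorem isOpenPolygon {x : Point L} (hx : x ∈ interiorP D) (v : Vertex L) :
    IsOpenPolygon (etaL D x v) (normalL D x v) (etaBreve x v) (normalV x v) := by
  obtain ⟨hη, h⟩ := hx
  obtain ⟨T0, T1, T2, T3, T4, hb⟩ := h v
  refine ⟨fun I => hη _, fun I => x.normal_unit _ _, T0, T1, T2, T3, T4, ?_, ?_⟩
  · rw [normalV, smul_neg, smul_smul, mul_inv_cancel₀ hb.ne', one_smul, gauss_eq D, neg_neg]; rfl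
  · have h2 := len_sq (x.gauss v)
    change etaBreve x v ^ 2 = _ at h2
    simp only [normalV, neg_dotProduct, dotProduct_neg, smul_dotProduct, dotProduct_smul, ← h2,
      smul_eq_mul]
    field_simp

theorem isClosedPolygon {x : Point L} (hx : x ∈ constraintInterior D) (v : Vertex L) :
    IsClosedPolygon (etaL D x v) (normalL D x v) := by
  obtain ⟨hη, h⟩ := hx
  obtain ⟨hg, T0, T1, T2, T3⟩ := h v
  refine ⟨fun I => hη _, fun I => x.normal_unit _ _, T0, T1, T2, T3, ?_⟩
  rw [gauss_eq D, neg_eq_zero, etaVec_eq, polygonVec_three] at hg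
  rw [← hg]; abel

theorem nondegenerate_of_interior {x : Point L} (hx : x ∈ interiorP D) : Nondegenerate D x :=
  nondegenerate_of_pairs fun v =>
    ⟨(isOpenPolygon hx v).transverse0.w0, (isOpenPolygon hx v).transverse1.w0,
      (isOpenPolygon hx v).transverse2.w0⟩

theorem nondegenerate_of_constraint {x : Point L} (hx : x ∈ constraintInterior D) :
    Nondegenerate D x :=
  nondegenerate_of_pairs fun v =>
    ⟨(isClosedPolygon hx v).transverse0.w0, (isClosedPolygon hx v).transverse1.w0,
      (isClosedPolygon hx v).transverse2.w0⟩

theorem Nondegenerate.source_ne {x : Point L} (h : Nondegenerate D x) (e : Edge L) :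
    x.normal (source e) (D.partner (source e) (e.2, true)) ⨯₃ x.V e ≠ 0 := fun h0 =>
  h (source e) (e.2, true) (by rw [← cross_anticomm, Point.normal_source, h0, neg_zero])

theorem Nondegenerate.target_ne {x : Point L} (h : Nondegenerate D x) (e : Edge L) :
    x.Vt e ⨯₃ x.normal (target e) (D.partner (target e) (e.2, false)) ≠ 0 := by
  rw [← x.normal_target e]; exact h _ _

theorem zeta_eq (S : Sections L) (x : Point L) (e : Edge L) : zeta D S x e =
    holonomyAngle (S.n e (x.V e)) (S.nt e (x.Vt e)) (x.V e) (x.Vt e)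
      (x.normal (source e) (D.partner (source e) (e.2, true)))
      (x.normal (target e) (D.partner (target e) (e.2, false))) := rfl

theorem xi_eq (S : Sections L) (x : Point L) (e : Edge L) :
    x.ξ e = rho D S x e + zeta D S x e := by simp [rho]

theorem zeta_spec {S : Sections L} {x : Point L} (h : Nondegenerate D x) (e : Edge L) :
    rot (S.n e (x.V e)) axis = x.V e ∧ rot (S.nt e (x.Vt e)) axis = -x.Vt e ∧
      x.normal (source e) (D.partner (source e) (e.2, true)) ⨯₃ x.V e ≠ 0 ∧
      x.Vt e ⨯₃ x.normal (target e) (D.partner (target e) (e.2, false)) ≠ 0 :=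
  ⟨S.rot_n e (x.V_unit e), S.rot_nt e (x.Vt_unit e), h.source_ne e, h.target_ne e⟩

/-! ### The symplectic potential in terms of turning rates. -/

section Curves

variable {S : Sections L} {c : ℝ → Point L} {t : ℝ}

theorem smooth_sections (hV : ∀ e, ContDiffAt ℝ ∞ (fun s => (c s).V e) t)
    (hVt : ∀ e, ContDiffAt ℝ ∞ (fun s => (c s).Vt e) t) (hr : EdgeRegular S (c t)) (e : Edge L) :
    SmoothSU2At (fun s => S.n e ((c s).V e)) t ∧ SmoothSU2At (fun s => S.nt e ((c s).Vt e)) t :=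
  ⟨(hr e).1.smoothSU2At (hV e) (Filter.Eventually.of_forall fun s => (c s).V_unit e),
    (hr e).2.smoothSU2At (hVt e) (Filter.Eventually.of_forall fun s => (c s).Vt_unit e)⟩

theorem smoothAngleAt_zeta (hV : ∀ e, ContDiffAt ℝ ∞ (fun s => (c s).V e) t)
    (hVt : ∀ e, ContDiffAt ℝ ∞ (fun s => (c s).Vt e) t) (hr : EdgeRegular S (c t))
    (hd : ∀ᶠ s in 𝓝 t, Nondegenerate D (c s)) (e : Edge L) :
    SmoothAngleAt (fun s => zeta D S (c s) e) t :=
  smoothAngleAt_holonomy (smooth_sections hV hVt hr e).1 (smooth_sections hV hVt hr e).2 (hV e)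
    (hVt e) (contDiffAt_normal hV hVt _ _) (contDiffAt_normal hV hVt _ _)
    (hd.mono fun _ hs => zeta_spec hs e)

theorem smoothAngleAt_rho (hc : Point.SmoothAt c t) (hr : EdgeRegular S (c t))
    (hd : ∀ᶠ s in 𝓝 t, Nondegenerate D (c s)) (e : Edge L) :
    SmoothAngleAt (fun s => rho D S (c s) e) t :=
  (hc.2.2.2 e).sub (smoothAngleAt_zeta hc.1 hc.2.1 hr hd e)

/-- Smooth normals suffice for a smooth `ζ`, so `ξ = ϱ + ζ` is recovered smoothly once the polygons
are. -/
theorem smoothAngleAt_xi (hV : ∀ e, ContDiffAt ℝ ∞ (fun s => (c s).V e) t)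
    (hVt : ∀ e, ContDiffAt ℝ ∞ (fun s => (c s).Vt e) t) (hr : EdgeRegular S (c t))
    (hd : ∀ᶠ s in 𝓝 t, Nondegenerate D (c s))
    (hρ : ∀ e, SmoothAngleAt (fun s => rho D S (c s) e) t) (e : Edge L) :
    SmoothAngleAt (fun s => (c s).ξ e) t := by
  simp only [xi_eq (D := D) S]
  exact (hρ e).add (smoothAngleAt_zeta hV hVt hr hd e)

theorem contDiffAt_V_of_normalL (h : ∀ v I, ContDiffAt ℝ ∞ (fun s => normalL D (c s) v I) t)
    (e : Edge L) : ContDiffAt ℝ ∞ (fun s => (c s).V e) t := by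
  simp only [← Point.normal_source, normal_eq_normalL D]; exact h _ _

theorem contDiffAt_Vt_of_normalL (h : ∀ v I, ContDiffAt ℝ ∞ (fun s => normalL D (c s) v I) t)
    (e : Edge L) : ContDiffAt ℝ ∞ (fun s => (c s).Vt e) t := by
  simp only [← Point.normal_target, normal_eq_normalL D]; exact h _ _

theorem contDiffAt_normalL (hc : Point.SmoothAt c t) (v : Vertex L) (I : Fin 6) :
    ContDiffAt ℝ ∞ (fun s => normalL D (c s) v I) t := contDiffAt_normal hc.1 hc.2.1 _ _

theorem contDiffAt_etaL (hc : Point.SmoothAt c t) (v : Vertex L) (I : Fin 6) :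
    ContDiffAt ℝ ∞ (fun s => etaL D (c s) v I) t := hc.2.2.1 _

/-- The edge identity in a form symmetric in the two ends, so that it can be summed over half-edges.
-/
theorem edge_form (hc : Point.SmoothAt c t) (hr : EdgeRegular S (c t))
    (hd : ∀ᶠ s in 𝓝 t, Nondegenerate D (c s)) (e : Edge L) :
    sphereForm (S.n e) (fun s => (c s).V e) t + angleDeriv (fun s => (c s).ξ e) t +
      sphereForm (S.nt e) (fun s => (c s).Vt e) t =
    angleDeriv (fun s => rho D S (c s) e) t +
      spin ((c t).normal (source e) (e.2, true)) (fun s => (c s).normal (source e) (e.2, true) ⨯₃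
        (c s).normal (source e) (D.partner (source e) (e.2, true))) t +
      spin ((c t).normal (target e) (e.2, false)) (fun s => (c s).normal (target e) (e.2, false) ⨯₃
        (c s).normal (target e) (D.partner (target e) (e.2, false))) t := by
  obtain ⟨s1, s2⟩ := smooth_sections hc.1 hc.2.1 hr e
  have key := sphereForm_add_angleDeriv_holonomy s1 s2 (hc.1 e) (hc.2.1 e)
    (contDiffAt_normal hc.1 hc.2.1 (source e) (D.partner (source e) (e.2, true)))
    (contDiffAt_normal hc.1 hc.2.1 (target e) (D.partner (target e) (e.2, false)))
    (hd.mono fun s hs => zeta_spec hs e) ((c t).V_unit e)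
  simp only [← zeta_eq] at key
  have hx : (fun s => (c s).ξ e) = fun s => rho D S (c s) e + zeta D S (c s) e := by
    funext s; exact xi_eq S (c s) e
  rw [hx, angleDeriv_add (smoothAngleAt_rho hc hr hd e)
    (smoothAngleAt_zeta hc.1 hc.2.1 hr hd e)]
  simp only [Point.normal_source, Point.normal_target]
  -- At the source the alignment condition has the opposite order of factors; the turning rate does
  -- not depend on that sign.
  have hneg : (fun s => (c s).V e ⨯₃ (c s).normal (source e) (D.partner (source e) (e.2, true))) =
      fun s => -((c s).normal (source e) (D.partner (source e) (e.2, true)) ⨯₃ (c s).V e) := by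
    funext s; rw [cross_anticomm]
  rw [hneg, spin_neg]
  linear_combination key

/-- Two partners have the same plane up to orientation, which the turning rate ignores. By linearity
in the axis their weighted normals add up to the diagonal of the pair. -/
theorem vertex_form (D : LoopChoice L) (c : ℝ → Point L) (t : ℝ) (v : Vertex L) :
    ∑ h, (c t).η (edgeAt v h) * spin ((c t).normal v h)
      (fun s => (c s).normal v h ⨯₃ (c s).normal v (D.partner v h)) t =
    spin (polygonVec (etaL D (c t) v) (normalL D (c t) v) 0)
        (fun s => normalL D (c s) v 0 ⨯₃ normalL D (c s) v 1) t +
      spin (polygonVec (etaL D (c t) v) (normalL D (c t) v) 1)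
        (fun s => normalL D (c s) v 2 ⨯₃ normalL D (c s) v 3) t +
      spin (polygonVec (etaL D (c t) v) (normalL D (c t) v) 2)
        (fun s => normalL D (c s) v 4 ⨯₃ normalL D (c s) v 5) t := by
  rw [← Equiv.sum_comp (D.label v), Fin.sum_univ_six]
  have hp : ∀ I x, x.normal v (D.partner v (D.label v I)) =
      normalL D x v (![1, 0, 3, 2, 5, 4] I) := fun I x => by
    rw [normal_partner, Equiv.symm_apply_apply]
  have hs : ∀ (k : R3) (u w : ℝ → R3), spin k (fun s => u s ⨯₃ w s) t =
      spin k (fun s => w s ⨯₃ u s) t := fun k u w => by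
    rw [← spin_neg]; simp only [cross_anticomm]
  have hN : ∀ I x, x.normal v (D.label v I) = normalL D x v I := fun _ _ => rfl
  have hη : ∀ I x, x.η (edgeAt v (D.label v I)) = etaL D x v I := fun _ _ => rfl
  simp only [hp, hN, hη, polygonVec, Matrix.cons_val, spin_add, spin_smul_axis]
  rw [hs _ (fun s => normalL D (c s) v 1), hs _ (fun s => normalL D (c s) v 3),
    hs _ (fun s => normalL D (c s) v 5)]
  ring

/-- The part of the calculation common to open and closed polygons; it uses only that neighbours in
a loop are not parallel. -/
theorem potential_eq [∀ i, NeZero (L i)] (a κ : ℝ) (hc : Point.SmoothAt c t)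
    (hr : EdgeRegular S (c t)) (hd : ∀ᶠ s in 𝓝 t, Nondegenerate D (c s)) :
    potential a κ S c t = a ^ 2 / κ *
      (∑ e, (c t).η e * angleDeriv (fun s => rho D S (c s) e) t +
      ∑ v, (spin (polygonVec (etaL D (c t) v) (normalL D (c t) v) 0)
        (fun s => normalL D (c s) v 0 ⨯₃ normalL D (c s) v 1) t +
      spin (polygonVec (etaL D (c t) v) (normalL D (c t) v) 1)
        (fun s => normalL D (c s) v 2 ⨯₃ normalL D (c s) v 3) t +
      spin (polygonVec (etaL D (c t) v) (normalL D (c t) v) 2)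
        (fun s => normalL D (c s) v 4 ⨯₃ normalL D (c s) v 5) t)) := by
  simp only [← vertex_form]
  rw [← sum_half_edges, potential, ← Finset.sum_add_distrib]
  congr 1
  refine Finset.sum_congr rfl fun e _ => ?_
  rw [edgeAt_source, edgeAt_target]
  linear_combination (c t).η e * edge_form hc hr hd e

end Curves

/-! ### Points with prescribed normals -/

theorem Point.ext_of_normalL {S : Sections L} {x y : Point L}
    (hN : ∀ v, normalL D x v = normalL D y v) (hη : x.η = y.η)
    (hρ : ∀ e, rho D S x e = rho D S y e) : x = y := by
  have hn : ∀ v h, x.normal v h = y.normal v h := fun v h => by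
    rw [normal_eq_normalL D, hN, ← normal_eq_normalL D]
  have hV : x.V = y.V := by
    funext e; rw [← Point.normal_source, hn, Point.normal_source]
  have hVt : x.Vt = y.Vt := by
    funext e; rw [← Point.normal_target, hn, Point.normal_target]
  refine Point.ext hV hVt hη ?_
  funext e
  rw [xi_eq (D := D) S x, xi_eq (D := D) S y, hρ, zeta_eq, zeta_eq, hn, hn, hV, hVt]

theorem exists_point (D : LoopChoice L) (S : Sections L) {N : Vertex L → Fin 6 → R3}
    (hN : ∀ v I, N v I ⬝ᵥ N v I = 1) {η : Edge L → ℝ} (hη : ∀ e, 0 < η e)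
    (ρ : Edge L → Real.Angle) :
    ∃ x : Point L, (∀ v, normalL D x v = N v) ∧ x.η = η ∧ ∀ e, rho D S x e = ρ e := by
  let x₀ : Point L :=
    { V := fun e => N (source e) ((D.label (source e)).symm (e.2, true))
      Vt := fun e => N (target e) ((D.label (target e)).symm (e.2, false))
      η := η
      ξ := 0
      V_unit := fun e => hN _ _
      Vt_unit := fun e => hN _ _
      η_nonneg := fun e => (hη e).le }
  let x : Point L := { x₀ with ξ := fun e => ρ e + zeta D S x₀ e }
  refine ⟨x, fun v => ?_, rfl, fun e => ?_⟩
  · funext I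
    have key : ∀ h, x.normal v h = N v ((D.label v).symm h) := by
      rintro ⟨i, b⟩
      cases b
      · change N (target (edgeAt v (i, false)))
          ((D.label (target (edgeAt v (i, false)))).symm (i, false)) = _
        rw [target_edgeAt]
      · rfl
    rw [normalL, key, Equiv.symm_apply_apply]
  · exact add_sub_cancel_right (ρ e) (zeta D S x₀ e)

end Lattice

section Variables

variable {L : Fin 3 → ℕ} {D : LoopChoice L} {S : Sections L}

/-! ### The interior of the twisted geometry space -/

/-- The reference direction for the angle `ϱ̆_v`. -/
def refDir (S : Sections L) (v : Vertex L) (W : R3) : R3 := rot (S.nv v W) ![0, 1, 0] ⨯₃ W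

/-- The reference direction is a constant vector carried by the section, which is why its turning
rate about `W` is exactly the sphere term (`spin_refDir`). -/
theorem refDir_eq {v : Vertex L} {W : R3} (h : W ⬝ᵥ W = 1) :
    refDir S v W = rot (S.nv v W) ![1, 0, 0] := by
  have e : (![0, 1, 0] : R3) ⨯₃ axis = ![1, 0, 0] := by simp [axis, cross_apply]
  rw [refDir, ← e, rot_cross, S.rot_nv v h]

theorem refDir_unit {v : Vertex L} {W : R3} (h : W ⬝ᵥ W = 1) :
    refDir S v W ⬝ᵥ refDir S v W = 1 := by
  rw [refDir_eq h, rot_dot]; simp [dotProduct, Fin.sum_univ_three]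

theorem dot_refDir (S : Sections L) (v : Vertex L) (W : R3) : W ⬝ᵥ refDir S v W = 0 :=
  dot_cross_right _ _

theorem rhoBreve_eq (D : LoopChoice L) (S : Sections L) (x : Point L) (v : Vertex L) :
    rhoBreve D S x v = angleAbout (normalV x v) (refDir S v (normalV x v))
      (polygonVec (etaL D x v) (normalL D x v) 2 ⨯₃ normalV x v) := rfl

theorem normalL_eq_openPolygon {x : Point L} (hx : x ∈ interiorP D) (v : Vertex L) :
    normalL D x v = openPolygon ((newVariables D S x).W v)
      (refDir S v ((newVariables D S x).W v)) ((newVariables D S x).ηb v)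
      ((newVariables D S x).ρb v) ((newVariables D S x).ηv v) ((newVariables D S x).ρv v)
      (fun I => (newVariables D S x).η (edgeAt v (D.label v I))) :=
  have h := isOpenPolygon hx v
  h.eq_openPolygon (refDir_unit h.W_unit) (dot_refDir S v _)

theorem newVariables_mem {x : Point L} (hx : x ∈ interiorP D) :
    newVariables D S x ∈ variablesRange D := by
  refine ⟨hx.1, fun v => ?_⟩
  obtain ⟨T0, T1, T2, T3, T4, hb⟩ := hx.2 v
  exact ⟨T0, T1, T2, T3, T4, hb, (isOpenPolygon hx v).W_unit⟩

theorem newVariables_injOn : Set.InjOn (newVariables D S) (interiorP D) := by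
  intro x hx y hy h
  refine Point.ext_of_normalL (D := D) (S := S) (fun v => ?_) (congrArg Variables.η h)
    fun e => congrFun (congrArg Variables.ρ h) e
  rw [normalL_eq_openPolygon (S := S) hx, normalL_eq_openPolygon (S := S) hy, h]

theorem newVariables_surjOn :
    Set.SurjOn (newVariables D S) (interiorP D) (variablesRange D) := by
  rintro q ⟨hη, hq⟩
  have spec : ∀ v, _ := fun v =>
    openPolygon_spec (u := refDir S v (q.W v)) (q.ρb v) (q.ρv v) (hq v).2.2.2.2.2.2
      (refDir_unit (hq v).2.2.2.2.2.2) (dot_refDir S v _) (fun I => hη (edgeAt v (D.label v I)))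
      (hq v).1 (hq v).2.1 (hq v).2.2.1 (hq v).2.2.2.1 (hq v).2.2.2.2.1 rfl
  obtain ⟨x, hN, hxη, hρ⟩ := exists_point D S (fun v => (spec v).1.unit) hη q.ρ
  have hηL : ∀ v, etaL D x v = fun I => q.η (edgeAt v (D.label v I)) := fun v => by
    funext I; rw [etaL, hxη]
  have hpoly : ∀ v, IsOpenPolygon (etaL D x v) (normalL D x v) (q.ηb v) (q.W v) := fun v => by
    rw [hN, hηL]; exact (spec v).1
  have hlen : ∀ v I, len (etaVec D x v I) = q.ηv v I := fun v I => by
    rw [etaVec_eq, hN, hηL]; exact (spec v).2.1 I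
  -- Closing the polygon by the prescribed seventh side fixes the Gauss constraint, whose modulus
  -- and direction are then the prescribed ones.
  have hgauss : ∀ v, x.gauss v = -(q.ηb v • q.W v) := fun v => by
    rw [gauss_eq D, etaVec_eq, (hpoly v).sum]
  have hb : ∀ v, etaBreve x v = q.ηb v := fun v => by
    rw [etaBreve, hgauss, len_neg, len_smul_unit (hpoly v).ηb_pos (hpoly v).W_unit]
  have hW : ∀ v, normalV x v = q.W v := fun v => by
    rw [normalV, hb, hgauss, smul_neg, neg_neg, smul_smul,
      inv_mul_cancel₀ (hpoly v).ηb_pos.ne', one_smul]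
  refine ⟨x, ⟨fun e => by rw [hxη]; exact hη e, fun v => ?_⟩, ?_⟩
  · simp only [hlen, hb, hηL]
    obtain ⟨T0, T1, T2, T3, T4, hb, -⟩ := hq v
    exact ⟨T0, T1, T2, T3, T4, hb⟩
  · refine Variables.ext hxη (funext hρ) ?_ ?_ (funext hb) ?_ (funext hW)
    · funext v I; exact hlen v I
    · funext v
      change polygonRho (etaL D x v) (normalL D x v) = _
      rw [hN, hηL]; exact (spec v).2.2.1
    · funext v
      change rhoBreve D S x v = _
      rw [rhoBreve_eq, hW, hN, hηL]; exact (spec v).2.2.2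

theorem newVariables_bijOn (D : LoopChoice L) (S : Sections L) :
    Set.BijOn (newVariables D S) (interiorP D) (variablesRange D) :=
  ⟨fun _ => newVariables_mem, newVariables_injOn, newVariables_surjOn⟩

/-! ### Curves in the interior: smoothness in both directions and the potential. -/

section Curves

variable {c : ℝ → Point L} {t : ℝ}

theorem contDiffAt_gauss (D : LoopChoice L) (hc : Point.SmoothAt c t) (v : Vertex L) :
    ContDiffAt ℝ ∞ (fun s => (c s).gauss v) t := by
  have hE := contDiffAt_polygonVec (contDiffAt_etaL (D := D) hc v)
    (contDiffAt_normalL (D := D) hc v)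
  simp only [gauss_eq D]
  exact ((hE 2).add (hE 3)).neg

theorem contDiffAt_etaBreve (hc : Point.SmoothAt c t) (hi : c t ∈ interiorP D) (v : Vertex L) :
    ContDiffAt ℝ ∞ (fun s => etaBreve (c s) v) t :=
  contDiffAt_len (contDiffAt_gauss D hc v) (ne_zero_of_len_pos (isOpenPolygon hi v).ηb_pos)

theorem contDiffAt_normalV (hc : Point.SmoothAt c t) (hi : c t ∈ interiorP D) (v : Vertex L) :
    ContDiffAt ℝ ∞ (fun s => normalV (c s) v) t :=
  (((contDiffAt_etaBreve hc hi v).inv (isOpenPolygon hi v).ηb_pos.ne').smul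
    (contDiffAt_gauss D hc v)).neg

theorem smooth_refDir {W : ℝ → R3} {v : Vertex L} (hW : ContDiffAt ℝ ∞ W t)
    (h1 : ∀ᶠ s in 𝓝 t, W s ⬝ᵥ W s = 1) (hr : SectionSmoothAt (S.nv v) (W t)) :
    ContDiffAt ℝ ∞ (fun s => refDir S v (W s)) t :=
  contDiffAt_cross (contDiffAt_rot (hr.smoothSU2At hW h1) contDiffAt_const) hW

theorem eventually_refDir {W : ℝ → R3} {v : Vertex L} (h1 : ∀ᶠ s in 𝓝 t, W s ⬝ᵥ W s = 1) :
    ∀ᶠ s in 𝓝 t, refDir S v (W s) ≠ 0 ∧ W s ⬝ᵥ refDir S v (W s) = 0 :=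
  h1.mono fun s hs => ⟨ne_zero_of_unit (refDir_unit hs), dot_refDir S v (W s)⟩

theorem smooth_newVariables (hc : Point.SmoothAt c t) (hi : ∀ᶠ s in 𝓝 t, c s ∈ interiorP D)
    (hr : EdgeRegular S (c t)) (hv : VertexRegular S (c t)) :
    Variables.SmoothAt (fun s => newVariables D S (c s)) t := by
  have h0 := hi.self_of_nhds
  have hpoly := fun v => hi.mono fun s hs => isOpenPolygon hs v
  have hW := contDiffAt_normalV hc h0
  have hW1 := fun v => (hpoly v).mono fun s hs => hs.W_unit
  refine ⟨hc.2.2.1, smoothAngleAt_rho hc hr (hi.mono fun _ => nondegenerate_of_interior),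
    fun v => contDiffAt_len_polygonVec (contDiffAt_etaL hc v) (contDiffAt_normalL hc v)
      (isOpenPolygon h0 v),
    fun v => smoothAngleAt_polygonRho (contDiffAt_etaL hc v) (contDiffAt_normalL hc v) (hpoly v),
    contDiffAt_etaBreve hc h0, fun v => ?_, hW⟩
  exact smoothAngleAt_breve (contDiffAt_etaL hc v) (contDiffAt_normalL hc v) (hW v)
    (smooth_refDir (hW v) (hW1 v) (hv v)) (hpoly v) (eventually_refDir (hW1 v))

/-- The order matters: the explicit polygon makes the normals smooth first, using only the vertex
sections; then the edge sections are smooth along them and `ξ` follows. -/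
theorem smooth_of_newVariables (hq : Variables.SmoothAt (fun s => newVariables D S (c s)) t)
    (hi : ∀ᶠ s in 𝓝 t, c s ∈ interiorP D) (hr : EdgeRegular S (c t))
    (hv : VertexRegular S (c t)) : Point.SmoothAt c t := by
  have h0 := hi.self_of_nhds
  obtain ⟨sη, sρ, sηv, sρv, sηb, sρb, sW⟩ := hq
  have hN : ∀ v I, ContDiffAt ℝ ∞ (fun s => normalL D (c s) v I) t := fun v I => by
    refine ContDiffAt.congr_of_eventuallyEq ?_
      (hi.mono fun s hs => congrFun (normalL_eq_openPolygon (S := S) hs v) I)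
    have hW1 : ∀ᶠ s in 𝓝 t, (newVariables D S (c s)).W v ⬝ᵥ (newVariables D S (c s)).W v = 1 :=
      hi.mono fun s hs => (isOpenPolygon hs v).W_unit
    obtain ⟨T0, T1, T2, T3, T4, -, hW⟩ := (newVariables_mem (S := S) h0).2 v
    exact contDiffAt_openPolygon (sW v) (smooth_refDir (sW v) hW1 (hv v)) (sηb v) (sρb v) (sηv v)
      (sρv v) (fun I => sη _) hW (refDir_unit hW) (dot_refDir S v _) T0 T1 T2 T3 T4 I
  have hV := contDiffAt_V_of_normalL hN
  have hVt := contDiffAt_Vt_of_normalL hN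
  exact ⟨hV, hVt, sη, smoothAngleAt_xi hV hVt hr (hi.mono fun _ => nondegenerate_of_interior) sρ⟩

theorem spin_refDir {W : ℝ → R3} {v : Vertex L} (hW : ContDiffAt ℝ ∞ W t)
    (h1 : ∀ᶠ s in 𝓝 t, W s ⬝ᵥ W s = 1) (hr : SectionSmoothAt (S.nv v) (W t)) :
    spin (W t) (fun s => refDir S v (W s)) t = sphereForm (S.nv v) W t := by
  have hrot := S.rot_nv v h1.self_of_nhds
  have key := spin_rot (hr.smoothSU2At hW h1) (q := fun _ => ![1, 0, 0])
    (differentiableAt_const _) (by intro h; simpa using congrFun h 0) (k := axis)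
    (by simp [axis, dotProduct, Fin.sum_univ_three])
  rw [hrot] at key
  rw [spin_congr (h1.mono fun s hs => refDir_eq hs), key, sphereForm]
  simp [spin]

theorem potential_eq_newPotential [∀ i, NeZero (L i)] (a κ : ℝ) (hc : Point.SmoothAt c t)
    (hi : ∀ᶠ s in 𝓝 t, c s ∈ interiorP D) (hr : EdgeRegular S (c t))
    (hv : VertexRegular S (c t)) :
    potential a κ S c t = newPotential a κ S (fun s => newVariables D S (c s)) t := by
  have h0 := hi.self_of_nhds
  rw [potential_eq a κ hc hr (hi.mono fun _ => nondegenerate_of_interior), newPotential]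
  congr 2
  refine Finset.sum_congr rfl fun v _ => ?_
  have hpoly := hi.mono fun s hs => isOpenPolygon hs v
  have hW := contDiffAt_normalV hc h0 v
  have hW1 := hpoly.mono fun s hs => hs.W_unit
  rw [open_spin_sum (contDiffAt_etaL hc v) (contDiffAt_normalL hc v)
    (contDiffAt_etaBreve hc h0 v) hW (smooth_refDir hW hW1 (hv v)) hpoly (eventually_refDir hW1),
    spin_refDir hW hW1 (hv v)]
  rfl

end Curves

/-! ### Gauge transformations -/

theorem IsGaugeTransform.normal {g : Vertex L → SU2} {x y : Point L}
    (h : IsGaugeTransform S g x y) (v : Vertex L) (e : HalfEdge) :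
    y.normal v e = rot (g v) (x.normal v e) := by
  obtain ⟨i, b⟩ := e
  cases b
  · have := (h (edgeAt v (i, false))).2.1
    rw [← rot_eq_iff, target_edgeAt] at this
    exact this
  · exact rot_eq_iff.mpr (h (v, i)).1

theorem polygonVec_rot (g : SU2) (η : Fin 6 → ℝ) (N : Fin 6 → R3) (I : Fin 4) :
    polygonVec η (fun J => rot g (N J)) I = rot g (polygonVec η N I) := by
  fin_cases I <;> simp [polygonVec, rot_add, rot_smul]

theorem closedLen_rot (g : SU2) (η : Fin 6 → ℝ) (N : Fin 6 → R3) :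
    closedLen η (fun J => rot g (N J)) = closedLen η N := by
  simp only [closedLen, polygonVec_rot, rot_len]

theorem closedRho_rot (g : SU2) (η : Fin 6 → ℝ) (N : Fin 6 → R3) :
    closedRho η (fun J => rot g (N J)) = closedRho η N := by
  simp only [closedRho, polygonVec_rot, ← rot_cross, rot_angleAbout]

theorem reducedVariables_ηv (D : LoopChoice L) (S : Sections L) (x : Point L) (v : Vertex L) :
    (reducedVariables D S x).ηv v = closedLen (etaL D x v) (normalL D x v) := rfl

theorem reducedVariables_ρv (D : LoopChoice L) (S : Sections L) (x : Point L) (v : Vertex L) :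
    (reducedVariables D S x).ρv v = closedRho (etaL D x v) (normalL D x v) := rfl

/-- Only covariance of the normals is assumed. Thus it serves both for the invariance of `ϱ_e` and
for building a gauge transformation, where the law for `ξ` is still to be shown. -/
theorem zeta_gauge {g : Vertex L → SU2} {x y : Point L} (hx : Nondegenerate D x)
    (hN : ∀ v e, y.normal v e = rot (g v) (x.normal v e)) {e : Edge L} {α β : ℝ}
    (hα : (g (source e)).1 * (S.n e (x.V e)).1 = (S.n e (y.V e)).1 * expTau3 α)
    (hβ : (g (target e)).1 * (S.nt e (x.Vt e)).1 = (S.nt e (y.Vt e)).1 * expTau3 β) :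
    zeta D S y e = zeta D S x e + ((α - β : ℝ) : Real.Angle) := by
  obtain ⟨h1, h2, h3, h4⟩ := zeta_spec (S := S) hx e
  have hV : y.V e = rot (g (source e)) (x.V e) := by
    rw [← y.normal_source, hN, x.normal_source]
  have hVt : y.Vt e = rot (g (target e)) (x.Vt e) := by
    rw [← y.normal_target, hN, x.normal_target]
  have key := holonomyAngle_gauge h1 h2 h3 h4 (Subtype.ext hα : _ = _ * axial α)
    (Subtype.ext hβ : _ = _ * axial β)
  rw [zeta_eq, zeta_eq, hN, hN, ← key, ← hV, ← hVt]

theorem reducedVariables_gauge {g : Vertex L → SU2} {x y : Point L}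
    (hx : x ∈ constraintInterior D) (h : IsGaugeTransform S g x y) :
    reducedVariables D S x = reducedVariables D S y := by
  have hη : y.η = x.η := funext fun e => (h e).2.2.1
  have hηL : ∀ v, etaL D y v = etaL D x v := fun v => by funext I; rw [etaL, hη, etaL]
  have hN : ∀ v, normalL D y v = fun I => rot (g v) (normalL D x v I) := fun v => by
    funext I; exact h.normal v _
  refine ReducedVariables.ext hη.symm ?_ ?_ ?_
  · funext e
    obtain ⟨-, -, -, α, β, hα, hβ, hξ⟩ := h e
    change rho D S x e = rho D S y e
    rw [rho, rho, hξ, zeta_gauge (nondegenerate_of_constraint hx) h.normal hα hβ]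
    abel
  · funext v
    rw [reducedVariables_ηv, reducedVariables_ηv, hηL, hN, closedLen_rot]
  · funext v
    rw [reducedVariables_ρv, reducedVariables_ρv, hηL, hN, closedRho_rot]

/-- Two frames over the same unit vector differ by an element of the stabilizer of the third axis.
-/
theorem exists_expTau3 {g n n' : SU2} (h : rot (g * n) axis = rot n' axis) :
    ∃ α : ℝ, g.1 * n.1 = n'.1 * expTau3 α := by
  obtain ⟨α, hα⟩ := exists_axial (g := n'⁻¹ * (g * n)) (by rw [rot_mul, h, rot_inv_rot])
  refine ⟨α, ?_⟩
  have : g * n = n' * axial α := by rw [← hα]; group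
  exact congrArg Subtype.val this

/-- An oriented frame attached to a closed polygon. -/
theorem IsClosedPolygon.frame {η : Fin 6 → ℝ} {N : Fin 6 → R3} (h : IsClosedPolygon η N) :
    dir (polygonVec η N 2) ⬝ᵥ dir (polygonVec η N 2) = 1 ∧
    dir (polygonVec η N 0 ⨯₃ polygonVec η N 1) ⬝ᵥ dir (polygonVec η N 0 ⨯₃ polygonVec η N 1) = 1 ∧
    dir (polygonVec η N 2) ⬝ᵥ dir (polygonVec η N 0 ⨯₃ polygonVec η N 1) = 0 := by
  refine ⟨dir_unit (ne_zero_of_len_pos h.T2.pos.1), dir_unit h.cross_ne_zero, ?_⟩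
  rw [dir, smul_dotProduct, dot_dir_eq_zero h.dot_cross, smul_zero]

/-- Closed polygons with equal lengths and angles differ by the rotation that matches their frames,
vertex by vertex. The law for `ξ` is then automatic: the `ϱ_e` agree and `ζ_e` shifts by `α - β`. -/
theorem exists_gaugeTransform {x y : Point L} (hx : x ∈ constraintInterior D)
    (hy : y ∈ constraintInterior D) (h : reducedVariables D S x = reducedVariables D S y) :
    ∃ g : Vertex L → SU2, IsGaugeTransform S g x y := by
  have hη : x.η = y.η := congrArg ReducedVariables.η h
  have hηL : ∀ v, etaL D x v = etaL D y v := fun v => by funext I; rw [etaL, hη, etaL]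
  have hρ : ∀ e, rho D S x e = rho D S y e := fun e => congrFun (congrArg ReducedVariables.ρ h) e
  have hex : ∀ v, ∃ g : SU2, ∀ I, normalL D y v I = rot g (normalL D x v I) := by
    intro v
    have px := isClosedPolygon hx v
    have py := isClosedPolygon hy v
    obtain ⟨k1, a1, ka1⟩ := px.frame
    obtain ⟨k2, a2, ka2⟩ := py.frame
    obtain ⟨g1, g1k, g1a⟩ := exists_rot_frame (fun V => S.rot_nv v (V := V)) k1 a1 ka1
    obtain ⟨g2, g2k, g2a⟩ := exists_rot_frame (fun V => S.rot_nv v (V := V)) k2 a2 ka2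
    -- Both frames are compared with the standard one.
    refine ⟨g2 * g1⁻¹, fun I => ?_⟩
    have e1 := congrFun px.eq_closedPolygon I
    have e2 := congrFun py.eq_closedPolygon I
    have hl : closedLen (etaL D x v) (normalL D x v) = closedLen (etaL D y v) (normalL D y v) :=
      congrFun (congrArg ReducedVariables.ηv h) v
    have hr : closedRho (etaL D x v) (normalL D x v) = closedRho (etaL D y v) (normalL D y v) :=
      congrFun (congrArg ReducedVariables.ρv h) v
    rw [e2, e1, rot_closedPolygon, hl, hr, ← g1k, ← g1a, ← g2k, ← g2a, rot_mul, rot_mul,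
      rot_inv_rot, rot_inv_rot, hηL]
  choose g hg using hex
  have hN : ∀ v e, y.normal v e = rot (g v) (x.normal v e) := fun v e => by
    rw [normal_eq_normalL D, hg, ← normal_eq_normalL D]
  refine ⟨g, fun e => ?_⟩
  have hV : y.V e = rot (g (source e)) (x.V e) := by
    rw [← y.normal_source, hN, x.normal_source]
  have hVt : y.Vt e = rot (g (target e)) (x.Vt e) := by
    rw [← y.normal_target, hN, x.normal_target]
  obtain ⟨α, hα⟩ := exists_expTau3 (g := g (source e)) (n := S.n e (x.V e)) (n' := S.n e (y.V e))
    (by rw [rot_mul, S.rot_n e (x.V_unit e), S.rot_n e (y.V_unit e), hV])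
  obtain ⟨β, hβ⟩ := exists_expTau3 (g := g (target e)) (n := S.nt e (x.Vt e))
    (n' := S.nt e (y.Vt e))
    (by rw [rot_mul, S.rot_nt e (x.Vt_unit e), S.rot_nt e (y.Vt_unit e), hVt, rot_neg])
  refine ⟨rot_eq_iff.mp hV, rot_eq_iff.mp hVt, congrFun hη.symm e, α, β, hα, hβ, ?_⟩
  rw [xi_eq (D := D) S y, xi_eq (D := D) S x,
    zeta_gauge (nondegenerate_of_constraint hx) hN hα hβ, hρ, add_assoc]

/-! ### The reduced space -/

theorem reducedVariables_mem {x : Point L} (hx : x ∈ constraintInterior D) :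
    reducedVariables D S x ∈ reducedRange D := by
  refine ⟨hx.1, fun v => ?_⟩
  obtain ⟨-, T0, T1, T2, T3⟩ := hx.2 v
  exact ⟨T0, T1, T2, T3⟩

/-- The constraint surface contains a point with given reduced variables and given frames at the
vertices. -/
theorem exists_closed_point {q : ReducedVariables L} (hq : q ∈ reducedRange D)
    {k a : Vertex L → R3} (hk : ∀ v, k v ⬝ᵥ k v = 1) (ha : ∀ v, a v ⬝ᵥ a v = 1)
    (hka : ∀ v, k v ⬝ᵥ a v = 0) :
    ∃ x : constraintInterior D, reducedVariables D S x.1 = q ∧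
      ∀ v, normalL D x.1 v = closedPolygon (k v) (a v) (q.ηv v) (q.ρv v)
        (fun I => q.η (edgeAt v (D.label v I))) := by
  obtain ⟨hη, hq⟩ := hq
  have spec : ∀ v, _ := fun v =>
    closedPolygon_spec (q.ρv v) (hk v) (ha v) (hka v) (fun I => hη (edgeAt v (D.label v I)))
      (hq v).1 (hq v).2.1 (hq v).2.2.1 (hq v).2.2.2 rfl
  obtain ⟨x, hN, hxη, hρ⟩ := exists_point D S (fun v => (spec v).1.unit) hη q.ρ
  have hηL : ∀ v, etaL D x v = fun I => q.η (edgeAt v (D.label v I)) := fun v => by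
    funext I; rw [etaL, hxη]
  have hpoly : ∀ v, IsClosedPolygon (etaL D x v) (normalL D x v) := fun v => by
    rw [hN, hηL]; exact (spec v).1
  refine ⟨⟨x, fun e => by rw [hxη]; exact hη e, fun v => ⟨?_, (hpoly v).T0, (hpoly v).T1,
    (hpoly v).T2, (hpoly v).T3⟩⟩, ?_, hN⟩
  · rw [gauss_eq D, neg_eq_zero, etaVec_eq, polygonVec_three, ← (hpoly v).sum]; abel
  · refine ReducedVariables.ext hxη (funext hρ) ?_ ?_
    · funext v
      rw [reducedVariables_ηv, hN, hηL]; exact (spec v).2.1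
    · funext v
      rw [reducedVariables_ρv, hN, hηL]; exact (spec v).2.2

/-- The reduced variables as functions on the reduced space. -/
def reducedChart (D : LoopChoice L) (S : Sections L) : ReducedSpace D S → ReducedVariables L :=
  Quot.lift (fun x => reducedVariables D S x.1) fun x _ ⟨_, hg⟩ => reducedVariables_gauge x.2 hg

theorem reducedChart_injective (D : LoopChoice L) (S : Sections L) :
    Function.Injective (reducedChart D S) := by
  intro p q
  induction p using Quot.ind with | _ x
  induction q using Quot.ind with | _ y
  exact fun h => Quot.sound (exists_gaugeTransform x.2 y.2 h)

theorem reducedChart_mem (p : ReducedSpace D S) : reducedChart D S p ∈ reducedRange D := by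
  induction p using Quot.ind with | _ x
  exact reducedVariables_mem x.2

theorem reducedChart_bijOn (D : LoopChoice L) (S : Sections L) :
    Set.BijOn (reducedChart D S) Set.univ (reducedRange D) := by
  refine ⟨fun p _ => reducedChart_mem p, (reducedChart_injective D S).injOn, fun q hq => ?_⟩
  -- Any orthonormal pair would do at each vertex, since only the class of the point matters.
  obtain ⟨x, hx, -⟩ := exists_closed_point (S := S) hq (k := fun _ => axis)
    (a := fun _ => ![1, 0, 0]) (fun _ => axis_unit)
    (fun _ => by simp [dotProduct, Fin.sum_univ_three])
    (fun _ => by simp [axis, dotProduct, Fin.sum_univ_three])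
  exact ⟨Quot.mk _ x, trivial, hx⟩

/-! ### Curves in the constraint surface and lifting of reduced curves. -/

theorem smooth_reducedVariables {c : ℝ → constraintInterior D} {t : ℝ}
    (hr : EdgeRegular S (c t).1) (hc : Point.SmoothAt (fun s => (c s).1) t) :
    ReducedVariables.SmoothAt (fun s => reducedVariables D S (c s).1) t := by
  have hpoly := fun v => Filter.Eventually.of_forall (f := 𝓝 t)
    fun s => isClosedPolygon (c s).2 v
  exact ⟨hc.2.2.1, smoothAngleAt_rho hc hr
      (Filter.Eventually.of_forall fun s => nondegenerate_of_constraint (c s).2),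
    fun v => contDiffAt_closedLen (contDiffAt_etaL hc v) (contDiffAt_normalL hc v)
      (isClosedPolygon (c t).2 v),
    fun v => smoothAngleAt_closedRho (contDiffAt_etaL hc v) (contDiffAt_normalL hc v) (hpoly v)⟩

theorem potential_eq_reducedPotential [∀ i, NeZero (L i)] (a κ : ℝ)
    {c : ℝ → constraintInterior D} {t : ℝ} (hr : EdgeRegular S (c t).1)
    (hc : Point.SmoothAt (fun s => (c s).1) t) :
    potential a κ S (fun s => (c s).1) t =
      reducedPotential a κ (fun s => reducedVariables D S (c s).1) t := by
  have hpoly := fun v => Filter.Eventually.of_forall (f := 𝓝 t)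
    fun s => isClosedPolygon (c s).2 v
  have key : ∀ v, _ := fun v =>
    closed_spin_sum (contDiffAt_etaL hc v) (contDiffAt_normalL hc v) (hpoly v)
  refine (potential_eq a κ hc hr
    (Filter.Eventually.of_forall fun s => nondegenerate_of_constraint (c s).2)).trans ?_
  simp only [key]
  rfl

/-- The polygons of `x` supply a frame at each vertex. Rebuilding every `q s` in these fixed frames
gives a section through `x`, smooth because the polygon formulas are. -/
theorem exists_smooth_lift (q : ℝ → ReducedSpace D S) (t : ℝ) (x : constraintInterior D)
    (hr : EdgeRegular S x.1) (hx : Quot.mk _ x = q t)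
    (hq : ReducedVariables.SmoothAt (fun s => reducedChart D S (q s)) t) :
    ∃ c : ℝ → constraintInterior D, c t = x ∧ (∀ s, Quot.mk _ (c s) = q s) ∧
      Point.SmoothAt (fun s => (c s).1) t := by
  have px := isClosedPolygon x.2
  have hk := fun v => (px v).frame.1
  have ha := fun v => (px v).frame.2.1
  have hka := fun v => (px v).frame.2.2
  choose c hcq hcN using fun s =>
    exists_closed_point (S := S) (reducedChart_mem (q s)) hk ha hka
  have hxq : reducedVariables D S x.1 = reducedChart D S (q t) := by rw [← hx]; rfl
  -- At time `t` the rebuilt point has the frames and the reduced variables of `x`, and these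
  -- determine normals, `η` and `ξ`.
  have hct : c t = x := by
    apply Subtype.ext
    refine Point.ext_of_normalL (D := D) (S := S) (fun v => ?_) ?_ fun e => ?_
    · rw [hcN, ← hxq]; exact ((px v).eq_closedPolygon).symm
    · exact congrArg ReducedVariables.η ((hcq t).trans hxq.symm)
    · exact congrFun (congrArg ReducedVariables.ρ ((hcq t).trans hxq.symm)) e
  refine ⟨c, hct, fun s => reducedChart_injective D S (hcq s), ?_⟩
  obtain ⟨sη, sρ, sηv, sρv⟩ := hq
  have hη : ∀ s, (c s).1.η = (reducedChart D S (q s)).η := fun s =>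
    congrArg ReducedVariables.η (hcq s)
  have hρ : ∀ s, rho D S (c s).1 = (reducedChart D S (q s)).ρ := fun s =>
    congrArg ReducedVariables.ρ (hcq s)
  have hN : ∀ v I, ContDiffAt ℝ ∞ (fun s => normalL D (c s).1 v I) t := fun v I => by
    simp only [hcN]
    obtain ⟨T0, T1, T2, T3⟩ := (reducedChart_mem (q t)).2 v
    exact contDiffAt_closedPolygon (sηv v) (sρv v) (fun I => sη _) (hk v) (ha v) (hka v)
      T0 T1 T2 T3 I
  have hV := contDiffAt_V_of_normalL hN
  have hVt := contDiffAt_Vt_of_normalL hN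
  refine ⟨hV, hVt, fun e => ?_, smoothAngleAt_xi hV hVt (D := D) (S := S) ?_ ?_ fun e => ?_⟩
  · simp only [hη]; exact sη e
  · rw [hct]; exact hr
  · exact Filter.Eventually.of_forall fun s => nondegenerate_of_constraint (c s).2
  · simp only [hρ]; exact sρ e

end Variables

end TwistedGeometry

end

open TwistedGeometry
theorem theorem1 (L : Fin 3 → ℕ) [∀ i, NeZero (L i)] (hL : ∀ i, 2 ≤ L i)
    (D : LoopChoice L) (S : Sections L) (a κ : ℝ) (ha : 0 < a) (hκ : 0 < κ) :
    -- the new variables parametrize the interior of `P_γ^+`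
    Set.BijOn (newVariables D S) (interiorP D) (variablesRange D) ∧
    -- smoothly in both directions, and the potential is the stated one
    (∀ (c : ℝ → Point L) (t : ℝ), (∀ᶠ s in 𝓝 t, c s ∈ interiorP D) →
      EdgeRegular S (c t) → VertexRegular S (c t) →
      (Point.SmoothAt c t ↔ Variables.SmoothAt (fun s => newVariables D S (c s)) t) ∧
      (Point.SmoothAt c t →
        potential a κ S c t = newPotential a κ S (fun s => newVariables D S (c s)) t)) ∧
    -- the reduced variables descend to the interior of `H_γ^+` and parametrize it
    ∃ Φ : ReducedSpace D S → ReducedVariables L,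
      (∀ x : constraintInterior D, Φ (Quot.mk _ x) = reducedVariables D S x.1) ∧
      Set.BijOn Φ Set.univ (reducedRange D) ∧
      -- the restriction of the potential to the constraint surface is the pullback of the
      -- stated potential under the projection to the interior of `H_γ^+`
      (∀ (c : ℝ → constraintInterior D) (t : ℝ), EdgeRegular S (c t).1 →
        Point.SmoothAt (fun s => (c s).1) t →
        ReducedVariables.SmoothAt (fun s => Φ (Quot.mk _ (c s))) t ∧
        potential a κ S (fun s => (c s).1) t =
          reducedPotential a κ (fun s => Φ (Quot.mk _ (c s))) t) ∧
      -- the projection is a submersion: smooth curves in the reduced space lift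
      (∀ (q : ℝ → ReducedSpace D S) (t : ℝ) (x : constraintInterior D),
        EdgeRegular S x.1 → Quot.mk _ x = q t → ReducedVariables.SmoothAt (fun s => Φ (q s)) t →
        ∃ c : ℝ → constraintInterior D, c t = x ∧ (∀ s, Quot.mk _ (c s) = q s) ∧
          Point.SmoothAt (fun s => (c s).1) t) := by
  refine ⟨newVariables_bijOn D S, fun c t hi hr hv =>
      ⟨⟨fun hc => smooth_newVariables hc hi hr hv, fun hq => smooth_of_newVariables hq hi hr hv⟩,
        fun hc => potential_eq_newPotential a κ hc hi hr hv⟩,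
    reducedChart D S, fun _ => rfl, reducedChart_bijOn D S,
    fun c t hr hc => ⟨smooth_reducedVariables hr hc, potential_eq_reducedPotential a κ hr hc⟩,
    exists_smooth_lift⟩
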